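/- Let $q\in(0,1)$ and let $z$ be a $q$-normal operator on a Hilbert space $\mathcal H\neq\{0\}$, i.e. $z$ is densely defined and closed and $zz^*=q^2z^*z$ (with equality of domains). Let $|z|$ be the positive self-adjoint operator with $|z|^2=z^*z$. Then $X:=\mathrm{spec}(|z|)\subset[0,\infty)$ is closed, contains $0$ and satisfies $qX=X$. Let $\alpha_q(f)(x)=f(qx)$ for $x\in X$ and $\alpha_q(f)(\infty)=f(\infty)$, and let $C(X\cup\{\infty\})\rtimes\mathbb Z$ be the enveloping C*-algebra generated by $C(X\cup\{\infty\})$ and a unitary $U$ with $UfU^*=\alpha_q(f)$ (if $X$ is compact, $\infty$ is an isolated point). Let $$C^*_0(z,z^*)=\overline{\Big\{\sum_{\text{finite}}f_kU^k:\ f_k\in C_0(X),\ f_k(0)=0\text{ if }k\neq0\Big\}},\qquad \mathcal A:=C^*_0(z,z^*)\dotplus\mathbb C1\subset C(X\cup\{\infty\})\rtimes\mathbb Z .$$ Index pairing. An even Fredholm module over $\mathcal A$ is a pair $(\pi_-,\pi_+)$ of (not necessarily unital) *-representations on a Hilbert space $\mathcal K$ such that $\pi_+(a)-\pi_-(a)$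 is compact for all $a\in\mathcal A$. Its index pairing with the class of a self-adjoint projection $p\in\mathrm{Mat}_N(\mathcal A)$ is $$\langle[(\pi_-,\pi_+)],[p]\rangle=\mathrm{ind}\big(\pi_+(p):\pi_-(p)\mathcal K^N\to\pi_+(p)\mathcal K^N\big),\qquad \mathrm{ind}\,T=\dim\ker T-\dim\mathrm{coker}\,T .$$ Fredholm modules. Let $\mathrm{ev}_0,\mathrm{ev}_\infty:\mathcal A\to\mathbb C$ be the characters with $\mathrm{ev}_0(\sum f_kU^k)=\sum f_k(0)$ and $\mathrm{ev}_\infty(\sum f_kU^k)=f_0(\infty)$. The pair $(\mathrm{ev}_\infty,0)$ acts on $\mathbb C$. For $y\in(q,1]\cap X$ let $\pi_y$ be the representation of $\mathcal A$ on $\ell_2(\mathbb Z)$ determined by $\pi_y(U)e_k=e_{k-1}$ and $\pi_y(f)e_k=f(q^ky)e_k$. Let $\Pi_+,\Pi_-$ be the orthogonal projections onto $\overline{\mathrm{span}}\{e_k:k>0\}$ and $\overline{\mathrm{span}}\{e_k:k\le0\}$, and let $(\pi_0\oplus\pi_\infty)(a)=\mathrm{ev}_0(a)\Pi_++\mathrm{ev}_\infty(a)\Pi_-$.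 Projections. Let $n\in\mathbb N$, $n\ge1$, and put $c=q^{-n(n-1)}$, $d=q^{n(n+1)}$. Writing $t$ for the variable in $X$ (so $t=|z|$), the Bott projections are $$P_n=\begin{pmatrix}\frac{c\,t^{2n}}{1+c\,t^{2n}}&\frac{\sqrt c\,t^n}{1+c\,t^{2n}}U^{*n}\\[4pt]\frac{\sqrt d\,t^n}{1+d\,t^{2n}}U^n&\frac1{1+d\,t^{2n}}\end{pmatrix},\qquad P_{-n}=\begin{pmatrix}\frac{d\,t^{2n}}{1+d\,t^{2n}}&\frac{\sqrt d\,t^n}{1+d\,t^{2n}}U^{n}\\[4pt]\frac{\sqrt c\,t^n}{1+c\,t^{2n}}U^{*n}&\frac1{1+c\,t^{2n}}\end{pmatrix}.$$ Given any continuous $\phi:[q,1]\to[0,1]$ with $\phi(q)=0$, $\phi(1)=1$, let $h=\sqrt{\phi(1-\phi)}$ on $[q,1]$ and $h=0$ elsewhere; let $f_n=\phi$ on $[q,1]$, $f_n=1$ on $(1,q^{-n+1})$, $f_n(t)=1-\phi(q^nt)$ on $[q^{-n+1},q^{-n}]$, and $f_n=0$ elsewhere. The Powers–Rieffel type projection is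 $R_n=U^nh+f_n+hU^{*n}$. Theorem. $P_{\pm n}\in\mathrm{Mat}_2(\mathcal A)$ and $R_n\in\mathcal A$ are self-adjoint projections, $(\mathrm{ev}_\infty,0)$ and, for every $y\in(q,1]\cap X$, $(\pi_y,\pi_0\oplus\pi_\infty)$ are even Fredholm modules over $\mathcal A$, the operators defining the pairings are Fredholm, and $$\langle[(\mathrm{ev}_\infty,0)],[P_{\pm n}]\rangle=1,\qquad \langle[(\mathrm{ev}_\infty,0)],[R_n]\rangle=0,\qquad \langle[(\mathrm{ev}_\infty,0)],[1]\rangle=1,$$ $$\langle[(\pi_y,\pi_0\oplus\pi_\infty)],[P_{\pm n}]\rangle=\pm n,\qquad \langle[(\pi_y,\pi_0\oplus\pi_\infty)],[R_n]\rangle=n,\qquad \langle[(\pi_y,\pi_0\oplus\pi_\infty)],[1]\rangle=0 .$$ -/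

import Mathlib

open scoped ENNReal InnerProductSpace LinearPMap Topology
open Filter Set

noncomputable section

namespace QPlane

/-! ### Unbounded operators, `q`-normal operators, modulus and spectrum -/

section Unbounded

variable {E : Type*} [NormedAddCommGroup E] [InnerProductSpace ℂ E]

/-- The product `g f` of two unbounded operators, on the maximal domain
`{x ∈ dom f | f x ∈ dom g}`. -/
def pcomp (g f : E →ₗ.[ℂ] E) : E →ₗ.[ℂ] E :=
  g.comp (f.domRestrict ((g.domain.comap f.toFun).map f.domain.subtype)) (by
    intro x
    obtain ⟨y, hy, hyx⟩ := x.2.1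
    rw [LinearPMap.domRestrict_apply (y := y) hyx.symm]
    exact hy)

theorem mem_pcomp_domain (g f : E →ₗ.[ℂ] E) (x : E) :
    x ∈ (pcomp g f).domain ↔ ∃ h : x ∈ f.domain, f ⟨x, h⟩ ∈ g.domain := by
  constructor
  · rintro ⟨⟨y, hy, rfl⟩, h2⟩
    exact ⟨y.2, hy⟩
  · rintro ⟨h, h2⟩
    exact ⟨⟨⟨x, h⟩, h2, rfl⟩, h⟩

theorem pcomp_apply (g f : E →ₗ.[ℂ] E) (x : E) (hx : x ∈ (pcomp g f).domain)
    (h : x ∈ f.domain) (h2 : f ⟨x, h⟩ ∈ g.domain) :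
    pcomp g f ⟨x, hx⟩ = g ⟨f ⟨x, h⟩, h2⟩ := rfl

/-- `z` is `q`-normal: densely defined, closed, and `z z* = q² z* z`, including the equality of the
domains of both sides. -/
structure IsQNormal [CompleteSpace E] (q : ℝ) (z : E →ₗ.[ℂ] E) : Prop where
  dense : Dense (z.domain : Set E)
  closed : z.IsClosed
  rel : pcomp z z† = ((q : ℂ) ^ 2) • pcomp z† z

/-- `T = |z|`: the positive self-adjoint operator whose square is `z* z`. -/
structure IsModulus [CompleteSpace E] (z T : E →ₗ.[ℂ] E) : Prop where
  selfAdjoint : IsSelfAdjoint T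
  nonneg : ∀ x : T.domain, 0 ≤ (⟪(x : E), T x⟫_ℂ).re
  sq : pcomp T T = pcomp z† z

/-- `l` is in the resolvent set of `T`: the operator `T - l : dom T → E` has a bounded inverse
defined on all of `E`. -/
def InResolvent (T : E →ₗ.[ℂ] E) (l : ℂ) : Prop :=
  ∃ R : E →L[ℂ] E,
    (∀ y : E, ∃ h : R y ∈ T.domain, T ⟨R y, h⟩ - l • R y = y) ∧
    ∀ x : T.domain, R (T x - l • (x : E)) = x

/-- The real points of the spectrum of an unbounded operator (for a self-adjoint operator this is
the whole spectrum). -/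
def realSpectrum (T : E →ₗ.[ℂ] E) : Set ℝ := {t : ℝ | ¬ InResolvent T (t : ℂ)}

end Unbounded

/-! ### The `q`-invariant spaces `X` and continuous functions on `X ∪ {∞}` -/

/-- A closed subset of `[0, ∞)` that contains `0` and satisfies `q X = X`, where `0 < q < 1`. -/
structure QSpace (q : ℝ) where
  carrier : Set ℝ
  q_pos : 0 < q
  q_lt_one : q < 1
  closed : IsClosed carrier
  nonneg : ∀ x ∈ carrier, 0 ≤ x
  zero_mem : 0 ∈ carrier
  mul_mem : ∀ x ∈ carrier, q * x ∈ carrier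
  of_mul_mem : ∀ x, q * x ∈ carrier → x ∈ carrier

variable {q : ℝ} (X : QSpace q)

/-- The space `X ∪ {∞}` (for unbounded `X` the one-point compactification; for compact `X`,
an isolated point is added). -/
abbrev Pts : Type := OnePoint X.carrier

variable {X} in
/-- A point of `X`, as a point of `X ∪ {∞}`. -/
abbrev pt (x : ℝ) (hx : x ∈ X.carrier) : Pts X := ((⟨x, hx⟩ : X.carrier) : OnePoint X.carrier)

/-- The point `0` of `X ∪ {∞}`. -/
abbrev pt0 : Pts X := pt 0 X.zero_mem

/-- The homeomorphism `x ↦ q x` of `X`. -/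
def scale : X.carrier ≃ₜ X.carrier where
  toFun x := ⟨q * x, X.mul_mem x x.2⟩
  invFun x := ⟨q⁻¹ * x, X.of_mul_mem _ (by
    rw [mul_inv_cancel_left₀ X.q_pos.ne']; exact x.2)⟩
  left_inv x := by ext; simp [inv_mul_cancel_left₀ X.q_pos.ne']
  right_inv x := by ext; simp [mul_inv_cancel_left₀ X.q_pos.ne']
  continuous_toFun := by fun_prop
  continuous_invFun := by fun_prop

/-- The automorphism `α_q(f)(x) = f(q x)`, with `α_q(f)(∞) = f(∞)`. -/
def alpha : C(Pts X, ℂ) →⋆ₐ[ℂ] C(Pts X, ℂ) :=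
  ContinuousMap.compStarAlgHom' ℂ ℂ ⟨(scale X).onePointCongr, (scale X).onePointCongr.continuous⟩

theorem alpha_pt (f : C(Pts X, ℂ)) (x : ℝ) (hx : x ∈ X.carrier) :
    alpha X f (pt x hx) = f (pt (q * x) (X.mul_mem x hx)) := rfl

theorem alpha_infty (f : C(Pts X, ℂ)) : alpha X f OnePoint.infty = f OnePoint.infty := rfl

theorem alpha_pt0 (f : C(Pts X, ℂ)) : alpha X f (pt0 X) = f (pt0 X) := by
  rw [pt0, alpha_pt]; simp

/-- The function on `X ∪ {∞}` given by a real function `g` on `[0,∞)` with limit `l` at infinity. -/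
def mkFun (g : ℝ → ℝ) (l : ℝ) (hg : ContinuousOn g (Ici 0)) (hl : Tendsto g atTop (𝓝 l)) :
    C(Pts X, ℂ) :=
  OnePoint.continuousMapMk
    ⟨fun x : X.carrier => ((g x : ℝ) : ℂ), by
      refine Complex.continuous_ofReal.comp ?_
      exact hg.comp_continuous continuous_subtype_val (fun x => X.nonneg x x.2)⟩ (l : ℂ) (by
      refine (Complex.continuous_ofReal.tendsto l).comp (hl.comp ?_)
      have h1 : Tendsto (Subtype.val : X.carrier → ℝ) (cocompact X.carrier) (cocompact ℝ) :=
        X.closed.isClosedEmbedding_subtypeVal.tendsto_cocompact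
      rw [coclosedCompact_eq_cocompact]
      rw [tendsto_atTop]
      intro b
      have h2 : ∀ᶠ t in cocompact ℝ, t ∉ Icc 0 b := isCompact_Icc.compl_mem_cocompact
      filter_upwards [h1.eventually h2] with x hx
      by_contra hb
      exact hx ⟨X.nonneg x x.2, (not_le.1 hb).le⟩)

theorem mkFun_pt (g : ℝ → ℝ) (l : ℝ) (hg hl) (x : ℝ) (hx : x ∈ X.carrier) :
    mkFun X g l hg hl (pt x hx) = (g x : ℂ) := rfl

theorem mkFun_infty (g : ℝ → ℝ) (l : ℝ) (hg hl) :
    mkFun X g l hg hl OnePoint.infty = (l : ℂ) := rfl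

/-! ### The crossed product -/

/-- A covariant pair of `C(X ∪ {∞})` and `ℤ` in a nonzero unital C*-algebra: a unital
*-homomorphism `ρ` and a unitary `U` with `U ρ(f) U* = ρ(α_q(f))`. -/
structure CovPair where
  B : Type
  [inst : CStarAlgebra B]
  [nontriv : Nontrivial B]
  ρ : C(Pts X, ℂ) →⋆ₐ[ℂ] B
  U : unitary B
  cov : ∀ f, (U : B) * ρ f * star (U : B) = ρ (alpha X f)

attribute [instance] CovPair.inst CovPair.nontriv

/-- The product of the targets of all covariant pairs, i.e. bounded families with the supremum
norm.  The enveloping C*-algebra `C(X ∪ {∞}) ⋊ ℤ` is the C*-subalgebra of it generated by the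
functions `fn f` and the unitary `gen`: the norm of a finite sum `∑ f_k U^k` is the supremum of its
norms over all covariant pairs. -/
abbrev Univ : Type 1 := lp (fun r : CovPair X => r.B) ∞

/-- The canonical homomorphism on functions. -/
def fn : C(Pts X, ℂ) →⋆ₐ[ℂ] Univ X where
  toFun f := ⟨fun r => r.ρ f, memℓp_infty ⟨‖f‖, by
    rintro _ ⟨r, rfl⟩
    exact NonUnitalStarAlgHom.norm_apply_le r.ρ f⟩⟩
  map_one' := by ext r; simp
  map_mul' f g := by ext r; simp
  map_zero' := by ext r; simp
  map_add' f g := by ext r; exact map_add r.ρ f g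
  commutes' c := by ext r; exact r.ρ.toAlgHom.commutes c
  map_star' f := by ext r; exact map_star r.ρ f

/-- The canonical unitary implementing the action. -/
def gen : unitary (Univ X) :=
  ⟨⟨fun r => (r.U : r.B), memℓp_infty ⟨1, by
    rintro _ ⟨r, rfl⟩
    exact (CStarRing.norm_of_mem_unitary r.U.2).le⟩⟩, by
    rw [Unitary.mem_iff]
    constructor
    · ext r; exact Unitary.star_mul_self_of_mem r.U.2
    · ext r; exact Unitary.mul_star_self_of_mem r.U.2⟩

theorem gen_cov (f : C(Pts X, ℂ)) :
    (gen X : Univ X) * fn X f * star (gen X : Univ X) = fn X (alpha X f) := by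
  ext r; exact r.cov f

/-- The evaluation of the universal pair in a given covariant pair, a *-homomorphism. -/
def CovPair.eval (r : CovPair X) : Univ X →⋆ₐ[ℂ] r.B where
  toFun a := a r
  map_one' := rfl
  map_mul' _ _ := rfl
  map_zero' := rfl
  map_add' _ _ := rfl
  commutes' _ := rfl
  map_star' _ := rfl

/-! ### The C*-algebra of a `q`-normal operator and its unitization -/

/-- The elements `f U^k`, `k ∈ ℤ`, with `f ∈ C_0(X)` and `f(0) = 0` if `k ≠ 0`. -/
def czzGens : Set (Univ X) :=
  {a | ∃ (f : C(Pts X, ℂ)) (k : ℤ), f OnePoint.infty = 0 ∧ (k ≠ 0 → f (pt0 X) = 0) ∧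
    a = fn X f * ((gen X ^ k : unitary (Univ X)) : Univ X)}

theorem gen_zpow_cov (k : ℤ) : ∀ f : C(Pts X, ℂ), ∃ g : C(Pts X, ℂ),
    g OnePoint.infty = f OnePoint.infty ∧ g (pt0 X) = f (pt0 X) ∧
    ((gen X ^ k : unitary (Univ X)) : Univ X) * fn X f
      = fn X g * ((gen X ^ k : unitary (Univ X)) : Univ X) := by
  have hs : star (gen X : Univ X) * (gen X : Univ X) = 1 :=
    Unitary.star_mul_self_of_mem (gen X).2
  have step : ∀ f, (gen X : Univ X) * fn X f = fn X (alpha X f) * (gen X : Univ X) := by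
    intro f
    rw [← gen_cov, mul_assoc, hs, mul_one]
  induction k with
  | zero => intro f; exact ⟨f, rfl, rfl, by simp⟩
  | succ k ih =>
    intro f
    obtain ⟨g, h1, h2, h3⟩ := ih (alpha X f)
    refine ⟨g, by rw [h1, alpha_infty], by rw [h2, alpha_pt0], ?_⟩
    rw [zpow_add_one, Submonoid.coe_mul, mul_assoc, step, ← mul_assoc, h3, mul_assoc]
  | pred k ih =>
    intro f
    let f' : C(Pts X, ℂ) :=
      f.comp ⟨(scale X).onePointCongr.symm, (scale X).onePointCongr.symm.continuous⟩
    have hf : alpha X f' = f := by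
      ext x
      exact congrArg f ((scale X).onePointCongr.symm_apply_apply x)
    obtain ⟨g, h1, h2, h3⟩ := ih f'
    refine ⟨g, by rw [h1, ← alpha_infty, hf], by rw [h2, ← alpha_pt0, hf], ?_⟩
    have hinv : ((gen X)⁻¹ : unitary (Univ X)) = star (gen X) := rfl
    have step' : star (gen X : Univ X) * fn X f = fn X f' * star (gen X : Univ X) := by
      have := step f'
      rw [hf] at this
      have hs' : (gen X : Univ X) * star (gen X : Univ X) = 1 :=
        Unitary.mul_star_self_of_mem (gen X).2
      calc star (gen X : Univ X) * fn X f
          = star (gen X : Univ X) * (fn X f * (gen X : Univ X)) * star (gen X : Univ X) := by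
            rw [mul_assoc, mul_assoc, hs', mul_one]
        _ = _ := by rw [← this, ← mul_assoc, hs, one_mul]
    rw [zpow_sub_one, hinv, Submonoid.coe_mul, Unitary.coe_star, mul_assoc, step', ← mul_assoc, h3,
      mul_assoc]

theorem czzGens_mul {a b : Univ X} (ha : a ∈ czzGens X) (hb : b ∈ czzGens X) :
    a * b ∈ czzGens X := by
  obtain ⟨f, k, hf1, hf2, rfl⟩ := ha
  obtain ⟨g, l, hg1, hg2, rfl⟩ := hb
  obtain ⟨g', h1, h2, h3⟩ := gen_zpow_cov X k g
  refine ⟨f * g', k + l, ?_, ?_, ?_⟩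
  · simp [hf1]
  · intro hkl
    by_cases hk : k = 0
    · have hl : l ≠ 0 := by omega
      simp [h2, hg2 hl]
    · simp [hf2 hk]
  · rw [map_mul, zpow_add, Submonoid.coe_mul, mul_assoc, ← mul_assoc _ (fn X g), h3]
    simp only [mul_assoc]

theorem czzGens_star {a : Univ X} (ha : a ∈ czzGens X) : star a ∈ czzGens X := by
  obtain ⟨f, k, hf1, hf2, rfl⟩ := ha
  obtain ⟨g, h1, h2, h3⟩ := gen_zpow_cov X (-k) (star f)
  refine ⟨g, -k, ?_, ?_, ?_⟩
  · simp [h1, hf1]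
  · intro hk
    have hk' : k ≠ 0 := by simpa using hk
    simp [h2, hf2 hk']
  · rw [star_mul, ← map_star, ← h3, zpow_neg]
    rfl

/-- The finite sums `∑ f_k U^k` with `f_k ∈ C_0(X)` and `f_k(0) = 0` for `k ≠ 0`. -/
def czzAlg : NonUnitalStarSubalgebra ℂ (Univ X) where
  toSubmodule := Submodule.span ℂ (czzGens X)
  mul_mem' {a b} ha hb := by
    change a ∈ Submodule.span ℂ (czzGens X) at ha
    change b ∈ Submodule.span ℂ (czzGens X) at hb
    change a * b ∈ Submodule.span ℂ (czzGens X)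
    have h := Submodule.mul_mem_mul ha hb
    rw [Submodule.span_mul_span] at h
    refine Submodule.span_mono ?_ h
    rintro _ ⟨x, hx, y, hy, rfl⟩
    exact czzGens_mul X hx hy
  star_mem' {a} ha := by
    change a ∈ Submodule.span ℂ (czzGens X) at ha
    change star a ∈ Submodule.span ℂ (czzGens X)
    induction ha using Submodule.span_induction with
    | mem x hx => exact Submodule.subset_span (czzGens_star X hx)
    | zero => simp
    | add x y _ _ hx hy => rw [star_add]; exact add_mem hx hy
    | smul c x _ hx => rw [star_smul]; exact Submodule.smul_mem _ _ hx

/-- The C*-algebra `C*_0(z, z*)` with `X = spec |z|`: the norm closure of the set of finite sums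
`∑ f_k U^k` with `f_k ∈ C_0(X)` and `f_k(0) = 0` for `k ≠ 0`. -/
def Czz : NonUnitalStarSubalgebra ℂ (Univ X) := (czzAlg X).topologicalClosure

/-- The unitization `C*_0(z, z*) ∔ ℂ 1`. The unit `1` is not in `Czz`
since `CovPair.eval` at the pair `evInftyPair` below vanishes on `Czz`. -/
def CzzOne : StarSubalgebra ℂ (Univ X) where
  carrier := {a | ∃ b ∈ Czz X, ∃ c : ℂ, a = b + c • (1 : Univ X)}
  mul_mem' := by
    rintro _ _ ⟨b, hb, c, rfl⟩ ⟨b', hb', c', rfl⟩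
    refine ⟨b * b' + c' • b + c • b', ?_, c * c', ?_⟩
    · exact add_mem (add_mem (mul_mem hb hb') (SMulMemClass.smul_mem _ hb))
        (SMulMemClass.smul_mem _ hb')
    · rw [mul_add, add_mul, add_mul, smul_mul_assoc, one_mul, mul_smul_comm, mul_one,
        smul_mul_assoc, one_mul, smul_smul]
      abel
  add_mem' := by
    rintro _ _ ⟨b, hb, c, rfl⟩ ⟨b', hb', c', rfl⟩
    refine ⟨b + b', add_mem hb hb', c + c', ?_⟩
    rw [add_smul]; abel
  algebraMap_mem' c := ⟨0, zero_mem _, c, by rw [zero_add, Algebra.algebraMap_eq_smul_one]⟩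
  star_mem' := by
    rintro _ ⟨b, hb, c, rfl⟩
    exact ⟨star b, star_mem hb, star c, by simp⟩

theorem czzGens_subset {a : Univ X} (ha : a ∈ czzGens X) : a ∈ Czz X :=
  subset_closure (Submodule.subset_span ha)

theorem Czz_le {a : Univ X} (ha : a ∈ Czz X) : a ∈ CzzOne X := ⟨a, ha, 0, by simp⟩

/-- Functions on `X ∪ {∞}` are in the unitization. -/
theorem fn_mem (f : C(Pts X, ℂ)) : fn X f ∈ CzzOne X := by
  refine ⟨fn X (f - algebraMap ℂ _ (f OnePoint.infty)), czzGens_subset X ?_, f OnePoint.infty, ?_⟩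
  · refine ⟨f - algebraMap ℂ _ (f OnePoint.infty), 0, ?_, fun h => (h rfl).elim, ?_⟩
    · change f OnePoint.infty - algebraMap ℂ C(Pts X, ℂ) (f OnePoint.infty) OnePoint.infty = 0
      simp [Algebra.algebraMap_eq_smul_one]
    · rw [zpow_zero, OneMemClass.coe_one, mul_one]
  · rw [map_sub, AlgHomClass.commutes, Algebra.algebraMap_eq_smul_one, sub_add_cancel]

/-- `f U^k` is in the unitization if `f` vanishes at `0` and `∞`. -/
theorem fn_mul_gen_mem (f : C(Pts X, ℂ)) (k : ℤ) (h0 : f (pt0 X) = 0)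
    (hi : f OnePoint.infty = 0) :
    fn X f * ((gen X ^ k : unitary (Univ X)) : Univ X) ∈ CzzOne X :=
  Czz_le X (czzGens_subset X ⟨f, k, hi, fun _ => h0, rfl⟩)

/-! ### Characters and representations on `ℓ²(ℤ)` -/

/-- The covariant pair `f ↦ f(0)`, `U = 1`. -/
def ev0Pair : CovPair X where
  B := ℂ
  ρ := { toFun := fun f => f (pt0 X)
         map_one' := rfl
         map_mul' := fun _ _ => rfl
         map_zero' := rfl
         map_add' := fun _ _ => rfl
         commutes' := fun _ => rfl
         map_star' := fun _ => rfl }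
  U := 1
  cov f := by
    change ((1 : unitary ℂ) : ℂ) * f (pt0 X) * star ((1 : unitary ℂ) : ℂ) = alpha X f (pt0 X)
    simp [alpha_pt0]

/-- The covariant pair `f ↦ f(∞)`, `U = 1`. -/
def evInftyPair : CovPair X where
  B := ℂ
  ρ := { toFun := fun f => f OnePoint.infty
         map_one' := rfl
         map_mul' := fun _ _ => rfl
         map_zero' := rfl
         map_add' := fun _ _ => rfl
         commutes' := fun _ => rfl
         map_star' := fun _ => rfl }
  U := 1
  cov f := by
    change ((1 : unitary ℂ) : ℂ) * f OnePoint.infty * star ((1 : unitary ℂ) : ℂ)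
      = alpha X f OnePoint.infty
    simp [alpha_infty]

/-- The restriction of a covariant pair to the unitization. -/
def CovPair.rep (r : CovPair X) : CzzOne X →⋆ₐ[ℂ] r.B := (r.eval X).comp (CzzOne X).subtype

/-- The character `ev_0`: `∑ f_k U^k ↦ ∑ f_k(0)`. -/
def ev0 : CzzOne X →⋆ₐ[ℂ] ℂ := (ev0Pair X).rep X

/-- The character `ev_∞`: `∑ f_k U^k ↦ f_0(∞)`. -/
def evInfty : CzzOne X →⋆ₐ[ℂ] ℂ := (evInftyPair X).rep X

/-- The Hilbert space `ℓ²(ℤ)`, with orthonormal basis `e_n = lp.single 2 n 1`. -/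
abbrev L2Z : Type := lp (fun _ : ℤ => ℂ) 2

instance : Nontrivial L2Z :=
  ⟨⟨lp.single 2 0 1, 0, fun h => by
    have := congrArg (fun x : L2Z => x 0) h
    simp at this⟩⟩

/-- The diagonal operator `e_n ↦ a(n) e_n` for a bounded sequence `a`. -/
def diag (a : ℤ → ℂ) (ha : ∃ C : ℝ, ∀ n, ‖a n‖ ≤ C) : L2Z →L[ℂ] L2Z :=
  LinearMap.mkContinuousOfExistsBound
    { toFun := fun x => ⟨fun n => a n * x n, by
        obtain ⟨C, hC⟩ := ha
        refine ((lp.memℓp x).norm.const_mul C).mono (fun n => ?_)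
        rw [norm_mul]
        exact mul_le_mul_of_nonneg_right (hC n) (norm_nonneg _)⟩
      map_add' := fun x y => by ext n; exact mul_add _ _ _
      map_smul' := fun c x => by ext n; exact mul_left_comm _ _ _ } (by
    obtain ⟨C, hC⟩ := ha
    refine ⟨C, fun x => ?_⟩
    have hC0 : 0 ≤ C := (norm_nonneg _).trans (hC 0)
    have h := lp.norm_mono (p := 2) (E := fun _ : ℤ => ℂ) (F := fun _ : ℤ => ℂ) (by norm_num)
      (x := ⟨fun n => a n * x n, by
        refine ((lp.memℓp x).norm.const_mul C).mono (fun n => ?_)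
        rw [norm_mul]
        exact mul_le_mul_of_nonneg_right (hC n) (norm_nonneg _)⟩)
      (y := (C : ℂ) • x) (fun n => by
        change ‖a n * x n‖ ≤ ‖(C : ℂ) * x n‖
        rw [norm_mul, norm_mul, Complex.norm_real, Real.norm_of_nonneg hC0]
        exact mul_le_mul_of_nonneg_right (hC n) (norm_nonneg _))
    rw [norm_smul, Complex.norm_real, Real.norm_of_nonneg hC0] at h
    exact h)

@[simp] theorem diag_apply (a : ℤ → ℂ) (ha) (x : L2Z) (n : ℤ) : diag a ha x n = a n * x n := rfl

theorem diag_star (a : ℤ → ℂ) (ha) (hb) :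
    star (diag a ha) = diag (fun n => star (a n)) hb := by
  rw [ContinuousLinearMap.star_eq_adjoint, eq_comm, ContinuousLinearMap.eq_adjoint_iff]
  intro x y
  rw [lp.inner_eq_tsum, lp.inner_eq_tsum]
  refine tsum_congr fun n => ?_
  simp only [diag_apply, RCLike.inner_apply, map_mul]
  simp
  ring

theorem memlp_translate (x : L2Z) (k : ℤ) : Memℓp (fun n => x (n + k)) 2 := by
  have h := lp.memℓp x
  rw [memℓp_gen_iff (by norm_num)] at h ⊢
  exact h.comp_injective (add_left_injective k)

/-- The bilateral shift `e_n ↦ e_{n-1}`, i.e. `(U x)(n) = x(n+1)`. -/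
def shiftEquiv : L2Z ≃ₗᵢ[ℂ] L2Z where
  toFun x := ⟨fun n => x (n + 1), memlp_translate x 1⟩
  invFun x := ⟨fun n => x (n + -1), memlp_translate x (-1)⟩
  left_inv x := by ext n; simp
  right_inv x := by ext n; simp
  map_add' x y := by ext n; rfl
  map_smul' c x := by ext n; rfl
  norm_map' x := by
    rw [lp.norm_eq_tsum_rpow (by norm_num), lp.norm_eq_tsum_rpow (by norm_num)]
    congr 1
    exact (Equiv.addRight (1 : ℤ)).tsum_eq (fun n => ‖x n‖ ^ (2 : ℝ≥0∞).toReal)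

theorem shiftEquiv_apply (x : L2Z) (n : ℤ) : shiftEquiv x n = x (n + 1) := rfl

theorem shiftEquiv_single (n : ℤ) :
    shiftEquiv (lp.single 2 n (1 : ℂ)) = lp.single 2 (n - 1) (1 : ℂ) := by
  ext m
  rw [shiftEquiv_apply, lp.single_apply, lp.single_apply]
  by_cases h : m + 1 = n
  · have : m = n - 1 := by omega
    simp [this]
  · have : ¬ m = n - 1 := by omega
    simp [h, this]

theorem zpow_mul_mem {y : ℝ} (hy : y ∈ X.carrier) (n : ℤ) : q ^ n * y ∈ X.carrier := by
  have hq := X.q_pos.ne'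
  induction n with
  | zero => simpa using hy
  | succ n ih =>
    have := X.mul_mem _ ih
    rwa [← mul_assoc, ← zpow_one_add₀ hq, add_comm] at this
  | pred n ih =>
    refine X.of_mul_mem _ ?_
    rwa [← mul_assoc, ← zpow_one_add₀ hq, add_sub_cancel]

theorem diag_bound (f : C(Pts X, ℂ)) (s : ℤ → Pts X) : ∃ C : ℝ, ∀ n, ‖f (s n)‖ ≤ C :=
  ⟨‖f‖, fun _ => f.norm_coe_le_norm _⟩

/-- The covariant pair on `ℓ²(ℤ)` with `f e_n = f(q^n y) e_n` and `U e_n = e_{n-1}`. -/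
def pairY {y : ℝ} (hy : y ∈ X.carrier) : CovPair X where
  B := L2Z →L[ℂ] L2Z
  ρ := { toFun := fun f => diag (fun n => f (pt (q ^ n * y) (zpow_mul_mem X hy n)))
           (diag_bound X f _)
         map_one' := by ext x n; simp
         map_mul' := fun f g => by ext x n; simp [mul_assoc]
         map_zero' := by ext x n; simp
         map_add' := fun f g => by ext x n; simp [add_mul]
         commutes' := fun c => by ext x n; simp [Algebra.algebraMap_eq_smul_one]
         map_star' := fun f => by
          rw [diag_star _ _ (diag_bound X (star f) _)]
          rfl }
  U := Unitary.linearIsometryEquiv.symm shiftEquiv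
  cov f := by
    have hU := Unitary.mul_star_self_of_mem (Unitary.linearIsometryEquiv.symm shiftEquiv).2
    refine Eq.trans (congrArg (· * _) ?_) ((mul_assoc _ _ _).trans
      ((congrArg _ hU).trans (mul_one _)))
    ext x n
    change f (pt (q ^ (n + 1) * y) (zpow_mul_mem X hy (n + 1))) * x (n + 1)
      = f (pt (q * (q ^ n * y)) (X.mul_mem _ (zpow_mul_mem X hy n))) * x (n + 1)
    have h : q ^ (n + 1) * y = q * (q ^ n * y) := by
      rw [zpow_add_one₀ X.q_pos.ne']; ring
    simp only [h]

/-- The representation `π_y` of the unitization on `ℓ²(ℤ)`. -/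
def piY {y : ℝ} (hy : y ∈ X.carrier) : CzzOne X →⋆ₙₐ[ℂ] (L2Z →L[ℂ] L2Z) :=
  ((pairY X hy).rep X).toNonUnitalStarAlgHom

/-- For a character `χ` and a projection `P`, the representation `a ↦ χ(a) P`. -/
def scalarRep {A : Type*} [Ring A] [StarRing A] [Algebra ℂ A]
    {H : Type*} [NormedAddCommGroup H] [InnerProductSpace ℂ H] [CompleteSpace H]
    (χ : A →⋆ₐ[ℂ] ℂ) (P : H →L[ℂ] H) (hP : IsStarProjection P) :
    A →⋆ₙₐ[ℂ] (H →L[ℂ] H) where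
  toFun a := χ a • P
  map_smul' c a := by simp [smul_smul]
  map_zero' := by simp
  map_add' a b := by simp [add_smul]
  map_mul' a b := by
    rw [map_mul, smul_mul_smul_comm, hP.isIdempotentElem.eq]
  map_star' a := by
    rw [map_star, star_smul, hP.isSelfAdjoint.star_eq]

/-- The direct sum of two representations whose ranges are mutually orthogonal. -/
def orthSum {A : Type*} [Ring A] [StarRing A] [Algebra ℂ A]
    {H : Type*} [NormedAddCommGroup H] [InnerProductSpace ℂ H] [CompleteSpace H]
    (π ρ : A →⋆ₙₐ[ℂ] (H →L[ℂ] H)) (h : ∀ a b, π a * ρ b = 0) : A →⋆ₙₐ[ℂ] (H →L[ℂ] H) where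
  toFun a := π a + ρ a
  map_smul' c a := by simp
  map_zero' := by simp
  map_add' a b := by rw [map_add, map_add]; abel
  map_mul' a b := by
    have h' : ρ a * π b = 0 := by
      have := congrArg star (h (star b) (star a))
      simpa [map_star] using this
    rw [map_mul, map_mul, add_mul, mul_add, mul_add, h, h', add_zero, zero_add]
  map_star' a := by simp [map_star]

/-- The orthogonal projection of `ℓ²(ℤ)` onto the closed span of `{e_k | k ∈ S}`. -/
def projOn (S : Set ℤ) [DecidablePred (· ∈ S)] : L2Z →L[ℂ] L2Z :=
  diag (fun k => if k ∈ S then 1 else 0) ⟨1, fun k => by split_ifs <;> simp⟩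

theorem projOn_isStarProjection (S : Set ℤ) [DecidablePred (· ∈ S)] :
    IsStarProjection (projOn S) where
  isIdempotentElem := by
    ext x n
    by_cases h : n ∈ S <;> simp [projOn, h]
  isSelfAdjoint := by
    have hb : ∃ C : ℝ, ∀ k : ℤ, ‖star (if k ∈ S then (1 : ℂ) else 0)‖ ≤ C :=
      ⟨1, fun k => by split_ifs <;> simp⟩
    rw [IsSelfAdjoint, projOn, diag_star _ _ hb]
    ext x n
    by_cases h : n ∈ S <;> simp [h]

/-- `Π_+`, the projection onto the closed span of `{e_k | k > 0}`. -/
def PiPlus : L2Z →L[ℂ] L2Z := projOn (Ioi 0)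

/-- `Π_-`, the projection onto the closed span of `{e_k | k ≤ 0}`. -/
def PiMinus : L2Z →L[ℂ] L2Z := projOn (Iic 0)

theorem PiPlus_mul_PiMinus : PiPlus * PiMinus = 0 := by
  ext x n
  by_cases h : 0 < n <;> simp [PiPlus, PiMinus, projOn, h]

/-- `π_0(a) = ev_0(a) Π_+`. -/
def piZero : CzzOne X →⋆ₙₐ[ℂ] (L2Z →L[ℂ] L2Z) :=
  scalarRep (ev0 X) PiPlus (projOn_isStarProjection _)

/-- `π_∞(a) = ev_∞(a) Π_-`. -/
def piInfty : CzzOne X →⋆ₙₐ[ℂ] (L2Z →L[ℂ] L2Z) :=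
  scalarRep (evInfty X) PiMinus (projOn_isStarProjection _)

/-- `π_0 ⊕ π_∞`. -/
def piZeroInfty : CzzOne X →⋆ₙₐ[ℂ] (L2Z →L[ℂ] L2Z) :=
  orthSum (piZero X) (piInfty X) (fun a b => by
    change (ev0 X a • PiPlus) * (evInfty X b • PiMinus) = 0
    rw [smul_mul_smul_comm, PiPlus_mul_PiMinus, smul_zero])

/-- `ev_∞` as a representation on the Hilbert space `ℂ`. -/
def evInftyRep : CzzOne X →⋆ₙₐ[ℂ] (ℂ →L[ℂ] ℂ) :=
  scalarRep (evInfty X) 1 (IsStarProjection.one _)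

/-! ### Fredholm modules and the index pairing -/

section Fredholm

variable {A : Type*} [Ring A] [StarRing A] [Algebra ℂ A]
  {H : Type*} [NormedAddCommGroup H] [InnerProductSpace ℂ H] [CompleteSpace H]

/-- `(π_-, π_+)` is an even Fredholm module: all `π_+(a) - π_-(a)` are compact. -/
def IsEvenFredholmModule (πm πp : A →⋆ₙₐ[ℂ] (H →L[ℂ] H)) : Prop :=
  ∀ a : A, IsCompactOperator (πp a - πm a)

/-- The operator `π(p)` on `H^N` for a matrix `p` over `A`: `(π(p) ξ)_i = ∑_j π(p_ij) ξ_j`. -/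
def amplify {N : ℕ} (π : A →⋆ₙₐ[ℂ] (H →L[ℂ] H)) (p : Matrix (Fin N) (Fin N) A) :
    PiLp 2 (fun _ : Fin N => H) →L[ℂ] PiLp 2 (fun _ : Fin N => H) :=
  (PiLp.continuousLinearEquiv 2 ℂ (fun _ : Fin N => H)).symm.toContinuousLinearMap ∘L
    ContinuousLinearMap.pi (fun i => ∑ j, π (p i j) ∘L PiLp.proj 2 (fun _ : Fin N => H) j)

theorem amplify_apply {N : ℕ} (π : A →⋆ₙₐ[ℂ] (H →L[ℂ] H)) (p : Matrix (Fin N) (Fin N) A)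
    (ξ : PiLp 2 (fun _ : Fin N => H)) (i : Fin N) :
    amplify π p ξ i = ∑ j, π (p i j) (ξ j) := by
  simp [amplify]

/-- The operator `π_+(p) : π_-(p) H^N → π_+(p) H^N`. -/
def pairingOp {N : ℕ} (πm πp : A →⋆ₙₐ[ℂ] (H →L[ℂ] H)) (p : Matrix (Fin N) (Fin N) A) :
    (amplify πm p).range →L[ℂ] (amplify πp p).range :=
  (amplify πp p ∘L (amplify πm p).range.subtypeL).codRestrict (amplify πp p).range
    (fun x => ⟨x, rfl⟩)

/-- The index `dim ker T - dim coker T` (meaningful for Fredholm operators). -/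
def fredholmIndex {E F : Type*} [AddCommGroup E] [Module ℂ E] [TopologicalSpace E]
    [AddCommGroup F] [Module ℂ F] [TopologicalSpace F] (T : E →L[ℂ] F) : ℤ :=
  (Module.finrank ℂ T.ker : ℤ) - (Module.finrank ℂ (F ⧸ T.range) : ℤ)

/-- The index pairing `⟨[(π_-, π_+)], [p]⟩` of an even Fredholm module with a projection
`p ∈ Mat_N(A)` is defined and equal to `m`: the pair is an even Fredholm module, `p` is a
self-adjoint projection, and `π_+(p) : π_-(p) H^N → π_+(p) H^N` is Fredholm of index `m`. -/
structure HasIndexPairing {N : ℕ} (πm πp : A →⋆ₙₐ[ℂ] (H →L[ℂ] H))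
    (p : Matrix (Fin N) (Fin N) A) (m : ℤ) : Prop where
  module : IsEvenFredholmModule πm πp
  projection : IsStarProjection p
  fredholm : (pairingOp πm πp p).IsFredholm
  index_eq : fredholmIndex (pairingOp πm πp p) = m

end Fredholm

/-! ### Bott projections -/

section Bott

theorem tendsto_bott_den {c : ℝ} (hc : 0 < c) {n : ℕ} (hn : 1 ≤ n) :
    Tendsto (fun t : ℝ => 1 + c * t ^ (2 * n)) atTop atTop :=
  tendsto_atTop_add_const_left _ _ ((tendsto_pow_atTop (by omega)).const_mul_atTop hc)

theorem continuousOn_bott {g : ℝ → ℝ} (hg : Continuous g) {c : ℝ} (hc : 0 < c) (n : ℕ) :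
    ContinuousOn (fun t => g t / (1 + c * t ^ (2 * n))) (Ici 0) := by
  refine ContinuousOn.div hg.continuousOn (by fun_prop) (fun t ht => ?_)
  have ht : (0 : ℝ) ≤ t := ht
  positivity

theorem tendsto_bottD {c : ℝ} (hc : 0 < c) {n : ℕ} (hn : 1 ≤ n) :
    Tendsto (fun t : ℝ => 1 / (1 + c * t ^ (2 * n))) atTop (𝓝 0) :=
  tendsto_const_nhds.div_atTop (tendsto_bott_den hc hn)

theorem tendsto_bottA {c : ℝ} (hc : 0 < c) {n : ℕ} (hn : 1 ≤ n) :
    Tendsto (fun t : ℝ => c * t ^ (2 * n) / (1 + c * t ^ (2 * n))) atTop (𝓝 1) := by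
  have h := (tendsto_bottD hc hn).const_sub 1
  rw [sub_zero] at h
  refine h.congr' ?_
  filter_upwards [eventually_ge_atTop 0] with t ht
  have : 0 < 1 + c * t ^ (2 * n) := by positivity
  field_simp
  ring

theorem tendsto_bottB (d : ℝ) {c : ℝ} (hc : 0 < c) {n : ℕ} (hn : 1 ≤ n) :
    Tendsto (fun t : ℝ => d * t ^ n / (1 + c * t ^ (2 * n))) atTop (𝓝 0) := by
  have h1 : Tendsto (fun t : ℝ => t ^ n) atTop atTop := tendsto_pow_atTop (by omega)
  have h2 : Tendsto (fun t : ℝ => (t ^ n)⁻¹ + c * t ^ n) atTop atTop :=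
    (tendsto_inv_atTop_zero.comp h1).add_atTop (h1.const_mul_atTop hc)
  have h3 : Tendsto (fun t : ℝ => d / ((t ^ n)⁻¹ + c * t ^ n)) atTop (𝓝 0) :=
    tendsto_const_nhds.div_atTop h2
  refine h3.congr' ?_
  filter_upwards [eventually_gt_atTop 0] with t ht
  have ht' : 0 < t ^ n := by positivity
  rw [two_mul, pow_add]
  field_simp

/-- `c t^{2n} / (1 + c t^{2n})` on `X`, with value `1` at `∞`. -/
def bottA {c : ℝ} (hc : 0 < c) {n : ℕ} (hn : 1 ≤ n) : C(Pts X, ℂ) :=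
  mkFun X (fun t => c * t ^ (2 * n) / (1 + c * t ^ (2 * n))) 1
    (continuousOn_bott (by fun_prop) hc n) (tendsto_bottA hc hn)

/-- `1 / (1 + c t^{2n})` on `X`, with value `0` at `∞`. -/
def bottD {c : ℝ} (hc : 0 < c) {n : ℕ} (hn : 1 ≤ n) : C(Pts X, ℂ) :=
  mkFun X (fun t => 1 / (1 + c * t ^ (2 * n))) 0
    (continuousOn_bott (by fun_prop) hc n) (tendsto_bottD hc hn)

/-- `d t^n / (1 + c t^{2n})` on `X`, with value `0` at `∞`. -/
def bottB (d : ℝ) {c : ℝ} (hc : 0 < c) {n : ℕ} (hn : 1 ≤ n) : C(Pts X, ℂ) :=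
  mkFun X (fun t => d * t ^ n / (1 + c * t ^ (2 * n))) 0
    (continuousOn_bott (by fun_prop) hc n) (tendsto_bottB d hc hn)

theorem bottB_zero (d : ℝ) {c : ℝ} (hc : 0 < c) {n : ℕ} (hn : 1 ≤ n) :
    bottB X d hc hn (pt0 X) = 0 := by
  rw [bottB, pt0, mkFun_pt]
  simp [show n ≠ 0 by omega]

/-- A function on `X ∪ {∞}` as an element of the unitization. -/
def el (f : C(Pts X, ℂ)) : CzzOne X := ⟨fn X f, fn_mem X f⟩

/-- The element `f U^k` of the unitization, for `f` with `f(0) = f(∞) = 0`. -/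
def elU (f : C(Pts X, ℂ)) (k : ℤ) (h0 : f (pt0 X) = 0) (hi : f OnePoint.infty = 0) : CzzOne X :=
  ⟨fn X f * ((gen X ^ k : unitary (Univ X)) : Univ X), fn_mul_gen_mem X f k h0 hi⟩

/-- The element `d |z|^n / (1 + c |z|^{2n}) U^k`. -/
def elB (d : ℝ) {c : ℝ} (hc : 0 < c) {n : ℕ} (hn : 1 ≤ n) (k : ℤ) : CzzOne X :=
  elU X (bottB X d hc hn) k (bottB_zero X d hc hn) (mkFun_infty X _ _ _ _)

theorem q_zpow_pos {q : ℝ} (X : QSpace q) (k : ℤ) : 0 < q ^ k := zpow_pos X.q_pos k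

/-- The Bott projection
`P_n = [[c t^{2n}/(1+c t^{2n}), c^{1/2} t^n/(1+c t^{2n}) U^{*n}],
[d^{1/2} t^n/(1+d t^{2n}) U^n, 1/(1+d t^{2n})]]`
with `t = |z|`, `c = q^{-n(n-1)}`, `d = q^{n(n+1)}`. -/
def bottPos {n : ℕ} (hn : 1 ≤ n) : Matrix (Fin 2) (Fin 2) (CzzOne X) :=
  !![el X (bottA X (q_zpow_pos X (-(n * (n - 1)))) hn),
      elB X (q ^ (-((n : ℝ) / 2 * (n - 1)))) (q_zpow_pos X (-(n * (n - 1)))) hn (-n);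
    elB X (q ^ ((n : ℝ) / 2 * (n + 1))) (q_zpow_pos X (n * (n + 1))) hn n,
      el X (bottD X (q_zpow_pos X (n * (n + 1))) hn)]

/-- The Bott projection
`P_{-n} = [[d t^{2n}/(1+d t^{2n}), d^{1/2} t^n/(1+d t^{2n}) U^n],
[c^{1/2} t^n/(1+c t^{2n}) U^{*n}, 1/(1+c t^{2n})]]`
with `t = |z|`, `c = q^{-n(n-1)}`, `d = q^{n(n+1)}`. -/
def bottNeg {n : ℕ} (hn : 1 ≤ n) : Matrix (Fin 2) (Fin 2) (CzzOne X) :=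
  !![el X (bottA X (q_zpow_pos X (n * (n + 1))) hn),
      elB X (q ^ ((n : ℝ) / 2 * (n + 1))) (q_zpow_pos X (n * (n + 1))) hn n;
    elB X (q ^ (-((n : ℝ) / 2 * (n - 1)))) (q_zpow_pos X (-(n * (n - 1)))) hn (-n),
      el X (bottD X (q_zpow_pos X (-(n * (n - 1)))) hn)]

end Bott

/-! ### Powers--Rieffel type projections -/

section Rieffel

/-- `φ : [q,1] → ℝ` is continuous with `0 ≤ φ ≤ 1`, `φ(q) = 0`, `φ(1) = 1` (the values of `φ`
outside `[q,1]` are irrelevant). -/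
structure IsCutoff (q : ℝ) (φ : ℝ → ℝ) : Prop where
  cont : ContinuousOn φ (Icc q 1)
  nonneg : ∀ t ∈ Icc q 1, 0 ≤ φ t
  le_one : ∀ t ∈ Icc q 1, φ t ≤ 1
  left : φ q = 0
  right : φ 1 = 1

open Classical in
/-- The function `h`. -/
def rieffelH (q : ℝ) (φ : ℝ → ℝ) (t : ℝ) : ℝ :=
  if t ∈ Icc q 1 then √(φ t * (1 - φ t)) else 0

open Classical in
/-- The function `f_n`. -/
def rieffelF (q : ℝ) (φ : ℝ → ℝ) (n : ℕ) (t : ℝ) : ℝ :=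
  if t ∈ Icc q 1 then φ t
  else if t ∈ Ioo 1 (q ^ (-(n : ℤ) + 1)) then 1
  else if t ∈ Icc (q ^ (-(n : ℤ) + 1)) (q ^ (-(n : ℤ))) then 1 - φ (q ^ n * t)
  else 0

variable {φ : ℝ → ℝ}

theorem cutoff_ext_continuous (hq : q < 1) (hφ : IsCutoff q φ) :
    Continuous (fun t => φ (projIcc q 1 hq.le t)) :=
  hφ.cont.comp_continuous (continuous_subtype_val.comp continuous_projIcc)
    (fun t => (projIcc q 1 hq.le t).2)

theorem rieffelH_eq (hq : q < 1) (hφ : IsCutoff q φ) :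
    rieffelH q φ = fun t => √(φ (projIcc q 1 hq.le t) * (1 - φ (projIcc q 1 hq.le t))) := by
  ext t
  rw [rieffelH]
  split_ifs with h
  · rw [projIcc_of_mem hq.le h]
  · rcases lt_or_ge t q with h1 | h1
    · rw [projIcc_of_le_left hq.le h1.le]; simp [hφ.left]
    · have h2 : 1 < t := by
        by_contra h3
        exact h ⟨h1, not_lt.1 h3⟩
      rw [projIcc_of_right_le hq.le h2.le]; simp [hφ.right]

theorem rieffelF_eq (hq0 : 0 < q) (hq : q < 1) (hφ : IsCutoff q φ) {n : ℕ} (hn : 1 ≤ n) :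
    rieffelF q φ n
      = fun t => φ (projIcc q 1 hq.le t) - φ (projIcc q 1 hq.le (q ^ n * t)) := by
  ext t
  have e1 : q ^ (-(n : ℤ)) = (q ^ n)⁻¹ := by simp
  have e2 : q ^ (-(n : ℤ) + 1) = (q ^ n)⁻¹ * q := by rw [zpow_add_one₀ hq0.ne', e1]
  have hqn : 0 < q ^ n := by positivity
  have hqn1 : q ^ n ≤ q := by
    calc q ^ n ≤ q ^ 1 := pow_le_pow_of_le_one hq0.le hq.le hn
      _ = q := pow_one q
  have L : ∀ s, s ≤ q → φ (projIcc q 1 hq.le s) = 0 := fun s hs => by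
    rw [projIcc_of_le_left hq.le hs]; exact hφ.left
  have R : ∀ s, 1 ≤ s → φ (projIcc q 1 hq.le s) = 1 := fun s hs => by
    rw [projIcc_of_right_le hq.le hs]; exact hφ.right
  have M : ∀ s, s ∈ Icc q 1 → φ (projIcc q 1 hq.le s) = φ s := fun s hs => by
    rw [projIcc_of_mem hq.le hs]
  have k1 : t < (q ^ n)⁻¹ * q ↔ q ^ n * t < q := by
    rw [inv_mul_eq_div, lt_div_iff₀ hqn, mul_comm]
  have k2 : t ≤ (q ^ n)⁻¹ ↔ q ^ n * t ≤ 1 := by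
    rw [← one_div, le_div_iff₀ hqn, mul_comm]
  have k3 : (q ^ n)⁻¹ * q ≤ t ↔ q ≤ q ^ n * t := by
    rw [← not_lt, k1, not_lt]
  rw [rieffelF, e1, e2]
  split_ifs with h1 h2 h3
  · have : q ^ n * t ≤ q := by nlinarith [h1.1, h1.2]
    rw [M t h1, L _ this, sub_zero]
  · rw [R t h2.1.le, L _ (k1.1 h2.2).le, sub_zero]
  · have h4 : q ^ n * t ∈ Icc q 1 := ⟨k3.1 h3.1, k2.1 h3.2⟩
    have h5 : 1 ≤ t := by
      by_contra h6
      have h6 : t < 1 := not_le.1 h6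
      have h7 : q ≤ t := by
        have := h4.1
        nlinarith
      exact h1 ⟨h7, h6.le⟩
    rw [M _ h4, R t h5]
  · rcases lt_or_ge t q with h4 | h4
    · have : q ^ n * t ≤ q := by
        have : q ^ n ≤ 1 := hqn1.trans hq.le
        nlinarith
      rw [L t h4.le, L _ this, sub_zero]
    · have h5 : 1 < t := by
        by_contra h6
        exact h1 ⟨h4, not_lt.1 h6⟩
      have h6 : q ≤ q ^ n * t := by
        by_contra h7
        exact h2 ⟨h5, k1.2 (not_le.1 h7)⟩
      have h7 : 1 ≤ q ^ n * t := by
        by_contra h8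
        exact h3 ⟨k3.2 h6, k2.2 (not_le.1 h8).le⟩
      rw [R t h5.le, R _ h7, sub_self]

theorem rieffelH_continuous (hq : q < 1) (hφ : IsCutoff q φ) : Continuous (rieffelH q φ) := by
  rw [rieffelH_eq hq hφ]
  have := cutoff_ext_continuous hq hφ
  exact (this.mul (continuous_const.sub this)).sqrt

theorem rieffelF_continuous (hq0 : 0 < q) (hq : q < 1) (hφ : IsCutoff q φ) {n : ℕ}
    (hn : 1 ≤ n) : Continuous (rieffelF q φ n) := by
  rw [rieffelF_eq hq0 hq hφ hn]
  have := cutoff_ext_continuous hq hφ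
  exact this.sub (this.comp (continuous_const.mul continuous_id))

theorem rieffelH_tendsto (hq : q < 1) (hφ : IsCutoff q φ) :
    Tendsto (rieffelH q φ) atTop (𝓝 0) := by
  refine tendsto_const_nhds.congr' ?_
  filter_upwards [eventually_ge_atTop 1] with t ht
  rw [rieffelH_eq hq hφ]
  simp only
  rw [projIcc_of_right_le hq.le ht]
  simp [hφ.right]

theorem rieffelF_tendsto (hq0 : 0 < q) (hq : q < 1) (hφ : IsCutoff q φ) {n : ℕ} (hn : 1 ≤ n) :
    Tendsto (rieffelF q φ n) atTop (𝓝 0) := by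
  refine tendsto_const_nhds.congr' ?_
  filter_upwards [eventually_ge_atTop 1, eventually_ge_atTop (q ^ n)⁻¹] with t ht ht2
  have hqn : 0 < q ^ n := by positivity
  have : 1 ≤ q ^ n * t := by
    calc (1 : ℝ) = q ^ n * (q ^ n)⁻¹ := (mul_inv_cancel₀ hqn.ne').symm
      _ ≤ _ := by gcongr
  rw [rieffelF_eq hq0 hq hφ hn]
  simp only
  rw [projIcc_of_right_le hq.le ht, projIcc_of_right_le hq.le this, sub_self]

/-- `h` as a function on `X ∪ {∞}`. -/
def hFun (hφ : IsCutoff q φ) : C(Pts X, ℂ) :=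
  mkFun X (rieffelH q φ) 0 (rieffelH_continuous X.q_lt_one hφ).continuousOn
    (rieffelH_tendsto X.q_lt_one hφ)

/-- `f_n` as a function on `X ∪ {∞}`. -/
def fFun (hφ : IsCutoff q φ) {n : ℕ} (hn : 1 ≤ n) : C(Pts X, ℂ) :=
  mkFun X (rieffelF q φ n) 0 (rieffelF_continuous X.q_pos X.q_lt_one hφ hn).continuousOn
    (rieffelF_tendsto X.q_pos X.q_lt_one hφ hn)

theorem hFun_zero (hφ : IsCutoff q φ) : hFun X hφ (pt0 X) = 0 := by
  rw [hFun, pt0, mkFun_pt, rieffelH, if_neg (fun h => absurd h.1 (not_le.2 X.q_pos))]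
  simp

theorem star_hFun (hφ : IsCutoff q φ) : star (hFun X hφ) = hFun X hφ := by
  ext x
  induction x using OnePoint.rec with
  | infty => change star ((0 : ℝ) : ℂ) = ((0 : ℝ) : ℂ); simp
  | coe x => exact Complex.conj_ofReal _

theorem gen_mul_h_mem (hφ : IsCutoff q φ) (n : ℕ) :
    ((gen X ^ (n : ℤ) : unitary (Univ X)) : Univ X) * fn X (hFun X hφ) ∈ CzzOne X := by
  have h := star_mem (fn_mul_gen_mem X (hFun X hφ) (-n) (hFun_zero X hφ) (mkFun_infty X _ _ _ _))
  rw [star_mul, ← map_star, star_hFun, zpow_neg, ← Unitary.coe_star, Unitary.star_eq_inv,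
    inv_inv] at h
  exact h

/-- The Powers--Rieffel type projection `R_n = U^n h + f_n + h U^{*n}`. -/
def rieffelR (hφ : IsCutoff q φ) {n : ℕ} (hn : 1 ≤ n) : CzzOne X :=
  ⟨((gen X ^ (n : ℤ) : unitary (Univ X)) : Univ X) * fn X (hFun X hφ), gen_mul_h_mem X hφ n⟩
    + el X (fFun X hφ hn)
    + elU X (hFun X hφ) (-n) (hFun_zero X hφ) (mkFun_infty X _ _ _ _)

end Rieffel

end QPlane

end

open QPlane

noncomputable section

namespace QPlane

/-! ### The spectrum of the modulus of a `q`-normal operator -/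

section Spectral

variable {E : Type*} [NormedAddCommGroup E] [InnerProductSpace ℂ E]

/-! The proof has two independent halves.

The first half shows that spec(|z|) is an admissible X. For self-adjoint T, a real l lies in the
resolvent set exactly when T - l is bounded below (`mem_realSpectrum_iff`), so all spectral claims
become norm estimates on graphs. For T = |z| one has z*z = T² and zz* = q²T². Two products ab and ba
have the same nonzero spectrum, hence so do T² and q²T², which gives qX = X (`boundedBelow_swap`,
`boundedBelow_sq_iff`). A bounded inverse K of T would satisfy ‖K‖ ≤ q‖K‖, so 0 ∈ X
(`not_boundedBelow_zero`).

The second half computes indices. The pair (π_y, π_0 ⊕ π_∞) is a Fredholm module because f(q^m y)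
tends to f(0) and f(∞) at the two ends of ℤ, so on f U^k the difference is a diagonal operator with
null sequence times a shift (`isEvenFredholmModule_piY`). If π_-(p) = v v' and π_+(p) = w w' with
v'v = 1 and w'w = 1, then v and w parametrize the two ranges and the pairing operator becomes D =
w'v (`pairingOp_rangeEquiv`); a one-sided inverse of D then reduces the index to the dimension of
one kernel.

The Bott projections are P_{±n} = v v*, where v is a column of two square roots, the second
multiplied by U^{±n}. Since ev_∞ and ev_0 send P_{±n} to diag(1,0) and diag(0,1), the representation
π_0 ⊕ π_∞ factors it through Π_- and Π_+. For P_n the operator D is diagonal on the coordinates m ≤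
0 and a weighted shift by n on m > 0, with weights bounded away from zero: it is onto with
n-dimensional kernel. For P_{-n} it is a right inverse of such an operator.

In the remaining pairings, apart from that of 1 with π_y, π_+(p) = 0 and the index is the rank of
π_-(p). For π_y(R_n) this rank is n: a rank-one block on e_0, e_{-n} and the identity on e_{-1}, …,
e_{-n+1} (`evalY_rieffelR_eq`). -/

theorem mem_graph_pcomp {g f : E →ₗ.[ℂ] E} {x y : E} :
    (x, y) ∈ (pcomp g f).graph ↔ ∃ v, (x, v) ∈ f.graph ∧ (v, y) ∈ g.graph := by
  constructor
  · intro h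
    obtain ⟨⟨x', hx'⟩, rfl, rfl⟩ := (LinearPMap.mem_graph_iff _).1 h
    obtain ⟨h1, h2⟩ := (mem_pcomp_domain g f x').1 hx'
    exact ⟨f ⟨x', h1⟩, f.mem_graph ⟨x', h1⟩, g.mem_graph ⟨f ⟨x', h1⟩, h2⟩⟩
  · rintro ⟨v, h1, h2⟩
    obtain ⟨⟨x', hx'⟩, rfl, rfl⟩ := (LinearPMap.mem_graph_iff _).1 h1
    obtain ⟨⟨v', hv'⟩, hv, rfl⟩ := (LinearPMap.mem_graph_iff _).1 h2
    dsimp only at hv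
    subst hv
    exact (pcomp g f).mem_graph ⟨x', (mem_pcomp_domain g f x').2 ⟨hx', hv'⟩⟩

theorem mem_graph_smul {T : E →ₗ.[ℂ] E} {c : ℂ} {x y : E} :
    (x, y) ∈ (c • T).graph ↔ ∃ u, (x, u) ∈ T.graph ∧ y = c • u := by
  constructor
  · intro h
    obtain ⟨⟨x', hx'⟩, rfl, rfl⟩ := (LinearPMap.mem_graph_iff _).1 h
    exact ⟨T ⟨x', hx'⟩, T.mem_graph ⟨x', hx'⟩, rfl⟩
  · rintro ⟨u, hu, rfl⟩
    obtain ⟨⟨x', hx'⟩, rfl, rfl⟩ := (LinearPMap.mem_graph_iff _).1 hu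
    exact (c • T).mem_graph ⟨x', hx'⟩

theorem graph_unique {T : E →ₗ.[ℂ] E} {x y y' : E} (h : (x, y) ∈ T.graph)
    (h' : (x, y') ∈ T.graph) : y = y' :=
  T.mem_graph_snd_inj h h' rfl

theorem graph_comb {T : E →ₗ.[ℂ] E} {x y x' y' : E} (h : (x, y) ∈ T.graph)
    (h' : (x', y') ∈ T.graph) (a b : ℂ) : (a • x + b • x', a • y + b • y') ∈ T.graph :=
  T.graph.add_mem (T.graph.smul_mem a h) (T.graph.smul_mem b h')

theorem graph_sub_smul {T : E →ₗ.[ℂ] E} {x y x' y' : E} (h : (x, y) ∈ T.graph)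
    (h' : (x', y') ∈ T.graph) (a : ℂ) : (x - a • x', y - a • y') ∈ T.graph :=
  T.graph.sub_mem h (T.graph.smul_mem a h')

theorem inResolvent_iff {T : E →ₗ.[ℂ] E} {l : ℂ} :
    InResolvent T l ↔ ∃ R : E →L[ℂ] E, (∀ y, (R y, y + l • R y) ∈ T.graph) ∧
      ∀ x y, (x, y) ∈ T.graph → R (y - l • x) = x := by
  refine exists_congr fun R => and_congr (forall_congr' fun y => ?_) ?_
  · constructor
    · rintro ⟨h1, h2⟩
      have := T.mem_graph ⟨R y, h1⟩
      rwa [sub_eq_iff_eq_add.1 h2] at this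
    · intro h
      obtain ⟨⟨x, hx⟩, h1, h2⟩ := (LinearPMap.mem_graph_iff _).1 h
      dsimp only at h1 h2
      subst h1
      exact ⟨hx, by rw [h2, add_sub_cancel_right]⟩
  · constructor
    · intro h x y hxy
      obtain ⟨x', rfl, rfl⟩ := (LinearPMap.mem_graph_iff _).1 hxy
      exact h x'
    · intro h x
      exact h _ _ (T.mem_graph x)

/-- `T - l` is bounded below on its domain. -/
def BoundedBelow (T : E →ₗ.[ℂ] E) (l : ℝ) : Prop :=
  ∃ C : ℝ, 0 ≤ C ∧ ∀ x y, (x, y) ∈ T.graph → ‖x‖ ≤ C * ‖y - (l : ℂ) • x‖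

theorem InResolvent.boundedBelow {T : E →ₗ.[ℂ] E} {l : ℝ} (h : InResolvent T (l : ℂ)) :
    BoundedBelow T l := by
  obtain ⟨R, -, hR⟩ := inResolvent_iff.1 h
  refine ⟨‖R‖, norm_nonneg _, fun x y hxy => ?_⟩
  have := R.le_opNorm (y - (l : ℂ) • x)
  rwa [hR x y hxy] at this

theorem isFormalAdjoint_graph {S T : E →ₗ.[ℂ] E} (h : S.IsFormalAdjoint T) {x y x' y' : E}
    (h1 : (x, y) ∈ S.graph) (h2 : (x', y') ∈ T.graph) : ⟪y, x'⟫_ℂ = ⟪x, y'⟫_ℂ := by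
  obtain ⟨a, rfl, rfl⟩ := (LinearPMap.mem_graph_iff _).1 h1
  obtain ⟨b, rfl, rfl⟩ := (LinearPMap.mem_graph_iff _).1 h2
  exact h a b

theorem nonneg_graph {T : E →ₗ.[ℂ] E} (hT : ∀ x : T.domain, 0 ≤ (⟪(x : E), T x⟫_ℂ).re)
    {x y : E} (h : (x, y) ∈ T.graph) : 0 ≤ (⟪x, y⟫_ℂ).re := by
  obtain ⟨a, rfl, rfl⟩ := (LinearPMap.mem_graph_iff _).1 h
  exact hT a

/-- By positivity Re⟨x, (T - l)x⟩ ≥ -l‖x‖², and Cauchy–Schwarz gives the bound with constant (-l)⁻¹.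
-/
theorem boundedBelow_of_neg {T : E →ₗ.[ℂ] E} (hT : ∀ x : T.domain, 0 ≤ (⟪(x : E), T x⟫_ℂ).re)
    {l : ℝ} (hl : l < 0) : BoundedBelow T l := by
  refine ⟨(-l)⁻¹, by rw [inv_nonneg]; linarith, fun x y hxy => ?_⟩
  have h1 := nonneg_graph hT hxy
  have h2 : (⟪x, y - (l : ℂ) • x⟫_ℂ).re = (⟪x, y⟫_ℂ).re - l * ‖x‖ ^ 2 := by
    rw [inner_sub_right, inner_smul_right, inner_self_eq_norm_sq_to_K, Complex.sub_re,
      Complex.re_ofReal_mul]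
    norm_cast
  have h3 : (⟪x, y - (l : ℂ) • x⟫_ℂ).re ≤ ‖x‖ * ‖y - (l : ℂ) • x‖ :=
    (Complex.re_le_norm _).trans (norm_inner_le_norm _ _)
  rw [← div_eq_inv_mul, le_div_iff₀ (by linarith)]
  rcases (norm_nonneg x).eq_or_lt with h | h
  · rw [← h]; simp
  · have : ‖x‖ * (‖x‖ * -l) ≤ ‖x‖ * ‖y - (l : ℂ) • x‖ := by nlinarith
    exact le_of_mul_le_mul_left this h

variable [CompleteSpace E]

theorem selfAdjoint_formal {T : E →ₗ.[ℂ] E} (hT : IsSelfAdjoint T) : T.IsFormalAdjoint T := by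
  have h := LinearPMap.adjoint_isFormalAdjoint hT.dense_domain
  rwa [LinearPMap.isSelfAdjoint_def.1 hT] at h

theorem selfAdjoint_mem_graph {T : E →ₗ.[ℂ] E} (hT : IsSelfAdjoint T) {x y : E}
    (h : ∀ a b, (a, b) ∈ T.graph → ⟪b, x⟫_ℂ = ⟪a, y⟫_ℂ) : (x, y) ∈ T.graph := by
  rw [← LinearPMap.isSelfAdjoint_def.1 hT, LinearPMap.adjoint_graph_eq_graph_adjoint hT.dense_domain,
    Submodule.mem_adjoint_iff]
  exact fun a b hab => sub_eq_zero.2 (h a b hab)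

/-- For a self-adjoint operator, the real points of the resolvent set are those where `T - l` is
bounded below. -/
theorem BoundedBelow.inResolvent {T : E →ₗ.[ℂ] E} (hT : IsSelfAdjoint T) {l : ℝ}
    (h : BoundedBelow T l) : InResolvent T (l : ℂ) := by
  obtain ⟨C, hC0, hC⟩ := h
  have hcl : IsClosed (T.graph : Set (E × E)) := hT.isClosed
  have : CompleteSpace T.graph := hcl.completeSpace_coe
  let Φ : T.graph →L[ℂ] E :=
    (ContinuousLinearMap.snd ℂ E E - (l : ℂ) • ContinuousLinearMap.fst ℂ E E) ∘L T.graph.subtypeL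
  have hΦ : ∀ p : T.graph, Φ p = (p : E × E).2 - (l : ℂ) • (p : E × E).1 := fun p => rfl
  -- With w = (T - l)x, both components of (x, Tx) are controlled by ‖w‖, the second through Tx = w
  -- + lx. As the graph is complete, the range of T - l is therefore closed.
  have hanti : AntilipschitzWith (Real.toNNReal (C + (1 + |l| * C))) Φ := by
    refine ContinuousLinearMap.antilipschitz_of_bound _ fun p => ?_
    rw [Real.coe_toNNReal _ (by positivity), hΦ]
    have h1 := hC _ _ p.2
    set w := (p : E × E).2 - (l : ℂ) • (p : E × E).1
    have h2 : (p : E × E).2 = w + (l : ℂ) • (p : E × E).1 := by simp [w]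
    have h3 : ‖(p : E × E).2‖ ≤ ‖w‖ + |l| * (C * ‖w‖) := by
      rw [h2]
      refine (norm_add_le _ _).trans ?_
      rw [norm_smul, Complex.norm_real, Real.norm_eq_abs]
      gcongr
    have h4 : 0 ≤ |l| * (C * ‖w‖) := by positivity
    have h5 : 0 ≤ C * ‖w‖ := by positivity
    refine max_le ?_ ?_
    · change ‖(p : E × E).1‖ ≤ _
      nlinarith [norm_nonneg w]
    · change ‖(p : E × E).2‖ ≤ _
      nlinarith [norm_nonneg w]
  have hinj : Φ.ker = ⊥ := LinearMap.ker_eq_bot.2 hanti.injective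
  have hrc : IsClosed (Φ.range : Set E) := hanti.isClosed_range Φ.uniformContinuous
  -- A vector y orthogonal to the range satisfies Ty = ly by self-adjointness, and the lower bound
  -- then forces y = 0.
  have hsurj : Φ.range = ⊤ := by
    have : CompleteSpace Φ.range := hrc.completeSpace_coe
    rw [← Submodule.orthogonal_eq_bot_iff, Submodule.eq_bot_iff]
    intro y hy
    rw [Submodule.mem_orthogonal] at hy
    have h1 : (y, (l : ℂ) • y) ∈ T.graph := by
      refine selfAdjoint_mem_graph hT fun a b hab => ?_
      have h2 := hy (Φ ⟨(a, b), hab⟩) ⟨_, rfl⟩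
      rw [hΦ, inner_sub_left, inner_smul_left, sub_eq_zero, Complex.conj_ofReal] at h2
      rw [h2, inner_smul_right]
    have h2 := hC _ _ h1
    simpa using h2
  let e : T.graph ≃L[ℂ] E := ContinuousLinearEquiv.ofBijective Φ hinj hsurj
  have he : ∀ p, e p = Φ p := fun p => rfl
  refine inResolvent_iff.2 ⟨ContinuousLinearMap.fst ℂ E E ∘L T.graph.subtypeL ∘L
    (e.symm : E →L[ℂ] T.graph), fun y => ?_, fun x y hxy => ?_⟩
  · have h1 : (e.symm y : E × E).2 - (l : ℂ) • (e.symm y : E × E).1 = y := by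
      rw [← hΦ, ← he, e.apply_symm_apply]
    have h2 := (e.symm y).2
    have h3 : (e.symm y : E × E) = ((e.symm y : E × E).1, y + (l : ℂ) • (e.symm y : E × E).1) :=
      Prod.ext rfl (by rw [← sub_eq_iff_eq_add, h1])
    rw [h3] at h2
    exact h2
  · have h1 : e.symm (y - (l : ℂ) • x) = ⟨(x, y), hxy⟩ := by
      rw [ContinuousLinearEquiv.symm_apply_eq]; rfl
    change ((e.symm (y - (l : ℂ) • x) : T.graph) : E × E).1 = x
    rw [h1]

theorem mem_realSpectrum_iff {T : E →ₗ.[ℂ] E} (hT : IsSelfAdjoint T) {l : ℝ} :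
    l ∈ realSpectrum T ↔ ¬ BoundedBelow T l :=
  not_congr ⟨fun h => h.boundedBelow, fun h => h.inResolvent hT⟩

/-- Lower bounds are stable: moving l by less than 1/(2(C+1)) changes the estimate by at most ‖x‖/2,
so the constant 2C still works. -/
theorem isClosed_realSpectrum {T : E →ₗ.[ℂ] E} (hT : IsSelfAdjoint T) :
    IsClosed (realSpectrum T) := by
  rw [← isOpen_compl_iff, Metric.isOpen_iff]
  intro l hl
  rw [mem_compl_iff, mem_realSpectrum_iff hT, not_not] at hl
  obtain ⟨C, hC0, hC⟩ := hl
  refine ⟨(2 * (C + 1))⁻¹, by positivity, fun m hm => ?_⟩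
  rw [mem_compl_iff, mem_realSpectrum_iff hT, not_not]
  refine ⟨2 * C, by positivity, fun x y hxy => ?_⟩
  have h1 := hC x y hxy
  have h2 : y - (l : ℂ) • x = (y - (m : ℂ) • x) + ((m - l : ℝ) : ℂ) • x := by
    push_cast; rw [sub_smul]; abel
  have h3 : ‖y - (l : ℂ) • x‖ ≤ ‖y - (m : ℂ) • x‖ + |m - l| * ‖x‖ := by
    rw [h2]
    refine (norm_add_le _ _).trans ?_
    rw [norm_smul, Complex.norm_real, Real.norm_eq_abs]
  have h4 : |m - l| * (2 * (C + 1)) ≤ 1 := by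
    have h5 : |m - l| < (2 * (C + 1))⁻¹ := by simpa [Real.dist_eq] using hm
    calc |m - l| * (2 * (C + 1)) ≤ (2 * (C + 1))⁻¹ * (2 * (C + 1)) := by gcongr
      _ = 1 := inv_mul_cancel₀ (by positivity)
  have h6 : C * (|m - l| * ‖x‖) ≤ ‖x‖ / 2 := by
    have : C * |m - l| ≤ 1 / 2 := by nlinarith [abs_nonneg (m - l)]
    nlinarith [norm_nonneg x]
  have h7 : C * ‖y - (l : ℂ) • x‖ ≤ C * (‖y - (m : ℂ) • x‖ + |m - l| * ‖x‖) := by gcongr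
  linarith

/-- A nonnegative self-adjoint operator has a bounded resolvent at negative points. -/
theorem exists_resolvent_neg {T : E →ₗ.[ℂ] E} (hT : IsSelfAdjoint T)
    (hp : ∀ x : T.domain, 0 ≤ (⟪(x : E), T x⟫_ℂ).re) {l : ℝ} (hl : 0 < l) :
    ∃ R : E →L[ℂ] E, (∀ y, (R y, y - (l : ℂ) • R y) ∈ T.graph) ∧
      ∀ x y, (x, y) ∈ T.graph → R (y + (l : ℂ) • x) = x := by
  obtain ⟨R, h1, h2⟩ := inResolvent_iff.1
    ((boundedBelow_of_neg hp (neg_neg_of_pos hl)).inResolvent hT)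
  refine ⟨R, fun y => ?_, fun x y hxy => ?_⟩
  · simpa [sub_eq_add_neg] using h1 y
  · simpa using h2 x y hxy

theorem norm_sq_of_graph {T : E →ₗ.[ℂ] E} (hT : IsSelfAdjoint T) {x u y : E}
    (h1 : (x, u) ∈ T.graph) (h2 : (u, y) ∈ T.graph) : (⟪x, y⟫_ℂ).re = ‖u‖ ^ 2 := by
  rw [← isFormalAdjoint_graph (selfAdjoint_formal hT) h1 h2, inner_self_eq_norm_sq_to_K]
  norm_cast

/-- Since T² - l² = (T + l)(T - l) and T + l is bounded below, a bound for T - l passes to T² - l².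
Conversely, put u = (T + l)⁻¹x, so that (T² - l²)u = (T - l)x =: w. This bounds u, hence T²u = w +
l²u, hence Tu by ‖Tu‖² = Re⟨u, T²u⟩, and finally x = Tu + lu. -/
theorem boundedBelow_sq_iff {T : E →ₗ.[ℂ] E} (hT : IsSelfAdjoint T)
    (hp : ∀ x : T.domain, 0 ≤ (⟪(x : E), T x⟫_ℂ).re) {l : ℝ} (hl : 0 < l) :
    BoundedBelow (pcomp T T) (l ^ 2) ↔ BoundedBelow T l := by
  constructor
  · rintro ⟨C, hC0, hC⟩
    obtain ⟨R, hR1, hR2⟩ := exists_resolvent_neg hT hp hl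
    refine ⟨C + (1 + l ^ 2 * C) + l * C, by positivity, fun x y hxy => ?_⟩
    set w := y - (l : ℂ) • x with hw
    set u := R x with hu
    set p := x - (l : ℂ) • u with hpdef
    have h1 : (u, p) ∈ T.graph := hR1 x
    have h2 : (p, y - (l : ℂ) • p) ∈ T.graph := graph_sub_smul hxy h1 (l : ℂ)
    have h3 : y - (l : ℂ) • p - ((l ^ 2 : ℝ) : ℂ) • u = w := by
      rw [hw, hpdef, smul_sub, smul_smul]; push_cast; rw [sq]; abel
    have h4 := hC _ _ (mem_graph_pcomp.2 ⟨p, h1, h2⟩)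
    rw [h3] at h4
    have h5 : ‖y - (l : ℂ) • p‖ ≤ (1 + l ^ 2 * C) * ‖w‖ := by
      rw [sub_eq_iff_eq_add.1 h3]
      refine (norm_add_le _ _).trans ?_
      rw [norm_smul, Complex.norm_real, Real.norm_of_nonneg (by positivity)]
      nlinarith [sq_nonneg l]
    have h6 : ‖p‖ ^ 2 ≤ ‖u‖ * ‖y - (l : ℂ) • p‖ := by
      rw [← norm_sq_of_graph hT h1 h2]
      exact (Complex.re_le_norm _).trans (norm_inner_le_norm _ _)
    have h7 : ‖p‖ ≤ (C + (1 + l ^ 2 * C)) * ‖w‖ := by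
      refine abs_le_of_sq_le_sq' ?_ (by positivity) |>.2
      calc ‖p‖ ^ 2 ≤ ‖u‖ * ‖y - (l : ℂ) • p‖ := h6
        _ ≤ (C * ‖w‖) * ((1 + l ^ 2 * C) * ‖w‖) := by gcongr
        _ ≤ _ := by
          have h8 : 0 ≤ (C * ‖w‖) := by positivity
          have h9 : 0 ≤ ((1 + l ^ 2 * C) * ‖w‖) := by positivity
          nlinarith
    have h8 : x = p + (l : ℂ) • u := by simp [hpdef]
    calc ‖x‖ ≤ ‖p‖ + l * ‖u‖ := by
          conv_lhs => rw [h8]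
          refine (norm_add_le _ _).trans ?_
          rw [norm_smul, Complex.norm_real, Real.norm_of_nonneg hl.le]
      _ ≤ (C + (1 + l ^ 2 * C)) * ‖w‖ + l * (C * ‖w‖) := by gcongr
      _ = _ := by ring
  · rintro ⟨C, hC0, hC⟩
    obtain ⟨C', hC0', hC'⟩ := boundedBelow_of_neg hp (neg_neg_of_pos hl)
    refine ⟨C' * C, by positivity, fun x y hxy => ?_⟩
    obtain ⟨u, h1, h2⟩ := mem_graph_pcomp.1 hxy
    have h3 := graph_comb h2 h1 1 (l : ℂ)
    rw [one_smul, one_smul] at h3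
    have h4 := hC _ _ h3
    have h5 : y + (l : ℂ) • u - (l : ℂ) • (u + (l : ℂ) • x) = y - ((l ^ 2 : ℝ) : ℂ) • x := by
      rw [smul_add, smul_smul]; push_cast; rw [sq]; abel
    rw [h5] at h4
    have h6 := hC' _ _ h1
    simp only [Complex.ofReal_neg, neg_smul, sub_neg_eq_add] at h6
    rw [mul_assoc]
    exact h6.trans (by gcongr)

/-- For a formal adjoint pair with `b a = k T²`, the norm of `a x` is `√k ‖T x‖`. -/
theorem norm_sq_of_formalAdjoint {T a b : E →ₗ.[ℂ] E} (hT : IsSelfAdjoint T)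
    (hab : a.IsFormalAdjoint b) {k : ℝ} {x u v y : E} (h1 : (x, v) ∈ a.graph)
    (h2 : (v, (k : ℂ) • y) ∈ b.graph) (h3 : (x, u) ∈ T.graph) (h4 : (u, y) ∈ T.graph) :
    ‖v‖ ^ 2 = k * ‖u‖ ^ 2 := by
  have h5 := isFormalAdjoint_graph hab h1 h2
  rw [inner_smul_right, inner_self_eq_norm_sq_to_K] at h5
  have h6 := congrArg Complex.re h5
  rw [Complex.re_ofReal_mul, norm_sq_of_graph hT h3 h4] at h6
  rw [← h6]
  norm_cast

/-- The operators ba and ab share their nonzero spectrum. If (T² - m')x = w, applying a gives (T² -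
m)ax = (k/k')aw, so the assumed bound controls ax by aw. As ‖ax‖ = √k‖Tx‖ on dom T², this controls
Tx by Tw, not by w; therefore x and w are first smoothed with R² = (T + 1)⁻². Smoothing makes Tw
bounded by the original data and puts w in dom T², which is all that is known to lie in dom a. -/
theorem boundedBelow_swap {T a b : E →ₗ.[ℂ] E} (hT : IsSelfAdjoint T)
    (hp : ∀ x : T.domain, 0 ≤ (⟪(x : E), T x⟫_ℂ).re) (hf : a.IsFormalAdjoint b)
    {k k' : ℝ} (hk : 0 < k) (hk' : 0 < k')
    (hba : pcomp b a = (k : ℂ) • pcomp T T) (hab : pcomp a b = (k' : ℂ) • pcomp T T)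
    {m m' : ℝ} (hm' : 0 < m') (hm : k' * m = k * m') (h : BoundedBelow (pcomp T T) m) :
    BoundedBelow (pcomp T T) m' := by
  obtain ⟨R, hR1, hR2⟩ := exists_resolvent_neg hT hp one_pos
  simp only [Complex.ofReal_one, one_smul] at hR1 hR2
  have hcomm : ∀ x u, (x, u) ∈ T.graph → (R x, R u) ∈ T.graph := by
    intro x u hxu
    have h1 := hR2 x u hxu
    rw [map_add] at h1
    rw [eq_sub_of_add_eq h1]
    exact hR1 x
  have hba' : ∀ x u y, (x, u) ∈ T.graph → (u, y) ∈ T.graph →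
      ∃ v, (x, v) ∈ a.graph ∧ (v, (k : ℂ) • y) ∈ b.graph := by
    intro x u y h1 h2
    rw [← mem_graph_pcomp, hba, mem_graph_smul]
    exact ⟨y, mem_graph_pcomp.2 ⟨u, h1, h2⟩, rfl⟩
  obtain ⟨C, hC0, hC⟩ := h
  set r := ‖R‖ with hr
  set A := C * (k / k') * (r + r ^ 2) with hA
  set B := 1 + (A ^ 2 + r ^ 2) / m' with hB
  refine ⟨B + 2 * A + r ^ 2 + m' * B, by positivity, fun x0 y0 hxy => ?_⟩
  obtain ⟨u0, hxu, huy⟩ := mem_graph_pcomp.1 hxy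
  set w0 := y0 - (m' : ℂ) • x0 with hw0
  set x := R (R x0) with hx
  set u := R (R u0) with hu
  set y := R (R y0) with hy
  set w := R (R w0) with hw
  set w1 := R w0 - w with hw1
  have gxu : (x, u) ∈ T.graph := hcomm _ _ (hcomm _ _ hxu)
  have guy : (u, y) ∈ T.graph := hcomm _ _ (hcomm _ _ huy)
  have hyw : y = w + (m' : ℂ) • x := by
    simp only [hw, hw0, map_sub, map_smul, hy, hx]; abel
  have gw : (w, w1) ∈ T.graph := hR1 (R w0)
  have gw1 : (w1, (w0 - R w0) - w1) ∈ T.graph := by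
    have := graph_sub_smul (hR1 w0) gw 1
    rwa [one_smul, one_smul] at this
  obtain ⟨v, hv1, hv2⟩ := hba' _ _ _ gxu guy
  obtain ⟨s, hs1, hs2⟩ := hba' _ _ _ gw gw1
  have nv := norm_sq_of_formalAdjoint hT hf hv1 hv2 gxu guy
  have ns := norm_sq_of_formalAdjoint hT hf hs1 hs2 gw gw1
  have gy : ((k : ℂ) • y, (k : ℂ) • s + ((k * m' : ℝ) : ℂ) • v) ∈ a.graph := by
    have := graph_comb hs1 hv1 (k : ℂ) ((k * m' : ℝ) : ℂ)
    rw [hyw, smul_add, smul_smul]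
    exact_mod_cast this
  have hk'c : (k' : ℂ) ≠ 0 := by exact_mod_cast hk'.ne'
  obtain ⟨t, ht1, ht2⟩ : ∃ t, (v, t) ∈ (pcomp T T).graph ∧
      (k : ℂ) • s + ((k * m' : ℝ) : ℂ) • v = (k' : ℂ) • t := by
    rw [← mem_graph_smul, ← hab, mem_graph_pcomp]
    exact ⟨_, hv2, gy⟩
  have h1 := hC _ _ ht1
  have h2 : t - (m : ℂ) • v = ((k / k' : ℝ) : ℂ) • s := by
    have h3 : (k' : ℂ) • (t - (m : ℂ) • v) = (k : ℂ) • s := by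
      rw [smul_sub, ← ht2, smul_smul, ← hm]; push_cast; abel
    rw [← inv_smul_smul₀ hk'c (t - (m : ℂ) • v), h3, smul_smul]
    congr 1; push_cast; field_simp
  rw [h2, norm_smul, Complex.norm_real, Real.norm_of_nonneg (by positivity)] at h1
  set W := ‖w0‖ with hW
  have nw : ‖w‖ ≤ r ^ 2 * W := by
    calc ‖w‖ ≤ r * ‖R w0‖ := R.le_opNorm _
      _ ≤ r * (r * W) := by gcongr; exact R.le_opNorm _
      _ = _ := by ring
  have nw1 : ‖w1‖ ≤ (r + r ^ 2) * W := by
    calc ‖w1‖ ≤ ‖R w0‖ + ‖w‖ := norm_sub_le _ _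
      _ ≤ r * W + r ^ 2 * W := add_le_add (R.le_opNorm _) nw
      _ = _ := by ring
  have hsq : ∀ {p p' : E}, ‖p‖ ^ 2 = k * ‖p'‖ ^ 2 → ‖p‖ = √k * ‖p'‖ := by
    intro p p' h
    rw [← Real.sqrt_sq (norm_nonneg p), h, Real.sqrt_mul hk.le, Real.sqrt_sq (norm_nonneg _)]
  have nu : ‖u‖ ≤ A * W := by
    rw [hsq nv, hsq ns] at h1
    have hk0 : 0 < √k := Real.sqrt_pos.2 hk
    have h3 : ‖u‖ ≤ C * (k / k' * ‖w1‖) := by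
      refine le_of_mul_le_mul_left (h1.trans_eq ?_) hk0
      ring
    refine h3.trans ?_
    calc C * (k / k' * ‖w1‖) ≤ C * (k / k' * ((r + r ^ 2) * W)) := by gcongr
      _ = _ := by rw [hA]; ring
  have nx : ‖x‖ ≤ B * W := by
    have h3 : ‖u‖ ^ 2 = (⟪x, w⟫_ℂ).re + m' * ‖x‖ ^ 2 := by
      rw [← norm_sq_of_graph hT gxu guy, hyw, inner_add_right, inner_smul_right,
        inner_self_eq_norm_sq_to_K, Complex.add_re, Complex.re_ofReal_mul]
      norm_cast
    have h4 : -(‖x‖ * ‖w‖) ≤ (⟪x, w⟫_ℂ).re :=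
      (abs_le.1 ((Complex.abs_re_le_norm _).trans (norm_inner_le_norm _ _))).1
    have hW0 : 0 ≤ W := norm_nonneg _
    have hBW : B * W = W + (A ^ 2 + r ^ 2) / m' * W := by rw [hB]; ring
    -- The quadratic inequality m'‖x‖² ≤ A²W² + r²W‖x‖ becomes linear once W < ‖x‖, by W² ≤ W‖x‖;
    -- the summand 1 in B covers the other case.
    rcases le_or_gt ‖x‖ W with h5 | h5
    · rw [hBW]
      have : 0 ≤ (A ^ 2 + r ^ 2) / m' * W := by positivity
      linarith
    · have hx0 : 0 < ‖x‖ := hW0.trans_lt h5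
      have h6 : m' * ‖x‖ ^ 2 ≤ (A * W) ^ 2 + ‖x‖ * (r ^ 2 * W) := by
        have : ‖u‖ ^ 2 ≤ (A * W) ^ 2 := by gcongr
        have : ‖x‖ * ‖w‖ ≤ ‖x‖ * (r ^ 2 * W) := by gcongr
        linarith
      have h7 : (A * W) ^ 2 ≤ ‖x‖ * (A ^ 2 * W) := by
        have : 0 ≤ A ^ 2 * W := by positivity
        nlinarith
      have h8 : m' * ‖x‖ ≤ (A ^ 2 + r ^ 2) * W := by
        refine le_of_mul_le_mul_left ?_ hx0
        nlinarith
      have h9 : ‖x‖ ≤ (A ^ 2 + r ^ 2) / m' * W := by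
        rw [div_mul_eq_mul_div, le_div_iff₀ hm']; linarith
      rw [hBW]; linarith
  -- Undoing the smoothing: x0 = (T + 1)²x = T²x + 2Tx + x with T²x = w + m'x, and each term is
  -- already bounded by W.
  have hx0 : x0 = x + (2 : ℂ) • u + w + (m' : ℂ) • x := by
    have e1 : u = R x0 - x := graph_unique gxu (hR1 (R x0))
    have e2 : R x0 = u + x := by rw [e1]; abel
    have g := graph_comb guy gxu 1 1
    simp only [one_smul] at g
    have e3 : x0 - R x0 = y + u := graph_unique (hR1 x0) (by rwa [e2])
    have e4 : x0 = y + u + R x0 := by rw [← e3]; abel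
    rw [e4, e2, hyw, two_smul]; abel
  calc ‖x0‖ ≤ ‖x‖ + 2 * ‖u‖ + ‖w‖ + m' * ‖x‖ := by
        conv_lhs => rw [hx0]
        refine (norm_add_le _ _).trans (add_le_add ((norm_add_le _ _).trans
          (add_le_add ((norm_add_le _ _).trans (add_le_add le_rfl ?_)) le_rfl)) ?_)
        · rw [norm_smul]; simp
        · rw [norm_smul, Complex.norm_real, Real.norm_of_nonneg hm'.le]
    _ ≤ B * W + 2 * (A * W) + r ^ 2 * W + m' * (B * W) := by gcongr
    _ = _ := by ring

/-- Zero is in the spectrum of the modulus of a `q`-normal operator. -/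
theorem not_boundedBelow_zero [Nontrivial E] {T a b : E →ₗ.[ℂ] E} (hT : IsSelfAdjoint T)
    (hf : a.IsFormalAdjoint b) {q : ℝ} (hq0 : 0 < q) (hq1 : q < 1)
    (hba : pcomp b a = ((q ^ 2 : ℝ) : ℂ) • pcomp T T) (hab : pcomp a b = pcomp T T) :
    ¬ BoundedBelow T 0 := by
  intro h
  obtain ⟨K, hK1, hK2⟩ := inResolvent_iff.1 (h.inResolvent hT)
  simp only [Complex.ofReal_zero, zero_smul, add_zero, sub_zero] at hK1 hK2
  have hba' : ∀ x u y, (x, u) ∈ T.graph → (u, y) ∈ T.graph →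
      ∃ v, (x, v) ∈ a.graph ∧ (v, ((q ^ 2 : ℝ) : ℂ) • y) ∈ b.graph := by
    intro x u y h1 h2
    rw [← mem_graph_pcomp, hba, mem_graph_smul]
    exact ⟨y, mem_graph_pcomp.2 ⟨u, h1, h2⟩, rfl⟩
  have hdense : DenseRange K := by
    refine hT.dense_domain.mono fun x hx => ?_
    exact ⟨T ⟨x, hx⟩, hK2 _ _ (T.mem_graph ⟨x, hx⟩)⟩
  -- Put x = K⁴g and v = ax. Then ‖v‖ = q‖Tx‖ = q‖K³g‖, while bv = q²T²x gives ‖Tv‖ = ‖bv‖ =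
  -- q²‖K²g‖. Comparing through v = K(Tv) gains a factor q. The extra powers of K keep every vector
  -- in the required domains; the range of K² is dense, so the estimate extends to all of E.
  have hkey : ∀ g, ‖K (K (K g))‖ ≤ q * ‖K‖ * ‖K (K g)‖ := by
    intro g
    obtain ⟨v, hv1, hv2⟩ := hba' _ _ _ (hK1 (K (K (K g)))) (hK1 (K (K g)))
    obtain ⟨s, hs1, -⟩ := hba' _ _ _ (hK1 (K g)) (hK1 g)
    have gs : (((q ^ 2 : ℝ) : ℂ) • K (K g), ((q ^ 2 : ℝ) : ℂ) • s) ∈ a.graph :=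
      a.graph.smul_mem _ hs1
    have hv3 : (v, ((q ^ 2 : ℝ) : ℂ) • s) ∈ (pcomp T T).graph := by
      rw [← hab, mem_graph_pcomp]; exact ⟨_, hv2, gs⟩
    obtain ⟨t, ht1, ht2⟩ := mem_graph_pcomp.1 hv3
    have n1 := norm_sq_of_formalAdjoint hT hf hv1 hv2 (hK1 _) (hK1 _)
    have n2 : ‖((q ^ 2 : ℝ) : ℂ) • K (K g)‖ ^ 2 = ‖t‖ ^ 2 := by
      rw [← one_mul (‖t‖ ^ 2)]
      exact norm_sq_of_formalAdjoint hT hf.symm hv2 (k := 1) (by simpa using gs) ht1 ht2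
    have n2' : ‖t‖ = q ^ 2 * ‖K (K g)‖ := by
      rw [← (sq_eq_sq₀ (norm_nonneg _) (norm_nonneg _)).1 n2,
        norm_smul, Complex.norm_real, Real.norm_of_nonneg (by positivity)]
    have n1' : ‖v‖ = q * ‖K (K (K g))‖ := by
      rw [← mul_pow] at n1
      exact (sq_eq_sq₀ (norm_nonneg _) (by positivity)).1 n1
    have hvt : ‖v‖ ≤ ‖K‖ * ‖t‖ := by
      have := K.le_opNorm t
      rwa [hK2 _ _ ht1] at this
    rw [n1', n2'] at hvt
    refine le_of_mul_le_mul_left (hvt.trans_eq ?_) hq0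
    ring
  have hd2 : DenseRange (K ∘ K) := hdense.comp hdense K.continuous
  have hall : ∀ f, ‖K f‖ ≤ q * ‖K‖ * ‖f‖ := by
    intro f
    refine hd2.induction_on (p := fun f => ‖K f‖ ≤ q * ‖K‖ * ‖f‖) f ?_ hkey
    exact isClosed_le (by fun_prop) (by fun_prop)
  have h1 : ‖K‖ ≤ q * ‖K‖ := K.opNorm_le_bound (by positivity) hall
  have h2 : ‖K‖ = 0 := by nlinarith [norm_nonneg K]
  have h3 : K = 0 := norm_eq_zero.1 h2
  obtain ⟨x, hx⟩ := exists_ne (0 : E)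
  have h4 := (hd2.closure_range ▸ mem_univ x : x ∈ closure (range (K ∘ K)))
  simp [h3, Function.comp_def] at h4
  exact hx h4

/-- The spectrum of the modulus of a `q`-normal operator, as a `q`-invariant space. -/
theorem exists_qSpace_of_isQNormal [Nontrivial E] {q : ℝ} (hq0 : 0 < q) (hq1 : q < 1)
    {z T : E →ₗ.[ℂ] E} (hz : IsQNormal q z) (hT : IsModulus z T) :
    ∃ X : QSpace q, X.carrier = realSpectrum T := by
  have hf : z†.IsFormalAdjoint z := LinearPMap.adjoint_isFormalAdjoint hz.dense
  have hsq : pcomp z† z = pcomp T T := hT.sq.symm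
  have hrel : pcomp z z† = ((q ^ 2 : ℝ) : ℂ) • pcomp T T := by
    rw [hz.rel, hsq]; push_cast; rfl
  have hsq' : pcomp z† z = ((1 : ℝ) : ℂ) • pcomp T T := by
    rw [hsq, Complex.ofReal_one, one_smul]
  have hnonneg : ∀ x ∈ realSpectrum T, 0 ≤ x := fun x hx => by
    by_contra h
    exact (mem_realSpectrum_iff hT.selfAdjoint).1 hx (boundedBelow_of_neg hT.nonneg (not_le.1 h))
  have hzero : 0 ∈ realSpectrum T := (mem_realSpectrum_iff hT.selfAdjoint).2
    (not_boundedBelow_zero hT.selfAdjoint hf hq0 hq1 hrel hsq)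
  -- One swap has (a, b) = (z*, z) and (k, k') = (q², 1); the other exchanges both pairs. The points
  -- m, m' are (qx)² and x².
  have hiff : ∀ x : ℝ, 0 < x → (BoundedBelow T (q * x) ↔ BoundedBelow T x) := by
    intro x hx
    rw [← boundedBelow_sq_iff hT.selfAdjoint hT.nonneg hx,
      ← boundedBelow_sq_iff hT.selfAdjoint hT.nonneg (mul_pos hq0 hx)]
    constructor
    · exact boundedBelow_swap hT.selfAdjoint hT.nonneg hf (by positivity) one_pos hrel hsq'
        (by positivity) (by ring)
    · exact boundedBelow_swap hT.selfAdjoint hT.nonneg hf.symm one_pos (by positivity) hsq' hrel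
        (by positivity) (by ring)
  refine ⟨⟨realSpectrum T, hq0, hq1, isClosed_realSpectrum hT.selfAdjoint, hnonneg, hzero,
    fun x hx => ?_, fun x hx => ?_⟩, rfl⟩
  · rcases (hnonneg x hx).eq_or_lt with h | h
    · rw [← h, mul_zero]; exact hzero
    · rw [mem_realSpectrum_iff hT.selfAdjoint] at hx ⊢
      rwa [hiff x h]
  · rcases (hnonneg _ hx).eq_or_lt with h | h
    · rcases mul_eq_zero.1 h.symm with h | h
      · exact absurd h hq0.ne'
      · rwa [h]
    · have hx0 : 0 < x := pos_of_mul_pos_right h hq0.le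
      rw [mem_realSpectrum_iff hT.selfAdjoint] at hx ⊢
      rwa [← hiff x hx0]

end Spectral

/-! ### Fredholm operators with a one-sided inverse -/

section OneSided

open scoped LinearMap.FiniteRangeSetoid

variable {E F : Type*} [NormedAddCommGroup E] [NormedSpace ℂ E] [NormedAddCommGroup F]
  [NormedSpace ℂ F] {T : E →L[ℂ] F} {S : F →L[ℂ] E}

/-- The operator T kills STx - x, so ST differs from the identity by an operator with values in the
finite-dimensional kernel of T, while TS is the identity exactly. -/
theorem isQuasiInverse_of_rightInverse (h : ∀ y, T (S y) = y) [FiniteDimensional ℂ T.ker] :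
    LinearMap.IsQuasiInverse (S : F →ₗ[ℂ] E) (T : E →ₗ[ℂ] F) := by
  constructor
  · rw [LinearMap.IsLeftQuasiInverse, LinearMap.FiniteRangeSetoid.equiv_iff_hasNoetherianRange]
    refine isNoetherian_of_le (t := T.ker) ?_
    rintro _ ⟨x, rfl⟩
    simp [h]
  · have : (T : E →ₗ[ℂ] F) ∘ₗ (S : F →ₗ[ℂ] E) = LinearMap.id := LinearMap.ext h
    rw [LinearMap.IsRightQuasiInverse, this]

/-- A bounded operator with a bounded right inverse and a kernel of dimension `n` is Fredholm of
index `n`. -/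
theorem fredholm_of_rightInverse (h : ∀ y, T (S y) = y) [FiniteDimensional ℂ T.ker] :
    T.IsFredholm ∧ fredholmIndex T = Module.finrank ℂ T.ker := by
  refine ⟨.of_isQuasiInverse (isQuasiInverse_of_rightInverse h), ?_⟩
  have hr : T.range = ⊤ := LinearMap.range_eq_top.2 fun y => ⟨S y, h y⟩
  have : Subsingleton (F ⧸ T.range) := Submodule.Quotient.subsingleton_iff.2 hr
  rw [fredholmIndex, Module.finrank_zero_of_subsingleton (M := F ⧸ T.range)]
  simp

/-- A bounded right inverse of a bounded operator with a kernel of dimension `n` is Fredholm of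
index `-n`. -/
theorem fredholm_rightInverse (h : ∀ y, T (S y) = y) [FiniteDimensional ℂ T.ker] :
    S.IsFredholm ∧ fredholmIndex S = -(Module.finrank ℂ T.ker : ℤ) := by
  refine ⟨.of_isQuasiInverse (isQuasiInverse_of_rightInverse h).symm, ?_⟩
  have hk : S.ker = ⊥ := LinearMap.ker_eq_bot.2 (Function.LeftInverse.injective h)
  -- The idempotent 1 - ST maps onto ker T with kernel ran S, hence coker S ≅ ker T.
  let g : E →ₗ[ℂ] T.ker := LinearMap.codRestrict T.ker
    (LinearMap.id - (S : F →ₗ[ℂ] E) ∘ₗ (T : E →ₗ[ℂ] F)) (fun x => by simp [h])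
  have hg : ∀ x, (g x : E) = x - S (T x) := fun x => rfl
  have hgs : Function.Surjective g := fun x => ⟨x, by
    ext
    have hx : T (x : E) = 0 := x.2
    rw [hg, hx, map_zero, sub_zero]⟩
  have hgk : LinearMap.ker g = S.range := by
    ext x
    rw [LinearMap.mem_ker, Subtype.ext_iff, hg]
    constructor
    · intro hx
      exact ⟨T x, (sub_eq_zero.1 hx).symm⟩
    · rintro ⟨y, rfl⟩
      simp [h]
  have e := g.quotKerEquivOfSurjective hgs
  rw [hgk] at e
  rw [fredholmIndex, hk, e.finrank_eq]
  simp

end OneSided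

/-! ### Index pairings computed from factorizations of projections -/

section Factor

variable {A : Type*} [Ring A] [StarRing A] [Algebra ℂ A]
  {H : Type*} [NormedAddCommGroup H] [InnerProductSpace ℂ H]
  {K L : Type*} [NormedAddCommGroup K] [NormedSpace ℂ K] [NormedAddCommGroup L] [NormedSpace ℂ L]
  {N : ℕ}

/-- The operator `K → H^N` with components `v i`. -/
def colOp (v : Fin N → K →L[ℂ] H) : K →L[ℂ] PiLp 2 (fun _ : Fin N => H) :=
  (PiLp.continuousLinearEquiv 2 ℂ (fun _ : Fin N => H)).symm.toContinuousLinearMap ∘L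
    ContinuousLinearMap.pi v

/-- The operator `H^N → K` with components `v i`. -/
def rowOp (v : Fin N → H →L[ℂ] K) : PiLp 2 (fun _ : Fin N => H) →L[ℂ] K :=
  ∑ j, v j ∘L PiLp.proj 2 (fun _ : Fin N => H) j

theorem colOp_apply (v : Fin N → K →L[ℂ] H) (x : K) (i : Fin N) : colOp v x i = v i x := by
  simp [colOp]

theorem rowOp_apply (v : Fin N → H →L[ℂ] K) (ξ : PiLp 2 (fun _ : Fin N => H)) :
    rowOp v ξ = ∑ j, v j (ξ j) := by
  simp [rowOp]

variable [CompleteSpace H]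

theorem amplify_eq_colOp {π : A →⋆ₙₐ[ℂ] (H →L[ℂ] H)} {p : Matrix (Fin N) (Fin N) A}
    {v : Fin N → K →L[ℂ] H} {v' : Fin N → H →L[ℂ] K} (h : ∀ i j, π (p i j) = v i ∘L v' j)
    (ξ : PiLp 2 (fun _ : Fin N => H)) : amplify π p ξ = colOp v (rowOp v' ξ) := by
  ext i
  rw [amplify_apply, colOp_apply, rowOp_apply, map_sum]
  simp [h]

/-- If `π(p) = v v'` with `v' v = 1`, then `v` is an isomorphism onto the range of `π(p)`. -/
def rangeEquiv {π : A →⋆ₙₐ[ℂ] (H →L[ℂ] H)} {p : Matrix (Fin N) (Fin N) A}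
    {v : Fin N → K →L[ℂ] H} {v' : Fin N → H →L[ℂ] K} (h : ∀ i j, π (p i j) = v i ∘L v' j)
    (hv : ∀ x, ∑ i, v' i (v i x) = x) : K ≃L[ℂ] (amplify π p).range :=
  have hv' : ∀ x, rowOp v' (colOp v x) = x := fun x => by
    simp only [rowOp_apply, colOp_apply, hv]
  ContinuousLinearEquiv.equivOfInverse
    ((colOp v).codRestrict (amplify π p).range
      (fun x => ⟨colOp v x, by
        change amplify π p (colOp v x) = _
        rw [amplify_eq_colOp h, hv']⟩))
    (rowOp v' ∘L (amplify π p).range.subtypeL)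
    hv'
    (by
      rintro ⟨_, ξ, rfl⟩
      ext1
      change colOp v (rowOp v' (amplify π p ξ)) = amplify π p ξ
      rw [amplify_eq_colOp h, hv'])

variable {πm πp : A →⋆ₙₐ[ℂ] (H →L[ℂ] H)} {p : Matrix (Fin N) (Fin N) A}
    {v : Fin N → K →L[ℂ] H} {v' : Fin N → H →L[ℂ] K} {w : Fin N → L →L[ℂ] H}
    {w' : Fin N → H →L[ℂ] L}

/-- In the coordinates v and w of the two ranges the pairing operator is w'v: w w' v x = w(w'v x).
-/
theorem pairingOp_rangeEquiv (hm : ∀ i j, πm (p i j) = v i ∘L v' j)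
    (hv : ∀ x, ∑ i, v' i (v i x) = x) (hp : ∀ i j, πp (p i j) = w i ∘L w' j)
    (hw : ∀ x, ∑ i, w' i (w i x) = x) (x : K) :
    pairingOp πm πp p (rangeEquiv hm hv x) = rangeEquiv hp hw (∑ i, w' i (v i x)) := by
  ext1
  change amplify πp p (colOp v x) = colOp w (∑ i, w' i (v i x))
  rw [amplify_eq_colOp hp, rowOp_apply]
  simp only [colOp_apply]

/-- Transporting D and S through the coordinates of the ranges reduces this to
`fredholm_of_rightInverse`. The kernel is given as an explicit copy of ℂⁿ, which supplies both
finiteness and dimension. -/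
theorem pairing_of_rightInverse (hm : ∀ i j, πm (p i j) = v i ∘L v' j)
    (hv : ∀ x, ∑ i, v' i (v i x) = x) (hp : ∀ i j, πp (p i j) = w i ∘L w' j)
    (hw : ∀ x, ∑ i, w' i (w i x) = x) {D : K →L[ℂ] L} (hD : ∀ x, ∑ i, w' i (v i x) = D x)
    {S : L →L[ℂ] K} (hS : ∀ y, D (S y) = y) {n : ℕ}
    (e : LinearMap.ker D.toLinearMap ≃ₗ[ℂ] (Fin n → ℂ)) :
    (pairingOp πm πp p).IsFredholm ∧ fredholmIndex (pairingOp πm πp p) = n := by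
  set T := pairingOp πm πp p
  have hT : ∀ x, T (rangeEquiv hm hv x) = rangeEquiv hp hw (D x) := fun x => by
    rw [← hD]; exact pairingOp_rangeEquiv hm hv hp hw x
  let S' : (amplify πp p).range →L[ℂ] (amplify πm p).range :=
    (rangeEquiv hm hv : K →L[ℂ] _) ∘L S ∘L ((rangeEquiv hp hw).symm : _ →L[ℂ] L)
  have hS' : ∀ y, T (S' y) = y := fun y => by
    change T (rangeEquiv hm hv (S ((rangeEquiv hp hw).symm y))) = y
    rw [hT, hS, ContinuousLinearEquiv.apply_symm_apply]
  have hker : LinearMap.ker D.toLinearMap =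
      T.ker.comap ((rangeEquiv hm hv).toLinearEquiv : K →ₗ[ℂ] (amplify πm p).range) := by
    ext x
    change D x = 0 ↔ T (rangeEquiv hm hv x) = 0
    rw [hT, map_eq_zero_iff _ (rangeEquiv hp hw).injective]
  let e1 : (Fin n → ℂ) ≃ₗ[ℂ] T.ker :=
    e.symm.trans ((LinearEquiv.ofEq _ _ hker).trans
      ((rangeEquiv hm hv).toLinearEquiv.ofSubmodule' T.ker))
  have : FiniteDimensional ℂ T.ker := Module.Finite.equiv e1
  obtain ⟨h1, h2⟩ := fredholm_of_rightInverse hS'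
  exact ⟨h1, by rw [h2, ← e1.finrank_eq]; simp⟩

/-- Here the transported D is a right inverse of the transported S, so its cokernel is the
n-dimensional kernel of S and the sign is negative. -/
theorem pairing_of_leftInverse (hm : ∀ i j, πm (p i j) = v i ∘L v' j)
    (hv : ∀ x, ∑ i, v' i (v i x) = x) (hp : ∀ i j, πp (p i j) = w i ∘L w' j)
    (hw : ∀ x, ∑ i, w' i (w i x) = x) {D : K →L[ℂ] L} (hD : ∀ x, ∑ i, w' i (v i x) = D x)
    {S : L →L[ℂ] K} (hS : ∀ y, S (D y) = y) {n : ℕ}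
    (e : LinearMap.ker S.toLinearMap ≃ₗ[ℂ] (Fin n → ℂ)) :
    (pairingOp πm πp p).IsFredholm ∧ fredholmIndex (pairingOp πm πp p) = -n := by
  set T := pairingOp πm πp p
  have hT : ∀ x, T (rangeEquiv hm hv x) = rangeEquiv hp hw (D x) := fun x => by
    rw [← hD]; exact pairingOp_rangeEquiv hm hv hp hw x
  let S' : (amplify πp p).range →L[ℂ] (amplify πm p).range :=
    (rangeEquiv hm hv : K →L[ℂ] _) ∘L S ∘L ((rangeEquiv hp hw).symm : _ →L[ℂ] L)
  have hS' : ∀ y, S' (T y) = y := fun y => by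
    obtain ⟨x, rfl⟩ := (rangeEquiv hm hv).surjective y
    rw [hT]
    change rangeEquiv hm hv (S ((rangeEquiv hp hw).symm (rangeEquiv hp hw (D x)))) = _
    rw [ContinuousLinearEquiv.symm_apply_apply, hS]
  have hker : LinearMap.ker S.toLinearMap =
      S'.ker.comap ((rangeEquiv hp hw).toLinearEquiv : L →ₗ[ℂ] (amplify πp p).range) := by
    ext x
    change S x = 0 ↔ rangeEquiv hm hv (S ((rangeEquiv hp hw).symm (rangeEquiv hp hw x))) = 0
    rw [ContinuousLinearEquiv.symm_apply_apply, map_eq_zero_iff _ (rangeEquiv hm hv).injective]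
  let e1 : (Fin n → ℂ) ≃ₗ[ℂ] S'.ker :=
    e.symm.trans ((LinearEquiv.ofEq _ _ hker).trans
      ((rangeEquiv hp hw).toLinearEquiv.ofSubmodule' S'.ker))
  have : FiniteDimensional ℂ S'.ker := Module.Finite.equiv e1
  obtain ⟨h1, h2⟩ := fredholm_rightInverse hS'
  exact ⟨h1, by rw [h2, ← e1.finrank_eq]; simp⟩

end Factor

/-! ### Compactness of diagonal operators and the Fredholm module of a point of `X` -/

section Compact

theorem norm_diag_le {a : ℤ → ℂ} (ha : ∃ C : ℝ, ∀ n, ‖a n‖ ≤ C) {C : ℝ} (hC : ∀ n, ‖a n‖ ≤ C) :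
    ‖diag a ha‖ ≤ C := by
  have hC0 : 0 ≤ C := (norm_nonneg _).trans (hC 0)
  refine ContinuousLinearMap.opNorm_le_bound _ hC0 fun x => ?_
  have h := lp.norm_mono (p := 2) (E := fun _ : ℤ => ℂ) (F := fun _ : ℤ => ℂ) (by norm_num)
    (x := diag a ha x) (y := (C : ℂ) • x) (fun n => by
      change ‖a n * x n‖ ≤ ‖(C : ℂ) * x n‖
      rw [norm_mul, norm_mul, Complex.norm_real, Real.norm_of_nonneg hC0]
      exact mul_le_mul_of_nonneg_right (hC n) (norm_nonneg _))
  rwa [norm_smul, Complex.norm_real, Real.norm_of_nonneg hC0] at h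

theorem memlp_of_finite {f : ℤ → ℂ} {s : Set ℤ} (hs : s.Finite) (h : ∀ n, n ∉ s → f n = 0) :
    Memℓp f 2 :=
  (memℓp_zero (hs.subset fun n (hn : f n ≠ 0) => by
    by_contra h'
    exact hn (h n h'))).of_exponent_ge zero_le

/-- The operator factors through the finite-dimensional space of coordinates in s. -/
theorem isCompactOperator_diag_of_finite {a : ℤ → ℂ} (ha : ∃ C : ℝ, ∀ n, ‖a n‖ ≤ C)
    {s : Finset ℤ} (h : ∀ n, n ∉ s → a n = 0) : IsCompactOperator (diag a ha) := by
  let A : L2Z →L[ℂ] (s → ℂ) :=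
    ContinuousLinearMap.pi fun i => lp.evalCLM ℂ (fun _ : ℤ => ℂ) 2 (i : ℤ)
  let B : (s → ℂ) →ₗ[ℂ] L2Z :=
    { toFun := fun c => ⟨fun n => if hn : n ∈ s then a n * c ⟨n, hn⟩ else 0,
        memlp_of_finite s.finite_toSet (fun n hn => dif_neg hn)⟩
      map_add' := fun c d => by
        ext n
        change (if hn : n ∈ s then a n * (c ⟨n, hn⟩ + d ⟨n, hn⟩) else 0) =
          (if hn : n ∈ s then a n * c ⟨n, hn⟩ else 0) + (if hn : n ∈ s then a n * d ⟨n, hn⟩ else 0)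
        split_ifs <;> simp [mul_add]
      map_smul' := fun r c => by
        ext n
        change (if hn : n ∈ s then a n * (r * c ⟨n, hn⟩) else 0) =
          r * (if hn : n ∈ s then a n * c ⟨n, hn⟩ else 0)
        split_ifs <;> ring }
  have hBA : (diag a ha : L2Z → L2Z) = LinearMap.toContinuousLinearMap B ∘ A := by
    ext x n
    change a n * x n = if hn : n ∈ s then a n * x n else 0
    split_ifs with hn
    · rfl
    · rw [h n hn, zero_mul]
  rw [hBA]
  exact (isCompactOperator_of_locallyCompactSpace_dom A).clm_comp _

/-- Truncations to finite sets converge in norm, since the norm of a diagonal operator is bounded by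
any bound on its entries. -/
theorem isCompactOperator_diag {a : ℤ → ℂ} (ha : ∃ C : ℝ, ∀ n, ‖a n‖ ≤ C)
    (h : Tendsto a cofinite (𝓝 0)) : IsCompactOperator (diag a ha) := by
  classical
  have hb : ∀ s : Finset ℤ, ∃ C : ℝ, ∀ n, ‖(if n ∈ s then a n else 0)‖ ≤ C := by
    intro s
    obtain ⟨C, hC⟩ := ha
    refine ⟨C, fun n => ?_⟩
    split_ifs
    · exact hC n
    · rw [norm_zero]; exact (norm_nonneg _).trans (hC 0)
  refine isCompactOperator_of_tendsto (l := (atTop : Filter (Finset ℤ)))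
    (F := fun s => diag (fun n => if n ∈ s then a n else 0) (hb s)) ?_
    (Eventually.of_forall fun s => isCompactOperator_diag_of_finite _ (s := s)
      (fun n hn => if_neg hn))
  rw [Metric.tendsto_atTop]
  intro ε hε
  have hfin : {n | ¬ ‖a n‖ < ε / 2}.Finite := by
    have := (tendsto_zero_iff_norm_tendsto_zero.1 h).eventually_lt_const (half_pos hε)
    rwa [eventually_cofinite] at this
  refine ⟨hfin.toFinset, fun s hs => ?_⟩
  rw [dist_eq_norm]
  have hb' : ∀ n, ‖(if n ∈ s then a n else 0) - a n‖ ≤ ε / 2 := by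
    intro n
    split_ifs with hn
    · rw [sub_self, norm_zero]; exact (half_pos hε).le
    · rw [zero_sub, norm_neg]
      by_contra h'
      exact hn (hs (hfin.mem_toFinset.2 fun h'' => h' h''.le))
  have he : diag (fun n => if n ∈ s then a n else 0) (hb s) - diag a ha
      = diag (fun n => (if n ∈ s then a n else 0) - a n) ⟨_, hb'⟩ := by
    ext x n
    exact (sub_mul _ _ _).symm
  rw [he]
  exact (norm_diag_le _ hb').trans_lt (half_lt_self hε)

end Compact

/-! ### Evaluation of f U^k in the covariant pairs at 0, at ∞ and along an orbit -/

section Evaluation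

variable {q : ℝ} (X : QSpace q)

theorem CovPair.eval_gen_zpow (r : CovPair X) (k : ℤ) :
    r.eval X ((gen X ^ k : unitary (Univ X)) : Univ X) = ((r.U ^ k : unitary r.B) : r.B) := by
  let e : Univ X →⋆* r.B :=
    { toFun := r.eval X
      map_one' := map_one _
      map_mul' := map_mul _
      map_star' := map_star _ }
  have h : Unitary.map e (gen X) = r.U := Subtype.ext rfl
  rw [← h, ← map_zpow]
  rfl

theorem CovPair.continuous_eval (r : CovPair X) : Continuous (r.eval X) :=
  AddMonoidHomClass.continuous_of_bound (r.eval X) 1 fun a => by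
    rw [one_mul]
    exact lp.norm_apply_le_norm ENNReal.top_ne_zero a r

/-- The character `f ↦ f(0)`, `U ↦ 1` of the crossed product. -/
def evalZero : Univ X →⋆ₐ[ℂ] ℂ := (ev0Pair X).eval X

/-- The character `f ↦ f(∞)`, `U ↦ 1` of the crossed product. -/
def evalInfty : Univ X →⋆ₐ[ℂ] ℂ := (evInftyPair X).eval X

theorem evalZero_apply (f : C(Pts X, ℂ)) (k : ℤ) :
    evalZero X (fn X f * ((gen X ^ k : unitary (Univ X)) : Univ X)) = f (pt0 X) := by
  rw [map_mul]
  have h : evalZero X ((gen X ^ k : unitary (Univ X)) : Univ X)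
      = (((1 : unitary ℂ) ^ k : unitary ℂ) : ℂ) := (ev0Pair X).eval_gen_zpow X k
  rw [h, one_zpow, OneMemClass.coe_one, mul_one]
  rfl

theorem evalInfty_apply (f : C(Pts X, ℂ)) (k : ℤ) :
    evalInfty X (fn X f * ((gen X ^ k : unitary (Univ X)) : Univ X)) = f OnePoint.infty := by
  rw [map_mul]
  have h : evalInfty X ((gen X ^ k : unitary (Univ X)) : Univ X)
      = (((1 : unitary ℂ) ^ k : unitary ℂ) : ℂ) := (evInftyPair X).eval_gen_zpow X k
  rw [h, one_zpow, OneMemClass.coe_one, mul_one]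
  rfl

/-- The bilateral shift as a unitary operator. -/
def shiftU : unitary (L2Z →L[ℂ] L2Z) := Unitary.linearIsometryEquiv.symm shiftEquiv

theorem shiftU_zpow_apply (k : ℤ) (x : L2Z) (m : ℤ) :
    ((shiftU ^ k : unitary (L2Z →L[ℂ] L2Z)) : L2Z →L[ℂ] L2Z) x m = x (m + k) := by
  have h1 : ∀ (x : L2Z) (m : ℤ), (shiftU : L2Z →L[ℂ] L2Z) x m = x (m + 1) := fun x m => rfl
  have h2 : ∀ (x : L2Z) (m : ℤ),
      ((shiftU⁻¹ : unitary (L2Z →L[ℂ] L2Z)) : L2Z →L[ℂ] L2Z) x m = x (m - 1) := by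
    intro x m
    have h3 : (shiftU : L2Z →L[ℂ] L2Z)
        (((shiftU⁻¹ : unitary (L2Z →L[ℂ] L2Z)) : L2Z →L[ℂ] L2Z) x) = x :=
      congrArg (fun u : unitary (L2Z →L[ℂ] L2Z) => (u : L2Z →L[ℂ] L2Z) x)
        (mul_inv_cancel shiftU)
    have h4 := h1 (((shiftU⁻¹ : unitary (L2Z →L[ℂ] L2Z)) : L2Z →L[ℂ] L2Z) x) (m - 1)
    rw [h3, sub_add_cancel] at h4
    exact h4.symm
  induction k generalizing x m with
  | zero => simp
  | succ k ih =>
    rw [zpow_add_one]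
    refine (ih _ m).trans ((h1 x _).trans ?_)
    rw [add_assoc]
  | pred k ih =>
    rw [zpow_sub_one]
    refine (ih _ m).trans ((h2 x _).trans ?_)
    rw [add_sub_assoc]

variable {y : ℝ} (hy : y ∈ X.carrier)

/-- The representation `π_y` of the crossed product. -/
def evalY : Univ X →⋆ₐ[ℂ] (L2Z →L[ℂ] L2Z) := (pairY X hy).eval X

theorem continuous_evalY : Continuous (evalY X hy) := (pairY X hy).continuous_eval X

theorem continuous_evalZero : Continuous (evalZero X) := (ev0Pair X).continuous_eval X

theorem continuous_evalInfty : Continuous (evalInfty X) := (evInftyPair X).continuous_eval X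

theorem evalY_gen_zpow (k : ℤ) :
    evalY X hy ((gen X ^ k : unitary (Univ X)) : Univ X)
      = ((shiftU ^ k : unitary (L2Z →L[ℂ] L2Z)) : L2Z →L[ℂ] L2Z) :=
  (pairY X hy).eval_gen_zpow X k

theorem evalY_fn_apply (f : C(Pts X, ℂ)) (x : L2Z) (m : ℤ) :
    evalY X hy (fn X f) x m = f (pt (q ^ m * y) (zpow_mul_mem X hy m)) * x m := rfl

theorem evalY_gen_zpow_apply (k : ℤ) (x : L2Z) (m : ℤ) :
    evalY X hy ((gen X ^ k : unitary (Univ X)) : Univ X) x m = x (m + k) := by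
  rw [evalY_gen_zpow, shiftU_zpow_apply]

theorem evalY_apply (f : C(Pts X, ℂ)) (k : ℤ) (x : L2Z) (m : ℤ) :
    evalY X hy (fn X f * ((gen X ^ k : unitary (Univ X)) : Univ X)) x m
      = f (pt (q ^ m * y) (zpow_mul_mem X hy m)) * x (m + k) := by
  rw [map_mul, mul_apply_eq_comp, evalY_fn_apply, evalY_gen_zpow_apply]

end Evaluation

/-! ### The Fredholm module of a point y > 0 -/

section PointModule

variable {q : ℝ} (X : QSpace q) {y : ℝ}

theorem tendsto_zpow_atTop_zero {q : ℝ} (h0 : 0 < q) (h1 : q < 1) :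
    Tendsto (fun m : ℤ => q ^ m) atTop (𝓝 0) := by
  have h : Tendsto (fun m : ℤ => q ^ m.toNat) atTop (𝓝 0) :=
    (tendsto_pow_atTop_nhds_zero_of_lt_one h0.le h1).comp
      (tendsto_atTop.2 fun b => by
        filter_upwards [eventually_ge_atTop (b : ℤ)] with m hm
        omega)
  refine h.congr' ?_
  filter_upwards [eventually_ge_atTop (0 : ℤ)] with m hm
  rw [← zpow_natCast, Int.toNat_of_nonneg hm]

theorem tendsto_zpow_atBot_atTop {q : ℝ} (h0 : 0 < q) (h1 : q < 1) :
    Tendsto (fun m : ℤ => q ^ m) atBot atTop := by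
  have h : Tendsto (fun m : ℤ => (q ^ (-m))⁻¹) atBot atTop := by
    refine Tendsto.inv_tendsto_nhdsGT_zero ?_
    rw [tendsto_nhdsWithin_iff]
    exact ⟨(tendsto_zpow_atTop_zero h0 h1).comp tendsto_neg_atBot_atTop,
      Eventually.of_forall fun m => zpow_pos h0 _⟩
  simpa using h

theorem tendsto_orbit_atTop (hy : y ∈ X.carrier) :
    Tendsto (fun m : ℤ => pt (q ^ m * y) (zpow_mul_mem X hy m)) atTop (𝓝 (pt0 X)) := by
  refine (OnePoint.continuous_coe.tendsto _).comp (tendsto_subtype_rng.2 ?_)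
  simpa using (tendsto_zpow_atTop_zero X.q_pos X.q_lt_one).mul_const y

/-- Compact subsets of X are bounded, while q^m y is eventually larger than any bound as m → -∞;
this needs y ≠ 0. -/
theorem tendsto_orbit_atBot (hy : y ∈ X.carrier) (hy0 : 0 < y) :
    Tendsto (fun m : ℤ => pt (q ^ m * y) (zpow_mul_mem X hy m)) atBot (𝓝 OnePoint.infty) := by
  refine OnePoint.tendsto_coe_infty.comp ?_
  rw [coclosedCompact_eq_cocompact, hasBasis_cocompact.tendsto_right_iff]
  intro K hK
  obtain ⟨b, hb⟩ := (hK.image continuous_subtype_val).bddAbove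
  have h1 := (tendsto_zpow_atBot_atTop X.q_pos X.q_lt_one).atTop_mul_const hy0
  filter_upwards [h1.eventually_gt_atTop b] with m hm hK'
  exact absurd (hb ⟨_, hK', rfl⟩) (not_le.2 hm)

theorem PiPlus_add_PiMinus : PiPlus + PiMinus = 1 := by
  ext x n
  change (if n ∈ Ioi 0 then (1 : ℂ) else 0) * x n + (if n ∈ Iic 0 then (1 : ℂ) else 0) * x n = x n
  by_cases h : 0 < n <;> simp [h, not_le.2, not_lt.1]

/-- `(π_y, π_0 ⊕ π_∞)` is an even Fredholm module. -/
theorem isEvenFredholmModule_piY (hy : y ∈ X.carrier) (hy0 : 0 < y) :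
    IsEvenFredholmModule (piY X hy) (piZeroInfty X) := by
  -- The difference of the representations is extended to the whole crossed product, where it is
  -- linear and continuous and vanishes at 1. Compact operators form a closed subspace, so only the
  -- generators f U^k need checking.
  let Δ : Univ X → (L2Z →L[ℂ] L2Z) := fun a => evalY X hy a
      - (evalZero X a • PiPlus + evalInfty X a • PiMinus)
  have hadd : ∀ a b, Δ (a + b) = Δ a + Δ b := fun a b => by
    simp only [Δ, map_add, add_smul]; abel
  have hsmul : ∀ (c : ℂ) a, Δ (c • a) = c • Δ a := fun c a => by
    simp only [Δ, map_smul, smul_sub, smul_add, smul_assoc]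
  have hone : Δ 1 = 0 := by
    simp only [Δ, map_one]
    rw [sub_eq_zero]
    rw [one_smul, one_smul, PiPlus_add_PiMinus]
  have hcont : Continuous Δ :=
    (continuous_evalY X hy).sub (((continuous_evalZero X).smul continuous_const).add
      ((continuous_evalInfty X).smul continuous_const))
  have hgen : ∀ a ∈ czzGens X, IsCompactOperator (Δ a) := by
    rintro _ ⟨f, k, hfi, hf0, rfl⟩
    let g : ℤ → ℂ := fun m => f (pt (q ^ m * y) (zpow_mul_mem X hy m))
      - if 0 < m then f (pt0 X) else f OnePoint.infty
    have hg : Tendsto g cofinite (𝓝 0) := by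
      rw [Int.cofinite_eq, tendsto_sup]
      constructor
      · have h1 := (f.continuous.tendsto _).comp (tendsto_orbit_atBot X hy hy0)
        have h2 := h1.sub_const (f OnePoint.infty)
        rw [sub_self] at h2
        refine h2.congr' ?_
        filter_upwards [eventually_le_atBot (0 : ℤ)] with m hm
        simp only [g, if_neg (not_lt.2 hm), Function.comp_apply]
      · have h1 := (f.continuous.tendsto _).comp (tendsto_orbit_atTop X hy)
        have h2 := h1.sub_const (f (pt0 X))
        rw [sub_self] at h2
        refine h2.congr' ?_
        filter_upwards [eventually_gt_atTop (0 : ℤ)] with m hm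
        simp only [g, if_pos hm, Function.comp_apply]
    have hgb : ∃ C : ℝ, ∀ n, ‖g n‖ ≤ C := by
      refine ⟨‖f‖ + ‖f‖, fun n => (norm_sub_le _ _).trans
        (add_le_add (f.norm_coe_le_norm _) ?_)⟩
      split_ifs <;> exact f.norm_coe_le_norm _
    have he : (Δ (fn X f * ((gen X ^ k : unitary (Univ X)) : Univ X)) : L2Z → L2Z)
        = diag g hgb ∘ ((shiftU ^ k : unitary (L2Z →L[ℂ] L2Z)) : L2Z →L[ℂ] L2Z) := by
      ext x m
      rw [Function.comp_apply, diag_apply, shiftU_zpow_apply]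
      simp only [Δ, evalZero_apply, evalInfty_apply]
      have h1 := evalY_apply X hy f k x m
      refine (congrArg (· - (f (pt0 X) * ((if m ∈ Ioi 0 then (1 : ℂ) else 0) * x m)
        + f OnePoint.infty * ((if m ∈ Iic 0 then (1 : ℂ) else 0) * x m))) h1).trans ?_
      -- For k ≠ 0 both limits f(0), f(∞) vanish and the scalar part disappears; for k = 0 there is
      -- no shift and the scalar part is diagonal. So the same formula diag(g) S^k covers both
      -- cases.
      by_cases hk : k = 0
      · subst hk
        by_cases hm : 0 < m
        · simp [g, hm, not_le.2 hm, sub_mul]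
        · simp [g, hm, not_lt.1 hm, sub_mul]
      · simp [g, hfi, hf0 hk]
    rw [he]
    exact (isCompactOperator_diag hgb hg).comp_clm _
  have hczz : ∀ a ∈ Czz X, IsCompactOperator (Δ a) := by
    have hcl : IsClosed {a | IsCompactOperator (Δ a)} :=
      (isClosed_setOfPred_isCompactOperator (M₁ := L2Z) (M₂ := L2Z) (σ₁₂ := RingHom.id ℂ)).preimage
        hcont
    refine closure_minimal (fun a ha => ?_) hcl
    change a ∈ Submodule.span ℂ (czzGens X) at ha
    change IsCompactOperator (Δ a)
    induction ha using Submodule.span_induction with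
    | mem x hx => exact hgen x hx
    | zero =>
      have : Δ 0 = 0 := by simpa using hsmul 0 0
      rw [this]
      exact isCompactOperator_zero
    | add x z _ _ hx hz => rw [hadd]; exact hx.add hz
    | smul c x _ hx => rw [hsmul]; exact hx.smul c
  rintro ⟨_, b, hb, c, rfl⟩
  have h1 : -Δ (b + c • 1) = -Δ b := by rw [hadd, hsmul, hone, smul_zero, add_zero]
  have h2 : IsCompactOperator (-Δ (b + c • 1)) := by rw [h1]; exact (hczz b hb).neg
  rw [neg_sub] at h2
  exact h2

end PointModule

/-! ### The Bott and Powers--Rieffel projections in the crossed product -/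

section Functions

variable {q : ℝ} (X : QSpace q)

theorem ext_pts {f g : C(Pts X, ℂ)} (h : ∀ x hx, f (pt x hx) = g (pt x hx))
    (hi : f OnePoint.infty = g OnePoint.infty) : f = g := by
  ext x
  induction x using OnePoint.rec with
  | infty => exact hi
  | coe x => exact h x x.2

theorem star_mkFun (g : ℝ → ℝ) (l : ℝ) (hg hl) :
    star (mkFun X g l hg hl) = mkFun X g l hg hl := by
  refine ext_pts X (fun x hx => ?_) ?_
  · rw [ContinuousMap.star_apply, mkFun_pt]; exact Complex.conj_ofReal _
  · rw [ContinuousMap.star_apply, mkFun_infty]; exact Complex.conj_ofReal _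

theorem pow_mul_mem (n : ℕ) {x : ℝ} (hx : x ∈ X.carrier) : q ^ n * x ∈ X.carrier := by
  have := zpow_mul_mem X hx n
  rwa [zpow_natCast] at this

theorem alpha_iterate_pt (f : C(Pts X, ℂ)) (n : ℕ) (x : ℝ) (hx : x ∈ X.carrier) :
    (alpha X)^[n] f (pt x hx) = f (pt (q ^ n * x) (pow_mul_mem X n hx)) := by
  induction n generalizing f x with
  | zero => simp
  | succ n ih =>
    rw [Function.iterate_succ_apply', alpha_pt, ih]
    simp only [pow_succ', mul_assoc, mul_left_comm]

theorem alpha_iterate_infty (f : C(Pts X, ℂ)) (n : ℕ) :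
    (alpha X)^[n] f OnePoint.infty = f OnePoint.infty := by
  induction n with
  | zero => rfl
  | succ n ih => rw [Function.iterate_succ_apply', alpha_infty, ih]

theorem gen_pow_mul_fn (n : ℕ) (f : C(Pts X, ℂ)) :
    ((gen X ^ (n : ℤ) : unitary (Univ X)) : Univ X) * fn X f
      = fn X ((alpha X)^[n] f) * ((gen X ^ (n : ℤ) : unitary (Univ X)) : Univ X) := by
  have step : ∀ f, (gen X : Univ X) * fn X f = fn X (alpha X f) * (gen X : Univ X) := fun f => by
    rw [← gen_cov, mul_assoc, Unitary.star_mul_self_of_mem (gen X).2, mul_one]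
  induction n generalizing f with
  | zero => simp
  | succ n ih =>
    rw [Nat.cast_succ, zpow_add_one, Submonoid.coe_mul, mul_assoc, step, ← mul_assoc, ih,
      mul_assoc, Function.iterate_succ_apply]

theorem star_gen_zpow (k : ℤ) : star ((gen X ^ k : unitary (Univ X)) : Univ X)
    = ((gen X ^ (-k) : unitary (Univ X)) : Univ X) := by
  rw [zpow_neg]; rfl

theorem gen_zpow_mul_neg (k : ℤ) : ((gen X ^ k : unitary (Univ X)) : Univ X)
    * ((gen X ^ (-k) : unitary (Univ X)) : Univ X) = 1 := by
  rw [← star_gen_zpow]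
  exact Unitary.mul_star_self_of_mem (gen X ^ k).2

theorem gen_zpow_neg_mul (k : ℤ) : ((gen X ^ (-k) : unitary (Univ X)) : Univ X)
    * ((gen X ^ k : unitary (Univ X)) : Univ X) = 1 := by
  rw [← star_gen_zpow]
  exact Unitary.star_mul_self_of_mem (gen X ^ k).2

/-- The standard fact that v v* is a projection when v*v = 1; the column v may lie in the larger
crossed product, only p has entries in the unitization. -/
theorem isStarProjection_of_factor {N : ℕ} {p : Matrix (Fin N) (Fin N) (CzzOne X)}
    {v : Fin N → Univ X} (h : ∀ i j, (p i j : Univ X) = v i * star (v j))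
    (hv : ∑ i, star (v i) * v i = 1) : IsStarProjection p where
  isIdempotentElem := by
    refine Matrix.ext fun i j => Subtype.ext ?_
    have h1 : ((∑ k, p i k * p k j : CzzOne X) : Univ X) = p i j := by
      push_cast
      simp only [h]
      have : ∀ k, v i * star (v k) * (v k * star (v j))
          = v i * ((star (v k) * v k) * star (v j)) := fun k => by noncomm_ring
      simp only [this]
      rw [← Finset.mul_sum, ← Finset.sum_mul, hv, one_mul]
    exact (congrArg Subtype.val Matrix.mul_apply).trans h1
  isSelfAdjoint := by
    refine Matrix.ext fun i j => Subtype.ext ?_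
    have h1 : star (p j i : Univ X) = p i j := by rw [h, h, star_mul, star_star]
    exact h1

end Functions

/-! ### Factorization of the Bott projections as v v* -/

section BottFactor

variable {q : ℝ} (X : QSpace q)

/-- The square root of `c t^{2n} / (1 + c t^{2n})` on `X ∪ {∞}`. -/
def sqrtA {c : ℝ} (hc : 0 < c) {n : ℕ} (hn : 1 ≤ n) : C(Pts X, ℂ) :=
  mkFun X (fun t => √(c * t ^ (2 * n) / (1 + c * t ^ (2 * n)))) √1
    (continuousOn_bott (by fun_prop) hc n).sqrt (tendsto_bottA hc hn).sqrt

/-- The square root of `1 / (1 + c t^{2n})` on `X ∪ {∞}`. -/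
def sqrtD {c : ℝ} (hc : 0 < c) {n : ℕ} (hn : 1 ≤ n) : C(Pts X, ℂ) :=
  mkFun X (fun t => √(1 / (1 + c * t ^ (2 * n)))) √0
    (continuousOn_bott (by fun_prop) hc n).sqrt (tendsto_bottD hc hn).sqrt

variable {c d s s' : ℝ} (hc : 0 < c) (hd : 0 < d) {n : ℕ} (hn : 1 ≤ n)

theorem sqrtA_mul_self : sqrtA X hc hn * sqrtA X hc hn = bottA X hc hn := by
  refine ext_pts X (fun x hx => ?_) ?_
  · have hx0 := X.nonneg x hx
    rw [ContinuousMap.mul_apply, sqrtA, bottA, mkFun_pt, mkFun_pt, ← Complex.ofReal_mul,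
      Real.mul_self_sqrt (by positivity)]
  · rw [ContinuousMap.mul_apply, sqrtA, bottA, mkFun_infty, mkFun_infty]; simp

theorem sqrtD_mul_self : sqrtD X hc hn * sqrtD X hc hn = bottD X hc hn := by
  refine ext_pts X (fun x hx => ?_) ?_
  · have hx0 := X.nonneg x hx
    rw [ContinuousMap.mul_apply, sqrtD, bottD, mkFun_pt, mkFun_pt, ← Complex.ofReal_mul,
      Real.mul_self_sqrt (by positivity)]
  · rw [ContinuousMap.mul_apply, sqrtD, bottD, mkFun_infty, mkFun_infty]; simp

theorem sqrtA_mul_sqrtD (hs : 0 ≤ s) (hsc : s ^ 2 = c) :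
    sqrtA X hc hn * sqrtD X hc hn = bottB X s hc hn := by
  refine ext_pts X (fun x hx => ?_) ?_
  · have hx0 := X.nonneg x hx
    have h1 : c * x ^ (2 * n) = (s * x ^ n) ^ 2 := by rw [mul_pow, hsc]; ring
    rw [ContinuousMap.mul_apply, sqrtA, sqrtD, bottB, mkFun_pt, mkFun_pt, mkFun_pt,
      ← Complex.ofReal_mul, h1, Real.sqrt_div (by positivity), Real.sqrt_div zero_le_one,
      Real.sqrt_sq (by positivity), div_mul_div_comm, Real.sqrt_one, mul_one,
      Real.mul_self_sqrt (by positivity)]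
  · rw [ContinuousMap.mul_apply, sqrtA, sqrtD, bottB, mkFun_infty, mkFun_infty, mkFun_infty]
    simp

theorem sqrtA_add_sqrtD :
    sqrtA X hc hn * sqrtA X hc hn + sqrtD X hc hn * sqrtD X hc hn = 1 := by
  rw [sqrtA_mul_self, sqrtD_mul_self]
  refine ext_pts X (fun x hx => ?_) ?_
  · have hx0 := X.nonneg x hx
    have h1 : 1 + c * x ^ (2 * n) ≠ 0 := by positivity
    rw [ContinuousMap.add_apply, bottA, bottD, mkFun_pt, mkFun_pt, ← Complex.ofReal_add,
      ← add_div, add_comm (c * _), div_self h1]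
    simp
  · rw [ContinuousMap.add_apply, bottA, bottD, mkFun_infty, mkFun_infty]; simp

/-- Substituting qⁿt for t multiplies the coefficient of t^{2n} by q^{2n²}; this relation ties the
constants c and d together. -/
theorem alpha_iterate_bottD (hcd : c * (q ^ n) ^ (2 * n) = d) :
    (alpha X)^[n] (bottD X hc hn) = bottD X hd hn := by
  refine ext_pts X (fun x hx => ?_) (alpha_iterate_infty X _ n)
  rw [alpha_iterate_pt, bottD, bottD, mkFun_pt, mkFun_pt]
  simp only [mul_pow (q ^ n) x, ← mul_assoc, hcd]

theorem alpha_iterate_bottB (hcd : c * (q ^ n) ^ (2 * n) = d) (hss : s * (q ^ n) ^ n = s') :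
    (alpha X)^[n] (bottB X s hc hn) = bottB X s' hd hn := by
  refine ext_pts X (fun x hx => ?_) (alpha_iterate_infty X _ n)
  rw [alpha_iterate_pt, bottB, bottB, mkFun_pt, mkFun_pt]
  simp only [mul_pow (q ^ n) x, ← mul_assoc, hcd, hss]

/-- The vector `v` with `P_n = v v*` for the Bott projection `P_n`. -/
def bottPosVec : Fin 2 → Univ X :=
  ![fn X (sqrtA X hc hn),
    ((gen X ^ (n : ℤ) : unitary (Univ X)) : Univ X) * fn X (sqrtD X hc hn)]

/-- The vector `v` with `P_{-n} = v v*` for the Bott projection `P_{-n}`. -/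
def bottNegVec : Fin 2 → Univ X :=
  ![fn X (sqrtA X hd hn),
    ((gen X ^ (-(n : ℤ)) : unitary (Univ X)) : Univ X) * fn X (sqrtD X hd hn)]

theorem star_fn_sqrtA : star (fn X (sqrtA X hc hn)) = fn X (sqrtA X hc hn) := by
  rw [← map_star, sqrtA, star_mkFun]

theorem star_fn_sqrtD : star (fn X (sqrtD X hc hn)) = fn X (sqrtD X hc hn) := by
  rw [← map_star, sqrtD, star_mkFun]

theorem bottPosVec_norm : ∑ i, star (bottPosVec X hc hn i) * bottPosVec X hc hn i = 1 := by
  rw [Fin.sum_univ_two]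
  change star (fn X (sqrtA X hc hn)) * fn X (sqrtA X hc hn)
    + star (((gen X ^ (n : ℤ) : unitary (Univ X)) : Univ X) * fn X (sqrtD X hc hn))
      * (((gen X ^ (n : ℤ) : unitary (Univ X)) : Univ X) * fn X (sqrtD X hc hn)) = 1
  rw [star_mul, star_gen_zpow, star_fn_sqrtA, star_fn_sqrtD, mul_assoc (fn X _),
    ← mul_assoc _ _ (fn X _), gen_zpow_neg_mul, one_mul, ← map_mul, ← map_mul, ← map_add,
    sqrtA_add_sqrtD, map_one]

theorem bottNegVec_norm : ∑ i, star (bottNegVec X hd hn i) * bottNegVec X hd hn i = 1 := by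
  rw [Fin.sum_univ_two]
  change star (fn X (sqrtA X hd hn)) * fn X (sqrtA X hd hn)
    + star (((gen X ^ (-(n : ℤ)) : unitary (Univ X)) : Univ X) * fn X (sqrtD X hd hn))
      * (((gen X ^ (-(n : ℤ)) : unitary (Univ X)) : Univ X) * fn X (sqrtD X hd hn)) = 1
  rw [star_mul, star_gen_zpow, star_fn_sqrtA, star_fn_sqrtD, mul_assoc (fn X _),
    ← mul_assoc _ _ (fn X _), gen_zpow_neg_mul, one_mul, ← map_mul, ← map_mul, ← map_add,
    sqrtA_add_sqrtD, map_one]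

/-- In the second row Uⁿ stands to the left of functions with constant c; moving it to the right
applies αⁿ and turns c into d. -/
theorem bottPosVec_mul_star (hs : 0 ≤ s) (hsc : s ^ 2 = c)
    (hcd : c * (q ^ n) ^ (2 * n) = d) (hss : s * (q ^ n) ^ n = s') (i j : Fin 2) :
    ((!![el X (bottA X hc hn), elB X s hc hn (-n);
      elB X s' hd hn n, el X (bottD X hd hn)] i j : CzzOne X) : Univ X)
      = bottPosVec X hc hn i * star (bottPosVec X hc hn j) := by
  fin_cases i <;> fin_cases j
  · change fn X (bottA X hc hn) = fn X (sqrtA X hc hn) * star (fn X (sqrtA X hc hn))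
    rw [star_fn_sqrtA, ← map_mul, sqrtA_mul_self]
  · change fn X (bottB X s hc hn) * ((gen X ^ (-(n : ℤ)) : unitary (Univ X)) : Univ X)
      = fn X (sqrtA X hc hn)
        * star (((gen X ^ (n : ℤ) : unitary (Univ X)) : Univ X) * fn X (sqrtD X hc hn))
    rw [star_mul, star_fn_sqrtD, star_gen_zpow, ← mul_assoc, ← map_mul,
      sqrtA_mul_sqrtD X hc hn hs hsc]
  · change fn X (bottB X s' hd hn) * ((gen X ^ (n : ℤ) : unitary (Univ X)) : Univ X)
      = ((gen X ^ (n : ℤ) : unitary (Univ X)) : Univ X) * fn X (sqrtD X hc hn)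
        * star (fn X (sqrtA X hc hn))
    rw [star_fn_sqrtA, mul_assoc, ← map_mul, mul_comm (sqrtD X hc hn),
      sqrtA_mul_sqrtD X hc hn hs hsc, gen_pow_mul_fn, alpha_iterate_bottB X hc hd hn hcd hss]
  · change fn X (bottD X hd hn)
      = ((gen X ^ (n : ℤ) : unitary (Univ X)) : Univ X) * fn X (sqrtD X hc hn)
        * star (((gen X ^ (n : ℤ) : unitary (Univ X)) : Univ X) * fn X (sqrtD X hc hn))
    rw [star_mul, star_fn_sqrtD, star_gen_zpow, mul_assoc, ← mul_assoc (fn X _), ← map_mul,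
      sqrtD_mul_self, ← mul_assoc, gen_pow_mul_fn, alpha_iterate_bottD X hc hd hn hcd, mul_assoc,
      gen_zpow_mul_neg, mul_one]

theorem bottNegVec_mul_star (hs : 0 ≤ s') (hsd : s' ^ 2 = d)
    (hcd : c * (q ^ n) ^ (2 * n) = d) (hss : s * (q ^ n) ^ n = s') (i j : Fin 2) :
    ((!![el X (bottA X hd hn), elB X s' hd hn n;
      elB X s hc hn (-n), el X (bottD X hc hn)] i j : CzzOne X) : Univ X)
      = bottNegVec X hd hn i * star (bottNegVec X hd hn j) := by
  -- Commuting U^{-n} past a function would apply the inverse of αⁿ; writing the function as αⁿ(f)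
  -- avoids that inverse, so here d is turned back into c.
  have hmove : ∀ f : C(Pts X, ℂ), ((gen X ^ (-(n : ℤ)) : unitary (Univ X)) : Univ X)
      * fn X ((alpha X)^[n] f) = fn X f * ((gen X ^ (-(n : ℤ)) : unitary (Univ X)) : Univ X) := by
    intro f
    have h := congrArg (fun a => ((gen X ^ (-(n : ℤ)) : unitary (Univ X)) : Univ X) * a
      * ((gen X ^ (-(n : ℤ)) : unitary (Univ X)) : Univ X)) (gen_pow_mul_fn X n f)
    simp only [← mul_assoc] at h
    rw [gen_zpow_neg_mul, one_mul, mul_assoc _ _ ((gen X ^ (-(n : ℤ)) : unitary (Univ X)) : Univ X),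
      gen_zpow_mul_neg, mul_one] at h
    exact h.symm
  fin_cases i <;> fin_cases j
  · change fn X (bottA X hd hn) = fn X (sqrtA X hd hn) * star (fn X (sqrtA X hd hn))
    rw [star_fn_sqrtA, ← map_mul, sqrtA_mul_self]
  · change fn X (bottB X s' hd hn) * ((gen X ^ (n : ℤ) : unitary (Univ X)) : Univ X)
      = fn X (sqrtA X hd hn)
        * star (((gen X ^ (-(n : ℤ)) : unitary (Univ X)) : Univ X) * fn X (sqrtD X hd hn))
    rw [star_mul, star_fn_sqrtD, star_gen_zpow, ← mul_assoc, ← map_mul,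
      sqrtA_mul_sqrtD X hd hn hs hsd, neg_neg]
  · change fn X (bottB X s hc hn) * ((gen X ^ (-(n : ℤ)) : unitary (Univ X)) : Univ X)
      = ((gen X ^ (-(n : ℤ)) : unitary (Univ X)) : Univ X) * fn X (sqrtD X hd hn)
        * star (fn X (sqrtA X hd hn))
    rw [star_fn_sqrtA, mul_assoc, ← map_mul, mul_comm (sqrtD X hd hn),
      sqrtA_mul_sqrtD X hd hn hs hsd, ← alpha_iterate_bottB X hc hd hn hcd hss, hmove]
  · change fn X (bottD X hc hn)
      = ((gen X ^ (-(n : ℤ)) : unitary (Univ X)) : Univ X) * fn X (sqrtD X hd hn)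
        * star (((gen X ^ (-(n : ℤ)) : unitary (Univ X)) : Univ X) * fn X (sqrtD X hd hn))
    rw [star_mul, star_fn_sqrtD, star_gen_zpow, mul_assoc, ← mul_assoc (fn X _), ← map_mul,
      sqrtD_mul_self, ← alpha_iterate_bottD X hc hd hn hcd, ← mul_assoc, hmove, mul_assoc,
      gen_zpow_mul_neg, mul_one]

end BottFactor

/-! ### Arithmetic of the constants c = q^{-n(n-1)}, d = q^{n(n+1)} and their square roots -/

section Constants

variable {q : ℝ}

theorem bott_const_sq (hq : 0 < q) (n : ℕ) :
    (q ^ (-((n : ℝ) / 2 * (n - 1)))) ^ 2 = q ^ (-((n : ℤ) * (n - 1))) := by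
  rw [← Real.rpow_intCast, ← Real.rpow_mul_natCast hq.le]
  congr 1; push_cast; ring

theorem bott_const_sq' (hq : 0 < q) (n : ℕ) :
    (q ^ ((n : ℝ) / 2 * (n + 1))) ^ 2 = q ^ ((n : ℤ) * (n + 1)) := by
  rw [← Real.rpow_intCast, ← Real.rpow_mul_natCast hq.le]
  congr 1; push_cast; ring

theorem bott_const_scale (hq : 0 < q) (n : ℕ) :
    q ^ (-((n : ℤ) * (n - 1))) * (q ^ n) ^ (2 * n) = q ^ ((n : ℤ) * (n + 1)) := by
  rw [← pow_mul, ← zpow_natCast q (n * (2 * n)), ← zpow_add₀ hq.ne']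
  congr 1; push_cast; ring

theorem bott_const_scale' (hq : 0 < q) (n : ℕ) :
    q ^ (-((n : ℝ) / 2 * (n - 1))) * (q ^ n) ^ n = q ^ ((n : ℝ) / 2 * (n + 1)) := by
  rw [← pow_mul, ← Real.rpow_natCast q (n * n), ← Real.rpow_add hq]
  congr 1; push_cast; ring

end Constants

/-! ### The Powers–Rieffel element is a projection -/

section RieffelProjection

/-- Here k and f' play the roles of αⁿ(h) and αⁿ(f). The square is sorted by powers of u: h3 kills
degree ±2, h4 reproduces the terms of degree ±1, and h5 is degree 0. The negative degrees are
adjoints of the positive ones. -/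
theorem isIdempotentElem_rieffel {R : Type*} [Ring R] [StarRing R] {u f h k f' : R}
    (hf : star f = f) (hh : star h = h) (hu : star u * u = 1) (hu' : u * star u = 1)
    (h1 : u * h = k * u) (h2 : u * f = f' * u) (h3 : h * k = 0)
    (h4 : k * f' + f * k = k) (h5 : k * k + f * f + h * h = f) :
    IsIdempotentElem (u * h + f + h * star u) := by
  have e1 : u * h * (u * h) = 0 := by
    rw [mul_assoc, ← mul_assoc h u h, mul_assoc h u h, h1, ← mul_assoc h, h3, zero_mul, mul_zero]
  have e2 : u * h * f + f * (u * h) = u * h := by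
    have h6 : u * (h * f) = k * f' * u := by rw [← mul_assoc, h1, mul_assoc, h2, mul_assoc]
    rw [mul_assoc, h6, h1, ← mul_assoc, ← add_mul, h4]
  have e3 : h * star u * (h * star u) = 0 := by
    have := congrArg star e1
    simpa [star_mul, hh] using this
  have e4 : f * (h * star u) + h * star u * f = h * star u := by
    have := congrArg star e2
    simpa [star_mul, hh, hf] using this
  have e5 : u * h * (h * star u) = k * k := by
    have hk : k = u * h * star u := by rw [h1, mul_assoc, hu', mul_one]
    rw [hk]
    have : u * h * star u * (u * h * star u) = u * h * (star u * u) * (h * star u) := by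
      noncomm_ring
    rw [this, hu, mul_one]
  have e6 : h * star u * (u * h) = h * h := by
    have : h * star u * (u * h) = h * (star u * u) * h := by noncomm_ring
    rw [this, hu, mul_one]
  have e7 : (u * h + f + h * star u) * (u * h + f + h * star u)
      = u * h * (u * h) + (u * h * f + f * (u * h)) + (u * h * (h * star u) + f * f
        + h * star u * (u * h)) + (f * (h * star u) + h * star u * f)
        + h * star u * (h * star u) := by noncomm_ring
  rw [IsIdempotentElem, e7, e1, e2, e3, e4, e5, e6, h5]
  abel

variable {q : ℝ} (X : QSpace q) {φ : ℝ → ℝ} (hφ : IsCutoff q φ)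

/-- The extension of a cutoff function by `0` to the left and by `1` to the right. -/
def cutoffExt (X : QSpace q) (φ : ℝ → ℝ) (t : ℝ) : ℝ := φ (projIcc q 1 X.q_lt_one.le t)

include hφ

theorem cutoffExt_of_le {t : ℝ} (ht : t ≤ q) : cutoffExt X φ t = 0 := by
  rw [cutoffExt, projIcc_of_le_left _ ht]; exact hφ.left

theorem cutoffExt_of_ge {t : ℝ} (ht : 1 ≤ t) : cutoffExt X φ t = 1 := by
  rw [cutoffExt, projIcc_of_right_le _ ht]; exact hφ.right

theorem cutoffExt_nonneg (t : ℝ) : 0 ≤ cutoffExt X φ t := hφ.nonneg _ (projIcc _ _ _ _).2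

theorem cutoffExt_le_one (t : ℝ) : cutoffExt X φ t ≤ 1 := hφ.le_one _ (projIcc _ _ _ _).2

theorem hFun_pt (x : ℝ) (hx : x ∈ X.carrier) :
    hFun X hφ (pt x hx) = (√(cutoffExt X φ x * (1 - cutoffExt X φ x)) : ℝ) := by
  rw [hFun, mkFun_pt, rieffelH_eq X.q_lt_one hφ]; rfl

theorem fFun_pt {n : ℕ} (hn : 1 ≤ n) (x : ℝ) (hx : x ∈ X.carrier) :
    fFun X hφ hn (pt x hx) = (cutoffExt X φ x - cutoffExt X φ (q ^ n * x) : ℝ) := by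
  rw [fFun, mkFun_pt, rieffelF_eq X.q_pos X.q_lt_one hφ hn]; rfl

/-- On `[0, ∞)`, the function `a` or its translate `α^n(a)` is constant, with values `1` or `0`. -/
theorem cutoffExt_dichotomy {n : ℕ} (hn : 1 ≤ n) {x : ℝ} (hx : 0 ≤ x) :
    cutoffExt X φ x = 1 ∨ cutoffExt X φ (q ^ n * x) = 0 := by
  -- The transition interval is [q, 1]: if x < 1, then qⁿx ≤ q because n ≥ 1.
  rcases le_or_gt 1 x with h | h
  · exact Or.inl (cutoffExt_of_ge X hφ h)
  · refine Or.inr (cutoffExt_of_le X hφ ?_)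
    have : q ^ n ≤ q := pow_le_of_le_one X.q_pos.le X.q_lt_one.le (by omega)
    nlinarith [X.q_pos]

theorem coe_rieffelR {n : ℕ} (hn : 1 ≤ n) : ((rieffelR X hφ hn : CzzOne X) : Univ X)
    = ((gen X ^ (n : ℤ) : unitary (Univ X)) : Univ X) * fn X (hFun X hφ) + fn X (fFun X hφ hn)
      + fn X (hFun X hφ) * star ((gen X ^ (n : ℤ) : unitary (Univ X)) : Univ X) := by
  rw [star_gen_zpow]; rfl

theorem isStarProjection_rieffelR {n : ℕ} (hn : 1 ≤ n) :
    IsStarProjection (!![rieffelR X hφ hn] : Matrix (Fin 1) (Fin 1) (CzzOne X)) := by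
  have hf : star (fn X (fFun X hφ hn)) = fn X (fFun X hφ hn) := by
    rw [← map_star, fFun, star_mkFun]
  have hh : star (fn X (hFun X hφ)) = fn X (hFun X hφ) := by rw [← map_star, star_hFun]
  have hidem : IsIdempotentElem ((rieffelR X hφ hn : CzzOne X) : Univ X) := by
    rw [coe_rieffelR]
    refine isIdempotentElem_rieffel hf hh (Unitary.star_mul_self_of_mem (gen X ^ (n : ℤ)).2)
      (Unitary.mul_star_self_of_mem (gen X ^ (n : ℤ)).2) (gen_pow_mul_fn X n _)
      (gen_pow_mul_fn X n _) ?_ ?_ ?_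
    · rw [← map_mul, ← map_zero (fn X)]
      congr 1
      refine ext_pts X (fun x hx => ?_) ?_
      · rw [ContinuousMap.mul_apply, alpha_iterate_pt, hFun_pt, hFun_pt]
        rcases cutoffExt_dichotomy X hφ hn (X.nonneg x hx) with h | h <;> simp [h]
      · rw [ContinuousMap.mul_apply, hFun, mkFun_infty]; simp
    · rw [← map_mul, ← map_mul, ← map_add]
      congr 1
      refine ext_pts X (fun x hx => ?_) ?_
      · rw [ContinuousMap.add_apply, ContinuousMap.mul_apply, ContinuousMap.mul_apply,
          alpha_iterate_pt, alpha_iterate_pt, hFun_pt, fFun_pt, fFun_pt]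
        rcases cutoffExt_dichotomy X hφ hn (X.nonneg _ (pow_mul_mem X n hx)) with h2 | h2
        · simp [h2]
        · rcases cutoffExt_dichotomy X hφ hn (X.nonneg x hx) with h | h
          · simp only [h, h2]; push_cast; ring
          · simp [h]
      · rw [ContinuousMap.add_apply, ContinuousMap.mul_apply, ContinuousMap.mul_apply,
          alpha_iterate_infty, alpha_iterate_infty, hFun, fFun, mkFun_infty]
        simp
    · rw [← map_mul, ← map_mul, ← map_mul, ← map_add, ← map_add]
      congr 1
      refine ext_pts X (fun x hx => ?_) ?_
      · have hs : ∀ t, √(cutoffExt X φ t * (1 - cutoffExt X φ t))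
            * √(cutoffExt X φ t * (1 - cutoffExt X φ t))
            = cutoffExt X φ t * (1 - cutoffExt X φ t) := fun t => Real.mul_self_sqrt
          (mul_nonneg (cutoffExt_nonneg X hφ t) (sub_nonneg.2 (cutoffExt_le_one X hφ t)))
        rw [ContinuousMap.add_apply, ContinuousMap.add_apply, ContinuousMap.mul_apply,
          ContinuousMap.mul_apply, ContinuousMap.mul_apply, alpha_iterate_pt, hFun_pt, hFun_pt,
          fFun_pt, ← Complex.ofReal_mul, ← Complex.ofReal_mul, ← Complex.ofReal_mul, hs, hs,
          ← Complex.ofReal_add, ← Complex.ofReal_add]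
        congr 1
        -- With a = φ(x) and a' = φ(qⁿx), φ extended by constants, the left side is a + a' - 2aa'.
        -- It equals a - a' because a = 1 or a' = 0.
        rcases cutoffExt_dichotomy X hφ hn (X.nonneg x hx) with h | h <;> rw [h] <;> ring
      · rw [ContinuousMap.add_apply, ContinuousMap.add_apply, ContinuousMap.mul_apply,
          ContinuousMap.mul_apply, ContinuousMap.mul_apply, alpha_iterate_infty, hFun, fFun,
          mkFun_infty, mkFun_infty]
        simp
  have hself : star ((rieffelR X hφ hn : CzzOne X) : Univ X) = (rieffelR X hφ hn : CzzOne X) := by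
    rw [coe_rieffelR, star_add, star_add, star_mul, star_mul, star_star, hf, hh]
    abel
  constructor
  · refine Matrix.ext fun i j => Subtype.ext ?_
    fin_cases i; fin_cases j
    rw [Matrix.mul_apply, Fin.sum_univ_one]
    exact hidem
  · refine Matrix.ext fun i j => Subtype.ext ?_
    fin_cases i; fin_cases j
    exact hself

end RieffelProjection

/-! ### Index computations -/

section CutShift

/-- The powers of the bilateral shift, `(S^k x)(m) = x(m+k)`. -/
def shiftPow (k : ℤ) : L2Z →L[ℂ] L2Z := ((shiftU ^ k : unitary (L2Z →L[ℂ] L2Z)) : L2Z →L[ℂ] L2Z)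

theorem shiftPow_apply (k : ℤ) (x : L2Z) (m : ℤ) : shiftPow k x m = x (m + k) :=
  shiftU_zpow_apply k x m

theorem bound_ite {p : ℤ → Prop} [DecidablePred p] {u : ℤ → ℂ} {C : ℝ} (hu : ∀ n, ‖u n‖ ≤ C) :
    ∃ C : ℝ, ∀ n, ‖(if p n then u n else 0)‖ ≤ C :=
  ⟨C, fun n => by
    split_ifs
    · exact hu n
    · rw [norm_zero]; exact (norm_nonneg _).trans (hu n)⟩

variable (n : ℕ) {u : ℤ → ℂ} {C : ℝ}

/-- The weighted shift by `n` of the positive half of `ℓ²(ℤ)`: it maps `x` to `m ↦ u(m) x(m)` for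
`m ≤ 0` and `m ↦ u(m) x(m+n)` for `m > 0`. -/
def cutShift (hu : ∀ n, ‖u n‖ ≤ C) : L2Z →L[ℂ] L2Z :=
  diag (fun m => if m ≤ 0 then u m else 0) (bound_ite hu)
    + diag (fun m => if 0 < m then u m else 0) (bound_ite hu) ∘L shiftPow n

theorem cutShift_apply (hu : ∀ n, ‖u n‖ ≤ C) (x : L2Z) (m : ℤ) :
    cutShift n hu x m = u m * (if 0 < m then x (m + n) else x m) := by
  change (if m ≤ 0 then u m else 0) * x m + (if 0 < m then u m else 0) * shiftPow n x m = _
  rw [shiftPow_apply]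
  by_cases h : 0 < m
  · simp [h, not_le.2 h]
  · simp [h, not_lt.1 h]

/-- The kernel of the weighted shift consists of the sequences supported in `{1, …, n}`. -/
theorem exists_ker_cutShift_equiv (hu : ∀ n, ‖u n‖ ≤ C) (h0 : ∀ m, u m ≠ 0) :
    Nonempty (LinearMap.ker (cutShift n hu).toLinearMap ≃ₗ[ℂ] (Fin n → ℂ)) := by
  let A : LinearMap.ker (cutShift n hu).toLinearMap →ₗ[ℂ] (Fin n → ℂ) :=
    { toFun := fun x i => (x : L2Z) ((i : ℤ) + 1)
      map_add' := fun x y => rfl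
      map_smul' := fun c x => rfl }
  refine ⟨LinearEquiv.ofBijective A ⟨?_, fun c => ?_⟩⟩
  · rw [← LinearMap.ker_eq_bot, LinearMap.ker_eq_bot']
    rintro ⟨x, hx⟩ hA
    have hx' : ∀ m, (if 0 < m then x (m + n) else x m) = 0 := fun m => by
      have h1 : cutShift n hu x = 0 := hx
      have h2 : cutShift n hu x m = 0 := by rw [h1]; rfl
      rw [cutShift_apply] at h2
      exact (mul_eq_zero.1 h2).resolve_left (h0 m)
    ext m
    change x m = 0
    rcases le_or_gt m 0 with h | h
    · simpa [not_lt.2 h] using hx' m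
    · rcases lt_or_ge (n : ℤ) m with h1 | h1
      · have := hx' (m - n)
        rwa [if_pos (by omega), sub_add_cancel] at this
      · have h2 : A ⟨x, hx⟩ ⟨(m - 1).toNat, by omega⟩ = 0 := by rw [hA]; rfl
        change x (((m - 1).toNat : ℤ) + 1) = 0 at h2
        rwa [Int.toNat_of_nonneg (by omega), sub_add_cancel] at h2
  -- Extension by zero from {1, …, n}: the operator reads only coordinates m ≤ 0 and m > n, so this
  -- vector is killed.
  · let f : ℤ → ℂ := fun m => if h : 1 ≤ m ∧ m ≤ n then c ⟨(m - 1).toNat, by omega⟩ else 0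
    have hf : ∀ m, m ∉ Icc (1 : ℤ) n → f m = 0 := fun m hm => dif_neg hm
    let x : L2Z := ⟨f, memlp_of_finite (finite_Icc _ _) hf⟩
    refine ⟨⟨x, ?_⟩, ?_⟩
    · change cutShift n hu x = 0
      ext m
      rw [cutShift_apply]
      change u m * (if 0 < m then f (m + n) else f m) = 0
      split_ifs with h
      · rw [hf _ (fun h' => by have := h'.2; omega), mul_zero]
      · rw [hf _ (fun h' => by have := h'.1; omega), mul_zero]
    · ext i
      change f ((i : ℤ) + 1) = c i
      have h : 1 ≤ (i : ℤ) + 1 ∧ (i : ℤ) + 1 ≤ n := ⟨by omega, by have := i.2; omega⟩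
      simp only [f, dif_pos h]
      congr 1
      ext
      simp

/-- A right inverse of the weighted shift with weights bounded below. -/
theorem exists_rightInverse_cutShift (hu : ∀ n, ‖u n‖ ≤ C) {C' : ℝ}
    (hu' : ∀ n, ‖(u n)⁻¹‖ ≤ C') (h0 : ∀ m, u m ≠ 0) :
    ∃ S : L2Z →L[ℂ] L2Z, ∀ x, cutShift n hu (S x) = x := by
  -- The positive half is shifted back by n and the coordinates 1, …, n are filled with zeros; each
  -- weight is inverted at the index where it acts.
  refine ⟨diag (fun m => if m ≤ 0 then (u m)⁻¹ else 0) (bound_ite hu')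
    + diag (fun m => if (n : ℤ) < m then (u (m - n))⁻¹ else 0)
      (bound_ite (u := fun m => (u (m - n))⁻¹) (fun m => hu' (m - n))) ∘L shiftPow (-n),
      fun x => ?_⟩
  ext m
  rw [cutShift_apply]
  have hS : ∀ k, (diag (fun m => if m ≤ 0 then (u m)⁻¹ else 0) (bound_ite hu')
    + diag (fun m => if (n : ℤ) < m then (u (m - n))⁻¹ else 0)
      (bound_ite (u := fun m => (u (m - n))⁻¹) (fun m => hu' (m - n))) ∘L shiftPow (-n)) x k
      = (if k ≤ 0 then (u k)⁻¹ else 0) * x k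
        + (if (n : ℤ) < k then (u (k - n))⁻¹ else 0) * x (k + -n) := fun k => by
    rw [← shiftPow_apply]; rfl
  rw [hS, hS]
  by_cases h : 0 < m
  · rw [if_pos h, if_neg (by omega), if_pos (by omega), add_sub_cancel_right, zero_mul, zero_add,
      mul_inv_cancel_left₀ (h0 m), add_neg_cancel_right]
  · rw [if_neg h, if_pos (by omega), if_neg (by omega), zero_mul, add_zero,
      mul_inv_cancel_left₀ (h0 m)]

end CutShift

/-! ### Pairing of the Bott projections with the point module -/

section BottIndex

variable {q : ℝ} (X : QSpace q) {y : ℝ} (hy : y ∈ X.carrier)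

theorem piY_apply_factor {N : ℕ} {p : Matrix (Fin N) (Fin N) (CzzOne X)} {v : Fin N → Univ X}
    (h : ∀ i j, (p i j : Univ X) = v i * star (v j)) (i j : Fin N) :
    piY X hy (p i j) = evalY X hy (v i) ∘L evalY X hy (star (v j)) := by
  change evalY X hy (p i j : Univ X) = evalY X hy (v i) * evalY X hy (star (v j))
  rw [h, map_mul]

theorem sum_evalY_star_mul {N : ℕ} {v : Fin N → Univ X} (h : ∑ i, star (v i) * v i = 1)
    (x : L2Z) : ∑ i, evalY X hy (star (v i)) (evalY X hy (v i) x) = x := by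
  have h1 := congrArg (fun a => evalY X hy a x) h
  simpa [map_sum] using h1

theorem piZeroInfty_apply (a : CzzOne X) : piZeroInfty X a
    = evalZero X (a : Univ X) • PiPlus + evalInfty X (a : Univ X) • PiMinus := rfl

theorem PiPlus_apply (x : L2Z) (m : ℤ) : PiPlus x m = if 0 < m then x m else 0 := by
  change (if m ∈ Ioi 0 then (1 : ℂ) else 0) * x m = _
  simp

theorem PiMinus_apply (x : L2Z) (m : ℤ) : PiMinus x m = if 0 < m then 0 else x m := by
  change (if m ∈ Iic 0 then (1 : ℂ) else 0) * x m = _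
  by_cases h : 0 < m <;> simp [h, not_le.2, not_lt.1]

/-- The projections `Π_-, Π_+` as the components of an isometry `ℓ² → ℓ² ⊕ ℓ²`. -/
def piVec : Fin 2 → L2Z →L[ℂ] L2Z := ![PiMinus, PiPlus]

theorem sum_piVec (x : L2Z) : ∑ i, piVec i (piVec i x) = x := by
  rw [Fin.sum_univ_two]
  change PiMinus (PiMinus x) + PiPlus (PiPlus x) = x
  ext m
  rw [lp.coeFn_add, Pi.add_apply, PiMinus_apply, PiPlus_apply, PiMinus_apply, PiPlus_apply]
  split_ifs <;> simp

theorem evalZero_fn (f : C(Pts X, ℂ)) : evalZero X (fn X f) = f (pt0 X) := rfl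

theorem evalInfty_fn (f : C(Pts X, ℂ)) : evalInfty X (fn X f) = f OnePoint.infty := rfl

variable {c d : ℝ} (hc : 0 < c) (hd : 0 < d) {n : ℕ} (hn : 1 ≤ n) {s s' : ℝ}

/-- A Bott type matrix over the unitization. -/
def bottMatrix (s s' : ℝ) (k l : ℤ) : Matrix (Fin 2) (Fin 2) (CzzOne X) :=
  !![el X (bottA X hc hn), elB X s hc hn k; elB X s' hd hn l, el X (bottD X hd hn)]

theorem evalInfty_bottMatrix (k l : ℤ) (i j : Fin 2) :
    evalInfty X (bottMatrix X hc hd hn s s' k l i j : CzzOne X)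
      = if i = 0 ∧ j = 0 then 1 else 0 := by
  fin_cases i <;> fin_cases j
  · change evalInfty X (fn X (bottA X hc hn)) = _
    rw [evalInfty_fn, bottA, mkFun_infty]; simp
  · change evalInfty X (fn X (bottB X s hc hn) * _) = _
    rw [evalInfty_apply, bottB, mkFun_infty]; simp
  · change evalInfty X (fn X (bottB X s' hd hn) * _) = _
    rw [evalInfty_apply, bottB, mkFun_infty]; simp
  · change evalInfty X (fn X (bottD X hd hn)) = _
    rw [evalInfty_fn, bottD, mkFun_infty]; simp

theorem evalZero_bottMatrix (k l : ℤ) (i j : Fin 2) :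
    evalZero X (bottMatrix X hc hd hn s s' k l i j : CzzOne X)
      = if i = 1 ∧ j = 1 then 1 else 0 := by
  fin_cases i <;> fin_cases j
  · change evalZero X (fn X (bottA X hc hn)) = _
    rw [evalZero_fn, bottA, mkFun_pt]; simp [show n ≠ 0 by omega]
  · change evalZero X (fn X (bottB X s hc hn) * _) = _
    rw [evalZero_apply, bottB_zero]; simp
  · change evalZero X (fn X (bottB X s' hd hn) * _) = _
    rw [evalZero_apply, bottB_zero]; simp
  · change evalZero X (fn X (bottD X hd hn)) = _
    rw [evalZero_fn, bottD, mkFun_pt]; simp [show n ≠ 0 by omega]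

/-- The values diag(1,0) at ∞ and diag(0,1) at 0 turn the matrix into diag(Π_-, Π_+), and the
off-diagonal products vanish because Π_- and Π_+ are orthogonal. -/
theorem piZeroInfty_bottMatrix (k l : ℤ) (i j : Fin 2) :
    piZeroInfty X (bottMatrix X hc hd hn s s' k l i j) = piVec i ∘L piVec j := by
  rw [piZeroInfty_apply, evalInfty_bottMatrix, evalZero_bottMatrix]
  ext x m
  fin_cases i <;> fin_cases j
  · change (((if (0 : Fin 2) = 1 ∧ (0 : Fin 2) = 1 then (1 : ℂ) else 0) * PiPlus x m
      + (if (0 : Fin 2) = 0 ∧ (0 : Fin 2) = 0 then (1 : ℂ) else 0) * PiMinus x m))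
      = PiMinus (PiMinus x) m
    rw [PiMinus_apply (PiMinus x), PiMinus_apply]
    split_ifs <;> simp_all
  · change (((if (0 : Fin 2) = 1 ∧ (1 : Fin 2) = 1 then (1 : ℂ) else 0) * PiPlus x m
      + (if (0 : Fin 2) = 0 ∧ (1 : Fin 2) = 0 then (1 : ℂ) else 0) * PiMinus x m))
      = PiMinus (PiPlus x) m
    rw [PiMinus_apply (PiPlus x), PiPlus_apply]
    split_ifs <;> simp_all
  · change (((if (1 : Fin 2) = 1 ∧ (0 : Fin 2) = 1 then (1 : ℂ) else 0) * PiPlus x m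
      + (if (1 : Fin 2) = 0 ∧ (0 : Fin 2) = 0 then (1 : ℂ) else 0) * PiMinus x m))
      = PiPlus (PiMinus x) m
    rw [PiPlus_apply (PiMinus x), PiMinus_apply]
    split_ifs <;> simp_all
  · change (((if (1 : Fin 2) = 1 ∧ (1 : Fin 2) = 1 then (1 : ℂ) else 0) * PiPlus x m
      + (if (1 : Fin 2) = 0 ∧ (1 : Fin 2) = 0 then (1 : ℂ) else 0) * PiMinus x m))
      = PiPlus (PiPlus x) m
    rw [PiPlus_apply (PiPlus x), PiPlus_apply]
    split_ifs <;> simp_all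

/-- The values of the square root of `c t^{2n} / (1 + c t^{2n})` along the orbit of `y`. -/
def orbA (q c : ℝ) (n : ℕ) (y : ℝ) (m : ℤ) : ℝ :=
  √(c * (q ^ m * y) ^ (2 * n) / (1 + c * (q ^ m * y) ^ (2 * n)))

/-- The values of the square root of `1 / (1 + c t^{2n})` along the orbit of `y`. -/
def orbD (q c : ℝ) (n : ℕ) (y : ℝ) (m : ℤ) : ℝ := √(1 / (1 + c * (q ^ m * y) ^ (2 * n)))

-- Along the orbit, c t^{2n}/(1 + c t^{2n}) decreases in m and 1/(1 + c t^{2n}) increases, so on the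
-- half-line where each is used its minimum is at m = 0. This is what makes the weights invertible.
include hc in
theorem orb_bounds (X : QSpace q) (hy0 : 0 < y) : ∃ δ : ℝ, 0 < δ ∧
    (∀ m, orbA q c n y m ≤ 1) ∧ (∀ m, orbD q c n y m ≤ 1) ∧
    (∀ m ≤ 0, δ ≤ orbA q c n y m) ∧ (∀ m ≥ 0, δ ≤ orbD q c n y m) := by
  have hq := X.q_pos
  have hg : ∀ m : ℤ, 0 < c * (q ^ m * y) ^ (2 * n) := fun m => by positivity
  have hg0 : 0 < c * y ^ (2 * n) := by positivity
  have hA1 : ∀ g : ℝ, 0 < g → g / (1 + g) ≤ 1 := fun g h => by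
    rw [div_le_one (by positivity)]; linarith
  have hD1 : ∀ g : ℝ, 0 < g → 1 / (1 + g) ≤ 1 := fun g h => by
    rw [div_le_one (by positivity)]; linarith
  set g := c * y ^ (2 * n) with hgdef
  refine ⟨min (√(g / (1 + g))) (√(1 / (1 + g))), by positivity, fun m => ?_, fun m => ?_,
    fun m hm => (min_le_left _ _).trans (Real.sqrt_le_sqrt ?_),
    fun m hm => (min_le_right _ _).trans (Real.sqrt_le_sqrt ?_)⟩
  · exact Real.sqrt_le_one.2 (hA1 _ (hg m))
  · exact Real.sqrt_le_one.2 (hD1 _ (hg m))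
  · have h1 : (1 : ℝ) ≤ q ^ m := one_le_zpow_of_nonpos₀ hq X.q_lt_one.le hm
    have h2 : g ≤ c * (q ^ m * y) ^ (2 * n) := by
      rw [hgdef]
      gcongr
      nlinarith
    rw [div_le_div_iff₀ (by positivity) (by have := hg m; positivity)]
    nlinarith
  · have h1 : q ^ m ≤ 1 := zpow_le_one₀ hq X.q_lt_one.le hm
    have h2 : c * (q ^ m * y) ^ (2 * n) ≤ g := by
      rw [hgdef]
      gcongr
      nlinarith
    have := hg m
    gcongr

theorem evalY_gen_mul_sqrtD (k : ℤ) (x : L2Z) (m : ℤ) :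
    evalY X hy (((gen X ^ k : unitary (Univ X)) : Univ X) * fn X (sqrtD X hc hn)) x m
      = (orbD q c n y (m + k) : ℂ) * x (m + k) := by
  rw [map_mul, mul_apply_eq_comp, evalY_gen_zpow_apply]
  rfl

theorem norm_orb_le {a : ℝ} (ha0 : 0 ≤ a) (ha : a ≤ 1) : ‖(a : ℂ)‖ ≤ 1 := by
  rw [Complex.norm_real, Real.norm_of_nonneg ha0]; exact ha

theorem norm_inv_orb_le {a δ : ℝ} (hδ : 0 < δ) (ha : δ ≤ a) : ‖(a : ℂ)⁻¹‖ ≤ δ⁻¹ := by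
  rw [norm_inv, Complex.norm_real, Real.norm_of_nonneg (hδ.le.trans ha)]
  exact inv_anti₀ hδ ha

theorem hasIndexPairing_bottPos (hy0 : 0 < y) (hs : 0 ≤ s) (hsc : s ^ 2 = c)
    (hcd : c * (q ^ n) ^ (2 * n) = d) (hss : s * (q ^ n) ^ n = s') :
    HasIndexPairing (piY X hy) (piZeroInfty X) (bottMatrix X hc hd hn s s' (-n) n) n := by
  have hfac := bottPosVec_mul_star X hc hd hn hs hsc hcd hss
  have hnorm := bottPosVec_norm X hc hn
  obtain ⟨δ, hδ, hA1, hD1, hA, hD⟩ := orb_bounds (q := q) (y := y) hc (n := n) X hy0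
  -- The lower component of v is Uⁿ√D, so its weight is read at the shifted index m + n, still in
  -- the range where `orbD` is bounded below.
  let u : ℤ → ℂ := fun m => if 0 < m then (orbD q c n y (m + n) : ℂ) else (orbA q c n y m : ℂ)
  have hu : ∀ m, ‖u m‖ ≤ 1 := fun m => by
    simp only [u]
    split_ifs
    · exact norm_orb_le (Real.sqrt_nonneg _) (hD1 _)
    · exact norm_orb_le (Real.sqrt_nonneg _) (hA1 _)
  have hu' : ∀ m, ‖(u m)⁻¹‖ ≤ δ⁻¹ := fun m => by
    simp only [u]
    split_ifs with h
    · exact norm_inv_orb_le hδ (hD _ (by omega))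
    · exact norm_inv_orb_le hδ (hA _ (by omega))
  have h0 : ∀ m, u m ≠ 0 := fun m => by
    simp only [u]
    split_ifs with h
    · exact_mod_cast (hδ.trans_le (hD _ (by omega))).ne'
    · exact_mod_cast (hδ.trans_le (hA _ (by omega))).ne'
  obtain ⟨S, hS⟩ := exists_rightInverse_cutShift n hu hu' h0
  obtain ⟨e⟩ := exists_ker_cutShift_equiv n hu h0
  have hDD : ∀ x, ∑ i, piVec i (evalY X hy (bottPosVec X hc hn i) x) = cutShift n hu x := by
    intro x
    rw [Fin.sum_univ_two]
    ext m
    rw [cutShift_apply, lp.coeFn_add, Pi.add_apply]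
    refine (congrArg₂ (· + ·) (PiMinus_apply _ m) (PiPlus_apply _ m)).trans ?_
    have h1 : evalY X hy (bottPosVec X hc hn 0) x m = (orbA q c n y m : ℂ) * x m := rfl
    have h2 : evalY X hy (bottPosVec X hc hn 1) x m = (orbD q c n y (m + n) : ℂ) * x (m + n) :=
      evalY_gen_mul_sqrtD X hy hc hn n x m
    simp only [h1, h2, u]
    split_ifs <;> simp
  obtain ⟨h1, h2⟩ := pairing_of_rightInverse (piY_apply_factor X hy hfac)
    (sum_evalY_star_mul X hy hnorm) (piZeroInfty_bottMatrix X hc hd hn (-n) n) sum_piVec hDD hS e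
  exact ⟨isEvenFredholmModule_piY X hy hy0, isStarProjection_of_factor X hfac hnorm, h1, h2⟩

theorem hasIndexPairing_bottNeg (hy0 : 0 < y) (hs : 0 ≤ s') (hsd : s' ^ 2 = d)
    (hcd : c * (q ^ n) ^ (2 * n) = d) (hss : s * (q ^ n) ^ n = s') :
    HasIndexPairing (piY X hy) (piZeroInfty X) (bottMatrix X hd hc hn s' s n (-n)) (-n) := by
  have hfac := bottNegVec_mul_star X hc hd hn hs hsd hcd hss
  have hnorm := bottNegVec_norm X hd hn
  obtain ⟨δ, hδ, hA1, hD1, hA, hD⟩ := orb_bounds (q := q) (y := y) hd (n := n) X hy0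
  -- For P_{-n} the operator D moves the positive half to the right, so a `cutShift` is a left
  -- inverse. Its weights are the reciprocals, at index m rather than m - n since it shifts before
  -- multiplying.
  let u : ℤ → ℂ := fun m => if 0 < m then (orbD q d n y m : ℂ)⁻¹ else (orbA q d n y m : ℂ)⁻¹
  have hA0 : ∀ m ≤ 0, (orbA q d n y m : ℂ) ≠ 0 := fun m hm => by
    exact_mod_cast (hδ.trans_le (hA _ hm)).ne'
  have hD0 : ∀ m ≥ 0, (orbD q d n y m : ℂ) ≠ 0 := fun m hm => by
    exact_mod_cast (hδ.trans_le (hD _ hm)).ne'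
  have hu : ∀ m, ‖u m‖ ≤ δ⁻¹ := fun m => by
    simp only [u]
    split_ifs with h
    · exact norm_inv_orb_le hδ (hD _ (by omega))
    · exact norm_inv_orb_le hδ (hA _ (by omega))
  have h0 : ∀ m, u m ≠ 0 := fun m => by
    simp only [u]
    split_ifs with h
    · exact inv_ne_zero (hD0 _ (by omega))
    · exact inv_ne_zero (hA0 _ (by omega))
  obtain ⟨e⟩ := exists_ker_cutShift_equiv n hu h0
  let D : L2Z →L[ℂ] L2Z := ∑ i, piVec i ∘L evalY X hy (bottNegVec X hd hn i)
  have hDD : ∀ x, ∑ i, piVec i (evalY X hy (bottNegVec X hd hn i) x) = D x := fun x => by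
    simp [D]
  have hDm : ∀ x m, D x m = if 0 < m then (orbD q d n y (m + -n) : ℂ) * x (m + -n)
      else (orbA q d n y m : ℂ) * x m := by
    intro x m
    rw [← hDD, Fin.sum_univ_two, lp.coeFn_add, Pi.add_apply]
    refine (congrArg₂ (· + ·) (PiMinus_apply _ m) (PiPlus_apply _ m)).trans ?_
    have h1 : evalY X hy (bottNegVec X hd hn 0) x m = (orbA q d n y m : ℂ) * x m := rfl
    have h2 : evalY X hy (bottNegVec X hd hn 1) x m
        = (orbD q d n y (m + -n) : ℂ) * x (m + -n) :=
      evalY_gen_mul_sqrtD X hy hd hn (-n) x m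
    rw [h1, h2]
    split_ifs <;> simp
  have hS : ∀ x, cutShift n hu (D x) = x := by
    intro x
    ext m
    rw [cutShift_apply, hDm, hDm]
    simp only [u]
    by_cases h : 0 < m
    · rw [if_pos h, if_pos h, if_pos (by omega), add_neg_cancel_right,
        inv_mul_cancel_left₀ (hD0 m h.le)]
    · rw [if_neg h, if_neg h, if_neg h, inv_mul_cancel_left₀ (hA0 m (by omega))]
  obtain ⟨h1, h2⟩ := pairing_of_leftInverse (piY_apply_factor X hy hfac)
    (sum_evalY_star_mul X hy hnorm) (piZeroInfty_bottMatrix X hd hc hn n (-n)) sum_piVec hDD hS e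
  exact ⟨isEvenFredholmModule_piY X hy hy0, isStarProjection_of_factor X hfac hnorm, h1, h2⟩

end BottIndex

/-! ### The index pairings and the theorem -/

section FiniteRank

variable {A : Type*} [Ring A] [StarRing A] [Algebra ℂ A]
  {H : Type*} [NormedAddCommGroup H] [InnerProductSpace ℂ H] [CompleteSpace H]

/-- If `π_+(p) = 0` and `π_-(p)` is a projection of rank `n`, then the index is `n`. -/
theorem pairing_of_eq_zero {N n : ℕ} {πm πp : A →⋆ₙₐ[ℂ] (H →L[ℂ] H)}
    {p : Matrix (Fin N) (Fin N) A} {v : Fin N → (Fin n → ℂ) →L[ℂ] H}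
    {v' : Fin N → H →L[ℂ] (Fin n → ℂ)} (hm : ∀ i j, πm (p i j) = v i ∘L v' j)
    (hv : ∀ x, ∑ i, v' i (v i x) = x) (hp : ∀ i j, πp (p i j) = 0) :
    (pairingOp πm πp p).IsFredholm ∧ fredholmIndex (pairingOp πm πp p) = n := by
  have hker : LinearMap.ker (0 : (Fin n → ℂ) →L[ℂ] (Fin 0 → ℂ)).toLinearMap = ⊤ :=
    LinearMap.ker_zero
  exact pairing_of_rightInverse hm hv (w := fun _ => (0 : (Fin 0 → ℂ) →L[ℂ] H)) (w' := fun _ => 0)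
    (fun i j => by rw [hp]; rfl) (fun x => Subsingleton.elim _ _)
    (D := 0) (fun x => Subsingleton.elim _ _) (S := 0) (fun x => Subsingleton.elim _ _)
    ((LinearEquiv.ofEq _ _ hker).trans Submodule.topEquiv)

end FiniteRank

/-! ### Pairings with the character at infinity -/

section EvInfty

variable {q : ℝ} (X : QSpace q)

theorem isEvenFredholmModule_evInfty : IsEvenFredholmModule (evInftyRep X) 0 := fun a =>
  isCompactOperator_of_locallyCompactSpace_dom
    ((0 : CzzOne X →⋆ₙₐ[ℂ] (ℂ →L[ℂ] ℂ)) a - evInftyRep X a)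

theorem evInftyRep_apply (a : CzzOne X) :
    evInftyRep X a = evalInfty X (a : Univ X) • (1 : ℂ →L[ℂ] ℂ) := rfl

/-- The inclusion `ℂ^1 → ℂ`. -/
def fromFinOne : (Fin 1 → ℂ) →L[ℂ] ℂ := ContinuousLinearMap.proj 0

/-- The map `ℂ → ℂ^1`. -/
def toFinOne : ℂ →L[ℂ] (Fin 1 → ℂ) := ContinuousLinearMap.pi fun _ => ContinuousLinearMap.id ℂ ℂ

theorem fromFinOne_toFinOne : fromFinOne ∘L toFinOne = 1 := rfl

theorem toFinOne_fromFinOne (x : Fin 1 → ℂ) : toFinOne (fromFinOne x) = x := by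
  ext i
  rw [Subsingleton.elim i 0]
  rfl

/-- The scalar matrix ev_∞(P) is diag(1,0), of rank one. -/
theorem hasIndexPairing_evInfty_bott {c d s s' : ℝ} (hc : 0 < c) (hd : 0 < d) {n : ℕ} (hn : 1 ≤ n)
    {k l : ℤ} (hp : IsStarProjection (bottMatrix X hc hd hn s s' k l)) :
    HasIndexPairing (evInftyRep X) 0 (bottMatrix X hc hd hn s s' k l) 1 := by
  have h := pairing_of_eq_zero (πm := evInftyRep X) (πp := 0)
    (p := bottMatrix X hc hd hn s s' k l)
    (v := fun i => if i = 0 then fromFinOne else 0) (v' := fun i => if i = 0 then toFinOne else 0)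
    (fun i j => by
      rw [evInftyRep_apply, evalInfty_bottMatrix]
      by_cases hi : i = 0 <;> by_cases hj : j = 0 <;> simp [hi, hj, fromFinOne_toFinOne])
    (fun x => by
      rw [Fin.sum_univ_two]
      simpa using toFinOne_fromFinOne x)
    (fun _ _ => rfl)
  exact ⟨isEvenFredholmModule_evInfty X, hp, h.1, h.2⟩

theorem hasIndexPairing_evInfty_one :
    HasIndexPairing (evInftyRep X) 0 (1 : Matrix (Fin 1) (Fin 1) (CzzOne X)) 1 := by
  have h := pairing_of_eq_zero (πm := evInftyRep X) (πp := 0)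
    (p := (1 : Matrix (Fin 1) (Fin 1) (CzzOne X)))
    (v := fun _ => fromFinOne) (v' := fun _ => toFinOne)
    (fun i j => by
      rw [Subsingleton.elim i 0, Subsingleton.elim j 0, Matrix.one_apply_eq, evInftyRep_apply,
        fromFinOne_toFinOne]
      change evalInfty X 1 • _ = _
      rw [map_one, one_smul])
    (fun x => by
      rw [Fin.sum_univ_one]
      exact toFinOne_fromFinOne x)
    (fun _ _ => rfl)
  exact ⟨isEvenFredholmModule_evInfty X, .one _, h.1, h.2⟩

variable {φ : ℝ → ℝ} (hφ : IsCutoff q φ) {n : ℕ} (hn : 1 ≤ n)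

theorem map_rieffelR_eq_zero (ψ : Univ X →⋆ₐ[ℂ] ℂ) (hf : ψ (fn X (fFun X hφ hn)) = 0)
    (hh : ψ (fn X (hFun X hφ)) = 0) : ψ (rieffelR X hφ hn : CzzOne X) = 0 := by
  rw [coe_rieffelR, map_add, map_add, map_mul, map_mul, hf, hh]
  simp

theorem evalInfty_rieffelR : evalInfty X (rieffelR X hφ hn : CzzOne X) = 0 := by
  refine map_rieffelR_eq_zero X hφ hn _ ?_ ?_
  · rw [evalInfty_fn, fFun, mkFun_infty, Complex.ofReal_zero]
  · rw [evalInfty_fn, hFun, mkFun_infty, Complex.ofReal_zero]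

theorem evalZero_rieffelR : evalZero X (rieffelR X hφ hn : CzzOne X) = 0 := by
  refine map_rieffelR_eq_zero X hφ hn _ ?_ ?_
  · rw [evalZero_fn, fFun_pt, mul_zero, sub_self, Complex.ofReal_zero]
  · rw [evalZero_fn, hFun_zero]

theorem hasIndexPairing_evInfty_rieffelR :
    HasIndexPairing (evInftyRep X) 0 !![rieffelR X hφ hn] 0 := by
  have h := pairing_of_eq_zero (πm := evInftyRep X) (πp := 0) (p := !![rieffelR X hφ hn])
    (v := fun _ => (0 : (Fin 0 → ℂ) →L[ℂ] ℂ)) (v' := fun _ => 0)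
    (fun i j => by
      rw [Subsingleton.elim i 0, Subsingleton.elim j 0]
      change evInftyRep X (rieffelR X hφ hn) = _
      rw [evInftyRep_apply, evalInfty_rieffelR]
      exact zero_smul ℂ (1 : ℂ →L[ℂ] ℂ))
    (fun x => Subsingleton.elim _ _)
    (fun _ _ => rfl)
  exact ⟨isEvenFredholmModule_evInfty X, isStarProjection_rieffelR X hφ hn, h.1, h.2⟩

end EvInfty

/-! ### Explicit coordinates on an n-dimensional subspace of ℓ²(ℤ) -/

section RieffelRange

/-- The coordinates on the range of `π_y(R_n)`: the vectors
`√φ(y) e_0 + √(1-φ(y)) e_{-n}, e_{-1}, …, e_{-n+1}` form an orthonormal basis. -/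
def rieffelCoord (n : ℕ) (a b : ℂ) : L2Z →L[ℂ] (Fin n → ℂ) :=
  ContinuousLinearMap.pi fun i =>
    if (i : ℕ) = 0 then a • lp.evalCLM ℂ (fun _ : ℤ => ℂ) 2 0
        + b • lp.evalCLM ℂ (fun _ : ℤ => ℂ) 2 (-n)
    else lp.evalCLM ℂ (fun _ : ℤ => ℂ) 2 (-(i : ℕ))

theorem rieffelCoord_apply (n : ℕ) (a b : ℂ) (x : L2Z) (i : Fin n) :
    rieffelCoord n a b x i = if (i : ℕ) = 0 then a * x 0 + b * x (-n) else x (-(i : ℕ)) := by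
  change (if (i : ℕ) = 0 then a • lp.evalCLM ℂ (fun _ : ℤ => ℂ) 2 0
        + b • lp.evalCLM ℂ (fun _ : ℤ => ℂ) 2 (-n)
    else lp.evalCLM ℂ (fun _ : ℤ => ℂ) 2 (-(i : ℕ))) x = _
  split_ifs <;> rfl

/-- The isometry of `ℂ^n` onto the range of `π_y(R_n)`. -/
def rieffelEmb {n : ℕ} (hn : 1 ≤ n) (a b : ℂ) : (Fin n → ℂ) →L[ℂ] L2Z :=
  LinearMap.toContinuousLinearMap
    { toFun := fun c => ⟨fun m => if h : -(n : ℤ) < m ∧ m ≤ 0 then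
          (if m = 0 then a else 1) * c ⟨(-m).toNat, by omega⟩
        else if m = -n then b * c ⟨0, hn⟩ else 0,
        memlp_of_finite (finite_Icc (-(n : ℤ)) 0) (fun m hm => by
          rw [mem_Icc] at hm
          rw [dif_neg (by omega), if_neg (by omega)])⟩
      map_add' := fun c d => by
        ext m
        change (if h : -(n : ℤ) < m ∧ m ≤ 0 then
              (if m = 0 then a else 1) * (c ⟨(-m).toNat, by omega⟩ + d ⟨(-m).toNat, by omega⟩)
            else if m = -n then b * (c ⟨0, hn⟩ + d ⟨0, hn⟩) else 0)
          = (if h : -(n : ℤ) < m ∧ m ≤ 0 then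
              (if m = 0 then a else 1) * c ⟨(-m).toNat, by omega⟩
            else if m = -n then b * c ⟨0, hn⟩ else 0)
          + (if h : -(n : ℤ) < m ∧ m ≤ 0 then
              (if m = 0 then a else 1) * d ⟨(-m).toNat, by omega⟩
            else if m = -n then b * d ⟨0, hn⟩ else 0)
        split_ifs <;> ring
      map_smul' := fun r c => by
        ext m
        change (if h : -(n : ℤ) < m ∧ m ≤ 0 then
              (if m = 0 then a else 1) * (r * c ⟨(-m).toNat, by omega⟩)
            else if m = -n then b * (r * c ⟨0, hn⟩) else 0)
          = r * (if h : -(n : ℤ) < m ∧ m ≤ 0 then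
              (if m = 0 then a else 1) * c ⟨(-m).toNat, by omega⟩
            else if m = -n then b * c ⟨0, hn⟩ else 0)
        split_ifs <;> ring }

theorem rieffelEmb_apply {n : ℕ} (hn : 1 ≤ n) (a b : ℂ) (c : Fin n → ℂ) (m : ℤ) :
    rieffelEmb hn a b c m = if h : -(n : ℤ) < m ∧ m ≤ 0 then
          (if m = 0 then a else 1) * c ⟨(-m).toNat, by omega⟩
        else if m = -n then b * c ⟨0, hn⟩ else 0 := rfl

theorem rieffelCoord_rieffelEmb {n : ℕ} (hn : 1 ≤ n) {a b : ℂ} (hab : a * a + b * b = 1)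
    (c : Fin n → ℂ) : rieffelCoord n a b (rieffelEmb hn a b c) = c := by
  ext i
  rw [rieffelCoord_apply]
  split_ifs with h
  · have hi : i = ⟨0, hn⟩ := Fin.ext h
    rw [rieffelEmb_apply, rieffelEmb_apply, dif_pos (by omega), dif_neg (by omega), if_pos rfl,
      if_pos rfl, ← mul_assoc, ← mul_assoc, hi]
    change a * a * c ⟨0, hn⟩ + b * b * c ⟨0, hn⟩ = _
    rw [← add_mul, hab, one_mul]
  · have := i.2
    rw [rieffelEmb_apply, dif_pos (by omega), if_neg (by omega), one_mul]
    congr 1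
    ext
    simp

end RieffelRange

/-! ### Pairings of 1 and R_n with the point module -/

section PointPairings

variable {q : ℝ} (X : QSpace q) {y : ℝ} (hy : y ∈ X.carrier)

/-- Both representations are unital, the second because Π_+ + Π_- = 1, so the pairing operator is
the identity. -/
theorem hasIndexPairing_piY_one (hy0 : 0 < y) :
    HasIndexPairing (piY X hy) (piZeroInfty X) (1 : Matrix (Fin 1) (Fin 1) (CzzOne X)) 0 := by
  have hker : LinearMap.ker (ContinuousLinearMap.id ℂ L2Z).toLinearMap = ⊥ := LinearMap.ker_id
  let e : (⊥ : Submodule ℂ L2Z) ≃ₗ[ℂ] (Fin 0 → ℂ) := 0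
  have hm : piY X hy 1 = ContinuousLinearMap.id ℂ L2Z := map_one (evalY X hy)
  have hp : piZeroInfty X 1 = ContinuousLinearMap.id ℂ L2Z := by
    rw [piZeroInfty_apply]
    change evalZero X 1 • PiPlus + evalInfty X 1 • PiMinus = 1
    rw [map_one, map_one, one_smul, one_smul, PiPlus_add_PiMinus]
  have h := pairing_of_rightInverse (πm := piY X hy) (πp := piZeroInfty X)
    (p := (1 : Matrix (Fin 1) (Fin 1) (CzzOne X))) (K := L2Z) (L := L2Z)
    (v := fun _ => .id ℂ L2Z) (v' := fun _ => .id ℂ L2Z)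
    (w := fun _ => .id ℂ L2Z) (w' := fun _ => .id ℂ L2Z)
    (fun i j => by
      rw [Subsingleton.elim i 0, Subsingleton.elim j 0, Matrix.one_apply_eq, hm]
      rfl)
    (fun x => by simp)
    (fun i j => by
      rw [Subsingleton.elim i 0, Subsingleton.elim j 0, Matrix.one_apply_eq, hp]
      rfl)
    (fun x => by simp)
    (D := .id ℂ L2Z) (fun x => by simp) (S := .id ℂ L2Z) (fun x => rfl)
    (n := 0) ((LinearEquiv.ofEq _ _ hker).trans e)
  exact ⟨isEvenFredholmModule_piY X hy hy0, .one _, h.1, h.2⟩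

variable {φ : ℝ → ℝ} (hφ : IsCutoff q φ) {n : ℕ} (hn : 1 ≤ n)

theorem evalY_rieffelR_apply (x : L2Z) (m : ℤ) :
    evalY X hy (rieffelR X hφ hn : CzzOne X) x m =
      (√(cutoffExt X φ (q ^ (m + n) * y) * (1 - cutoffExt X φ (q ^ (m + n) * y))) : ℝ) * x (m + n)
      + (cutoffExt X φ (q ^ m * y) - cutoffExt X φ (q ^ (m + n) * y) : ℝ) * x m
      + (√(cutoffExt X φ (q ^ m * y) * (1 - cutoffExt X φ (q ^ m * y))) : ℝ) * x (m - n) := by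
  have h1 : q ^ n * (q ^ m * y) = q ^ (m + n) * y := by
    rw [zpow_add₀ X.q_pos.ne', zpow_natCast]; ring
  rw [coe_rieffelR, star_gen_zpow, map_add, map_add]
  change evalY X hy (((gen X ^ (n : ℤ) : unitary (Univ X)) : Univ X) * fn X (hFun X hφ)) x m
    + evalY X hy (fn X (fFun X hφ hn)) x m
    + evalY X hy (fn X (hFun X hφ) * ((gen X ^ (-(n : ℤ)) : unitary (Univ X)) : Univ X)) x m = _
  rw [evalY_apply, evalY_fn_apply, map_mul, mul_apply_eq_comp, evalY_gen_zpow_apply,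
    evalY_fn_apply, hFun_pt, hFun_pt, fFun_pt, h1, sub_eq_add_neg m]

/-- Because q < y ≤ 1, exactly one orbit point, m = 0, can lie strictly inside the transition
interval: the extended cutoff is 0 for m > 0, 1 for m < 0, and some α at m = 0. Hence h survives
only at m = 0, and π_y(R_n) is the identity on e_m for -n < m < 0 together with the projection onto
√α e_0 + √(1-α) e_{-n}. -/
theorem evalY_rieffelR_eq (hyq : q < y) (hy1 : y ≤ 1) :
    evalY X hy (rieffelR X hφ hn : CzzOne X)
      = rieffelEmb hn (√(cutoffExt X φ y) : ℝ) (√(1 - cutoffExt X φ y) : ℝ)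
        ∘L rieffelCoord n (√(cutoffExt X φ y) : ℝ) (√(1 - cutoffExt X φ y) : ℝ) := by
  have hq := X.q_pos
  have hq1 := X.q_lt_one
  have hy0 : 0 < y := hq.trans hyq
  have hpos : ∀ m : ℤ, 0 < m → cutoffExt X φ (q ^ m * y) = 0 := fun m hm => by
    refine cutoffExt_of_le X hφ ?_
    have h1 : q ^ m ≤ q ^ (1 : ℤ) := zpow_le_zpow_right_of_le_one₀ hq hq1.le (by omega)
    rw [zpow_one] at h1
    have h2 : 0 < q ^ m := zpow_pos hq m
    nlinarith
  have hneg : ∀ m : ℤ, m < 0 → cutoffExt X φ (q ^ m * y) = 1 := fun m hm => by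
    refine cutoffExt_of_ge X hφ ?_
    have h1 : q ^ (-1 : ℤ) ≤ q ^ m := zpow_le_zpow_right_of_le_one₀ hq hq1.le (by omega)
    have h2 : q ^ (-1 : ℤ) * q = 1 := by rw [zpow_neg_one, inv_mul_cancel₀ hq.ne']
    have h3 : 0 < q ^ m := zpow_pos hq m
    nlinarith
  have hzero : cutoffExt X φ (q ^ (0 : ℤ) * y) = cutoffExt X φ y := by rw [zpow_zero, one_mul]
  set α := cutoffExt X φ y with hα
  have hα0 : 0 ≤ α := cutoffExt_nonneg X hφ y
  have hα1 : 0 ≤ 1 - α := sub_nonneg.2 (cutoffExt_le_one X hφ y)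
  have hsα : ((√α : ℝ) : ℂ) * (√α : ℝ) = α := by
    rw [← Complex.ofReal_mul, Real.mul_self_sqrt hα0]
  have hsα' : ((√(1 - α) : ℝ) : ℂ) * (√(1 - α) : ℝ) = 1 - α := by
    rw [← Complex.ofReal_mul, Real.mul_self_sqrt hα1]; push_cast; rfl
  have hsqrt : ((√(α * (1 - α)) : ℝ) : ℂ) = (√α : ℝ) * (√(1 - α) : ℝ) := by
    rw [Real.sqrt_mul hα0, Complex.ofReal_mul]
  ext x m
  rw [evalY_rieffelR_apply, ContinuousLinearMap.comp_apply, rieffelEmb_apply]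
  by_cases h1 : 0 < m
  · rw [hpos m h1, hpos (m + n) (by omega), dif_neg (by omega), if_neg (by omega)]
    simp
  by_cases h2 : m = 0
  · subst h2
    rw [hzero, hpos (0 + n) (by omega), dif_pos (by omega), if_pos rfl, rieffelCoord_apply,
      if_pos (by simp), mul_add, ← mul_assoc, ← mul_assoc, hsα, hsqrt, zero_sub]
    simp
  by_cases h3 : -(n : ℤ) < m
  · have h4 : ((-m).toNat : ℤ) = -m := Int.toNat_of_nonneg (by omega)
    rw [hneg m (by omega), hpos (m + n) (by omega), dif_pos (by omega), if_neg h2,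
      rieffelCoord_apply, if_neg (by simp only; omega)]
    simp only [h4]
    simp
  by_cases h5 : m = -n
  · subst h5
    rw [neg_add_cancel, hzero, hneg (-n) (by omega), dif_neg (by omega), if_pos rfl,
      rieffelCoord_apply, if_pos rfl, mul_add, ← mul_assoc, ← mul_assoc, hsα', hsqrt,
      mul_comm ((√α : ℝ) : ℂ)]
    simp
  · rw [hneg m (by omega), hneg (m + n) (by omega), dif_neg (by omega), if_neg h5]
    simp

/-- Both characters kill R_n since f_n and h vanish at 0 and ∞, so the index is the rank of
π_y(R_n). -/
theorem hasIndexPairing_piY_rieffelR (hyq : q < y) (hy1 : y ≤ 1) :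
    HasIndexPairing (piY X hy) (piZeroInfty X) !![rieffelR X hφ hn] n := by
  have hα0 : 0 ≤ cutoffExt X φ y := cutoffExt_nonneg X hφ y
  have hα1 : 0 ≤ 1 - cutoffExt X φ y := sub_nonneg.2 (cutoffExt_le_one X hφ y)
  have hab : ((√(cutoffExt X φ y) : ℝ) : ℂ) * (√(cutoffExt X φ y) : ℝ)
      + (√(1 - cutoffExt X φ y) : ℝ) * (√(1 - cutoffExt X φ y) : ℝ) = 1 := by
    rw [← Complex.ofReal_mul, ← Complex.ofReal_mul, Real.mul_self_sqrt hα0,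
      Real.mul_self_sqrt hα1]
    push_cast; ring
  have h := pairing_of_eq_zero (πm := piY X hy) (πp := piZeroInfty X) (p := !![rieffelR X hφ hn])
    (v := fun _ => rieffelEmb hn _ _) (v' := fun _ => rieffelCoord n _ _)
    (fun i j => by
      rw [Subsingleton.elim i 0, Subsingleton.elim j 0]
      exact evalY_rieffelR_eq X hy hφ hn hyq hy1)
    (fun x => by
      rw [Fin.sum_univ_one]
      exact rieffelCoord_rieffelEmb hn hab x)
    (fun i j => by
      rw [Subsingleton.elim i 0, Subsingleton.elim j 0]
      change piZeroInfty X (rieffelR X hφ hn) = 0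
      rw [piZeroInfty_apply, evalInfty_rieffelR, evalZero_rieffelR, zero_smul, zero_smul,
        add_zero])
  exact ⟨isEvenFredholmModule_piY X hy (X.q_pos.trans hyq), isStarProjection_rieffelR X hφ hn,
    h.1, h.2⟩

end PointPairings

end QPlane
end

theorem theorem4p2 {H : Type*} [NormedAddCommGroup H] [InnerProductSpace ℂ H] [CompleteSpace H]
    [Nontrivial H] (q : ℝ) (hq0 : 0 < q) (hq1 : q < 1)
    (z absz : H →ₗ.[ℂ] H) (hz : IsQNormal q z) (habs : IsModulus z absz) :
    ∃ X : QSpace q, X.carrier = realSpectrum absz ∧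
      ∀ (n : ℕ) (hn : 1 ≤ n) (φ : ℝ → ℝ) (hφ : IsCutoff q φ),
        (HasIndexPairing (evInftyRep X) 0 (bottPos X hn) 1 ∧
          HasIndexPairing (evInftyRep X) 0 (bottNeg X hn) 1 ∧
          HasIndexPairing (evInftyRep X) 0 !![rieffelR X hφ hn] 0 ∧
          HasIndexPairing (evInftyRep X) 0 (1 : Matrix (Fin 1) (Fin 1) (CzzOne X)) 1) ∧
        ∀ (y : ℝ) (hy : y ∈ X.carrier), q < y → y ≤ 1 →
          HasIndexPairing (piY X hy) (piZeroInfty X) (bottPos X hn) n ∧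
          HasIndexPairing (piY X hy) (piZeroInfty X) (bottNeg X hn) (-n) ∧
          HasIndexPairing (piY X hy) (piZeroInfty X) !![rieffelR X hφ hn] n ∧
          HasIndexPairing (piY X hy) (piZeroInfty X)
            (1 : Matrix (Fin 1) (Fin 1) (CzzOne X)) 0 := by
  obtain ⟨X, hX⟩ := exists_qSpace_of_isQNormal hq0 hq1 hz habs
  refine ⟨X, hX, fun n hn φ hφ => ?_⟩
  have hs := (Real.rpow_pos_of_pos hq0 (-((n : ℝ) / 2 * (n - 1)))).le
  have hs' := (Real.rpow_pos_of_pos hq0 ((n : ℝ) / 2 * (n + 1))).le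
  have hsc := bott_const_sq hq0 n
  have hsd := bott_const_sq' hq0 n
  have hcd := bott_const_scale hq0 n
  have hss := bott_const_scale' hq0 n
  have hc := q_zpow_pos X (-(n * (n - 1)))
  have hd := q_zpow_pos X (n * (n + 1))
  refine ⟨⟨?_, ?_, hasIndexPairing_evInfty_rieffelR X hφ hn, hasIndexPairing_evInfty_one X⟩,
    fun y hy hyq hy1 => ⟨?_, ?_, hasIndexPairing_piY_rieffelR X hy hφ hn hyq hy1,
      hasIndexPairing_piY_one X hy (hq0.trans hyq)⟩⟩
  · exact hasIndexPairing_evInfty_bott X hc hd hn (isStarProjection_of_factor X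
      (bottPosVec_mul_star X hc hd hn hs hsc hcd hss) (bottPosVec_norm X hc hn))
  · exact hasIndexPairing_evInfty_bott X hd hc hn (isStarProjection_of_factor X
      (bottNegVec_mul_star X hc hd hn hs' hsd hcd hss) (bottNegVec_norm X hd hn))
  · exact hasIndexPairing_bottPos X hy hc hd hn (hq0.trans hyq) hs hsc hcd hss
  · exact hasIndexPairing_bottNeg X hy hc hd hn (hq0.trans hyq) hs' hsd hcd hss
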